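/- Let $d\in\{2,3\}$, $\ell\in\{0,\dots,d-1\}$ and $\beta\in\left(-\frac{d-\ell}{2},\frac{d-\ell}{2}\right)$, let $\Omega\subset\mathbb R^d$ be a bounded connected open set with Lipschitz boundary, and let $c,\gamma_1,\gamma_2,\kappa,\tau>0$. Then there are constants $C>0$ and $\theta\in(0,1)$, depending only on $d,\ell,\beta,\Omega,c,\gamma_1,\gamma_2,\kappa,\tau$, such that the following holds for all data as described here. *Singular set.* $\Lambda\subset\Omega$ is nonempty, compact and $\ell$-dimensional in the sense that $c^{-1}r^\ell\le\mathcal H^\ell(\Lambda\cap \overline{B}(x,r))\le c\,r^\ell$ for all $x\in\Lambda$, $0<r\le\operatorname{diam}\Lambda$ (for example a point, a line fracture, a planar fracture). Put $d_\Lambda(x)=\operatorname{dist}(x,\Lambda)$ and $\|w\|_{L^2_\beta(S)}=\left(\int_S|w|^2d_\Lambda^{2\beta}\,dx\right)^{1/2}$. $H^1_\beta(\Omega)$ is the space of $u\in L^2_\beta(\Omega)$ with weak gradient $\nabla u\in L^2_\beta(\Omega;\mathbb R^d)$, and $H^1_{0,\beta}(\Omega)$ is the closure of $C_c^\infty(\Omega)$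 in it. *Coefficient.* $A\in L^\infty(\Omega)^{d\times d}$ is symmetric with $\gamma_1|\xi|^2\le A(x)\xi\cdot\xi\le\gamma_2|\xi|^2$ for a.e. $x\in\Omega$ and all $\xi\in\mathbb R^d$. *Mesh.* $\mathcal T_H$ is a finite conforming mesh of closed $d$-simplices with union $\overline\Omega$, shape regular (each $T$ contains a ball of radius $\kappa\operatorname{diam}T$) and quasi-uniform ($\operatorname{diam}T\le\tau\operatorname{diam}T'$ for all $T,T'$). $\mathcal N_{int}$ is the set of vertices of the mesh in $\Omega$, $V_H$ the space of continuous functions that are affine on each $T$ and vanish on $\partial\Omega$, and $\lambda_v$ the nodal $\mathbb P_1$ basis function of $v$. For $v\in\mathcal N_{int}$ let $\omega_v=\omega_{v,0}=\Omega\cap\bigcup_{T\ni v}T$ and $\omega_{v,k}=\Omega\cap\operatorname{int}\bigcup\{T\in\mathcal T_H : T\cap\overline{\omega_{v,k-1}}\ne\emptyset\}$ for $k\ge1$. *Fine-scale space.* For $v\in\mathcal N_{int}$ let $\mathcal P_vu\in V_H|_{\omega_v}$ be the weighted projection, $\int_{\omega_v}(\mathcal P_vu)\,g\,d_\Lambda^{2\beta}dx=\int_{\omega_v}u\,g\,d_\Lambda^{2\beta}dx$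 for all $g\in V_H|_{\omega_v}$. Put $\mathcal I_H^\beta u=\sum_{v\in\mathcal N_{int}}(\mathcal P_vu)(v)\lambda_v$, $V^f_\beta=\{w\in H^1_{0,\beta}(\Omega):\mathcal I^\beta_Hw=0\}$ and, for $S\subset\Omega$, $V^f_\beta(S)=\{w\in V^f_\beta: w=0\text{ a.e. on }\Omega\setminus S\}$. *Conclusion.* Let $v\in\mathcal N_{int}$, let $F$ be a bounded linear functional on $V^f_\beta$ with $F(w)=0$ for all $w\in V^f_\beta(\Omega\setminus\omega_{v,1})$, and let $u\in V^f_\beta$ satisfy $$\int_\Omega A\nabla u\cdot\nabla w\,d_\Lambda^{2\beta}\,dx=F(w)\qquad\text{for all }w\in V^f_\beta .$$ Then for every $k\in\mathbb N=\{0,1,2,\dots\}$ $$\|\nabla u\|_{L^2_\beta(\Omega\setminus\omega_{v,k})}\le C\,\theta^k\,\|\nabla u\|_{L^2_\beta(\Omega)} .$$ -/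

import Mathlib

open MeasureTheory Set
open scoped ENNReal ContDiff Gradient

noncomputable section

namespace DistWeightedLOD

/-- The Euclidean space `ℝ^d`. -/
abbrev E (d : ℕ) : Type := EuclideanSpace ℝ (Fin d)

/-! ### The domain and the singular set -/

/-- `Ω` has a Lipschitz boundary: near each boundary point, `Ω` is the strict epigraph, in some unit
direction `e`, of a Lipschitz function `g` of the component orthogonal to `e`. -/
def HasLipschitzBoundary {d : ℕ} (Ω : Set (E d)) : Prop :=
  ∀ x ∈ frontier Ω, ∃ (e : E d) (g : E d → ℝ) (L : NNReal) (r : ℝ),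
    ‖e‖ = 1 ∧ LipschitzWith L g ∧ 0 < r ∧
      ∀ y ∈ Metric.ball x r, (y ∈ Ω ↔ g (y - inner ℝ e y • e) < inner ℝ e y)

/-- A bounded Lipschitz domain: open, connected, bounded, with Lipschitz boundary. -/
structure IsLipschitzDomain {d : ℕ} (Ω : Set (E d)) : Prop where
  isOpen : IsOpen Ω
  isConnected : IsConnected Ω
  isBounded : Bornology.IsBounded Ω
  lipschitz : HasLipschitzBoundary Ω

/-- A nonempty compact set of dimension `ℓ`, quantitatively: the `ℓ`-dimensional Hausdorff measure
of the part of `Λ` in a ball centred on `Λ`, of radius `r ≤ diam Λ`, is comparable to `r ^ ℓ` with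
constant `c`. Every compact piecewise smooth `ℓ`-dimensional submanifold (a point, a polygonal line,
a planar polygon) satisfies this for some `c`, and `c` does not change when `Λ` is moved or scaled. -/
structure IsRegularSet {d : ℕ} (ℓ : ℕ) (c : ℝ) (Λ : Set (E d)) : Prop where
  isCompact : IsCompact Λ
  nonempty : Λ.Nonempty
  regular : ∀ x ∈ Λ, ∀ r : ℝ, 0 < r → r ≤ Metric.diam Λ →
    ENNReal.ofReal (c⁻¹ * r ^ ℓ) ≤ Measure.hausdorffMeasure (ℓ : ℝ) (Λ ∩ Metric.closedBall x r) ∧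
      Measure.hausdorffMeasure (ℓ : ℝ) (Λ ∩ Metric.closedBall x r) ≤ ENNReal.ofReal (c * r ^ ℓ)

/-! ### Distance-weighted Lebesgue and Sobolev spaces -/

section Spaces

variable {d : ℕ} (Ω Λ : Set (E d)) (β : ℝ)

/-- The measure `dist(x, Λ)^(2β) dx` on `Ω`. -/
def wMeasure : Measure (E d) :=
  (volume.restrict Ω).withDensity fun x => ENNReal.ofReal (Metric.infDist x Λ ^ (2 * β))

/-- The weighted space `L²_β(Ω)`. -/
abbrev L2 : Type := Lp ℝ 2 (wMeasure Ω Λ β)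

/-- The weighted space `L²_β(Ω; ℝ^d)`. -/
abbrev L2Vec : Type := Lp (E d) 2 (wMeasure Ω Λ β)

/-- `G` is the weak (distributional) gradient of `u` in `Ω`. -/
def HasWeakGradient (u : E d → ℝ) (G : E d → E d) : Prop :=
  LocallyIntegrableOn u Ω ∧ LocallyIntegrableOn G Ω ∧
    ∀ φ : E d → ℝ, ContDiff ℝ ∞ φ → HasCompactSupport φ → tsupport φ ⊆ Ω →
      ∫ x in Ω, u x • gradient φ x = - ∫ x in Ω, φ x • G x

variable {Ω} in
theorem HasWeakGradient.zero : HasWeakGradient Ω 0 0 := by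
  refine ⟨locallyIntegrableOn_zero, locallyIntegrableOn_zero, fun φ _ _ _ => by simp⟩

theorem integrableOn_smul_of_test {F : Type*} [NormedAddCommGroup F] [NormedSpace ℝ F]
    {Ω : Set (E d)} {f : E d → ℝ} {g : E d → F}
    (hf : Continuous f) (hc : HasCompactSupport f) (hs : tsupport f ⊆ Ω)
    (hg : LocallyIntegrableOn g Ω) : IntegrableOn (fun x => f x • g x) Ω := by
  have h1 : IntegrableOn (fun x => f x • g x) (tsupport f) :=
    (hg.integrableOn_compact_subset hs hc).continuousOn_smul hf.continuousOn hc
  have h2 : Integrable (fun x => f x • g x) := by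
    refine (integrableOn_iff_integrable_of_support_subset ?_).1 h1
    exact (Function.support_smul_subset_left f g).trans (subset_tsupport f)
  exact h2.integrableOn

theorem integrableOn_smul_of_test' {F : Type*} [NormedAddCommGroup F] [NormedSpace ℝ F]
    {Ω : Set (E d)} {f : E d → F} {g : E d → ℝ}
    (hf : Continuous f) (hc : HasCompactSupport f) (hs : tsupport f ⊆ Ω)
    (hg : LocallyIntegrableOn g Ω) : IntegrableOn (fun x => g x • f x) Ω := by
  have h1 : IntegrableOn (fun x => g x • f x) (tsupport f) :=
    (hg.integrableOn_compact_subset hs hc).smul_continuousOn hf.continuousOn hc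
  have h2 : Integrable (fun x => g x • f x) := by
    refine (integrableOn_iff_integrable_of_support_subset ?_).1 h1
    exact (Function.support_smul_subset_right g f).trans (subset_tsupport f)
  exact h2.integrableOn

theorem continuous_gradient {φ : E d → ℝ} (h : ContDiff ℝ ∞ φ) : Continuous (gradient φ) := by
  unfold gradient
  exact (InnerProductSpace.toDual ℝ (E d)).symm.continuous.comp (h.continuous_fderiv (by simp))

theorem tsupport_gradient_subset (φ : E d → ℝ) : tsupport (gradient φ) ⊆ tsupport φ := by
  refine closure_minimal ?_ (isClosed_tsupport φ)
  intro x hx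
  refine support_fderiv_subset ℝ (f := φ) ?_
  intro h
  exact hx (by simp [gradient, h])

variable {Ω} in
theorem HasWeakGradient.add {u v : E d → ℝ} {G K : E d → E d}
    (hu : HasWeakGradient Ω u G) (hv : HasWeakGradient Ω v K) :
    HasWeakGradient Ω (u + v) (G + K) := by
  refine ⟨hu.1.add hv.1, hu.2.1.add hv.2.1, fun φ h1 h2 h3 => ?_⟩
  have hg := continuous_gradient h1
  have hgs := tsupport_gradient_subset φ
  have hgc : HasCompactSupport (gradient φ) := h2.of_isClosed_subset (isClosed_tsupport _) hgs
  have e1 := hu.2.2 φ h1 h2 h3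
  have e2 := hv.2.2 φ h1 h2 h3
  simp only [Pi.add_apply, add_smul, smul_add]
  rw [integral_add (integrableOn_smul_of_test' hg hgc (hgs.trans h3) hu.1)
      (integrableOn_smul_of_test' hg hgc (hgs.trans h3) hv.1),
    integral_add (integrableOn_smul_of_test h1.continuous h2 h3 hu.2.1)
      (integrableOn_smul_of_test h1.continuous h2 h3 hv.2.1), e1, e2, neg_add]

variable {Ω} in
theorem HasWeakGradient.smul (c : ℝ) {u : E d → ℝ} {G : E d → E d}
    (hu : HasWeakGradient Ω u G) : HasWeakGradient Ω (c • u) (c • G) := by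
  refine ⟨hu.1.smul c, hu.2.1.smul c, fun φ h1 h2 h3 => ?_⟩
  have e1 := hu.2.2 φ h1 h2 h3
  simp only [Pi.smul_apply, smul_eq_mul, mul_smul]
  rw [integral_smul, e1, smul_neg, ← integral_smul]
  simp only [smul_comm c]

/-- The weighted Sobolev space `H¹_β(Ω)`, as the space of pairs `(u, ∇u)` in
`L²_β(Ω) × L²_β(Ω; ℝ^d)`, where `∇u` is the weak gradient of `u`. -/
def H1 : Submodule ℝ (L2 Ω Λ β × L2Vec Ω Λ β) where
  carrier := {p | ∃ (u : E d → ℝ) (G : E d → E d),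
    p.1 =ᵐ[wMeasure Ω Λ β] u ∧ p.2 =ᵐ[wMeasure Ω Λ β] G ∧ HasWeakGradient Ω u G}
  zero_mem' := ⟨0, 0, Lp.coeFn_zero _ _ _, Lp.coeFn_zero _ _ _, HasWeakGradient.zero⟩
  add_mem' := by
    rintro p q ⟨u, G, h1, h2, h3⟩ ⟨v, K, h4, h5, h6⟩
    exact ⟨u + v, G + K, (Lp.coeFn_add _ _).trans (h1.add h4),
      (Lp.coeFn_add _ _).trans (h2.add h5), h3.add h6⟩
  smul_mem' := by
    rintro c p ⟨u, G, h1, h2, h3⟩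
    exact ⟨c • u, c • G, (Lp.coeFn_smul _ _).trans (h1.const_smul c),
      (Lp.coeFn_smul _ _).trans (h2.const_smul c), h3.smul c⟩

/-- The pairs `(φ, ∇φ)` with `φ ∈ C_c^∞(Ω)`. -/
def testPairs : Set (L2 Ω Λ β × L2Vec Ω Λ β) :=
  {p | ∃ φ : E d → ℝ, ContDiff ℝ ∞ φ ∧ HasCompactSupport φ ∧ tsupport φ ⊆ Ω ∧
    p.1 =ᵐ[wMeasure Ω Λ β] φ ∧ p.2 =ᵐ[wMeasure Ω Λ β] gradient φ}

/-- The space `H¹_{0,β}(Ω)` of functions in `H¹_β(Ω)` that vanish on `∂Ω`: the closure of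
`C_c^∞(Ω)` in `H¹_β(Ω)`. -/
def H10 : Submodule ℝ (L2 Ω Λ β × L2Vec Ω Λ β) :=
  H1 Ω Λ β ⊓ (Submodule.span ℝ (testPairs Ω Λ β)).topologicalClosure

/-- The weighted norm `‖G‖_{L²_β(S)} = (∫_S |G|² dist(x, Λ)^(2β) dx)^(1/2)`, `S ⊆ Ω`. -/
def normOn {Ω Λ : Set (E d)} {β : ℝ} (S : Set (E d)) (G : L2Vec Ω Λ β) : ℝ :=
  √(∫ x in S, ‖G x‖ ^ 2 ∂(wMeasure Ω Λ β))

end Spaces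

/-! ### The coarse mesh and its `P₁` finite elements -/

/-- A conforming simplicial mesh of `Ω`: a finite simplicial complex with underlying space the
closure of `Ω`. -/
structure Mesh {d : ℕ} (Ω : Set (E d)) where
  /-- the simplicial complex of all simplices of the mesh, of all dimensions -/
  cplx : Geometry.SimplicialComplex ℝ (E d)
  finite : cplx.faces.Finite
  space_eq : cplx.space = closure Ω

/-- The barycentric coordinate of `x` at the vertex `v` of the simplex with vertex set `s`
(and `0` for `x` outside of the simplex). -/
def bary {d : ℕ} (s : Finset (E d)) (v x : E d) : ℝ :=
  open Classical in
  if h : x ∈ convexHull ℝ (s : Set (E d)) then (Finset.mem_convexHull'.1 h).choose v else 0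

namespace Mesh

variable {d : ℕ} {Ω : Set (E d)} (M : Mesh Ω)

/-- The elements `T` of the mesh, given by their vertex sets: the simplices of full dimension. -/
def elements : Set (Finset (E d)) := {s | s ∈ M.cplx.faces ∧ s.card = d + 1}

/-- Shape regularity with constant `κ`: each element `T` contains a ball of radius `κ diam T`. -/
def IsShapeRegular (κ : ℝ) : Prop :=
  ∀ s ∈ M.elements, ∃ x,
    Metric.closedBall x (κ * Metric.diam (s : Set (E d))) ⊆ convexHull ℝ (s : Set (E d))

/-- Quasi-uniformity with constant `τ`: the diameters of any two elements are comparable. -/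
def IsQuasiUniform (τ : ℝ) : Prop :=
  ∀ s ∈ M.elements, ∀ t ∈ M.elements,
    Metric.diam (s : Set (E d)) ≤ τ * Metric.diam (t : Set (E d))

theorem finite_vertices : M.cplx.vertices.Finite :=
  M.finite.preimage (Finset.singleton_injective.injOn)

/-- The interior nodes: the vertices of the mesh that lie in `Ω`. -/
def intNodes : Finset (E d) :=
  open Classical in M.finite_vertices.toFinset.filter (· ∈ Ω)

/-- The `P₁` nodal basis function of the node `v`: at a point `x` of a simplex with vertex `v` its
value is the barycentric coordinate of `x` at `v`, and it is `0` elsewhere. -/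
def hat (v x : E d) : ℝ :=
  open Classical in
  if h : ∃ s ∈ M.cplx.faces, v ∈ s ∧ x ∈ convexHull ℝ (s : Set (E d)) then bary h.choose v x else 0

/-- The coarse space `V_H`: the continuous functions that are affine on each element and vanish on
`∂Ω` (they are extended by `0` outside of `Ω`). -/
def VH : Submodule ℝ (E d → ℝ) where
  carrier := {g | Continuous g ∧ (∀ x, x ∉ Ω → g x = 0) ∧
    ∀ s ∈ M.elements, ∃ a : E d →ᵃ[ℝ] ℝ, EqOn g a (convexHull ℝ (s : Set (E d)))}
  zero_mem' := ⟨continuous_const, fun _ _ => rfl, fun _ _ => ⟨0, fun _ _ => rfl⟩⟩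
  add_mem' := by
    rintro f g ⟨h1, h2, h3⟩ ⟨h4, h5, h6⟩
    refine ⟨h1.add h4, fun x hx => by simp [h2 x hx, h5 x hx], fun s hs => ?_⟩
    obtain ⟨a, ha⟩ := h3 s hs
    obtain ⟨b, hb⟩ := h6 s hs
    exact ⟨a + b, fun x hx => by simp [ha hx, hb hx]⟩
  smul_mem' := by
    rintro c g ⟨h1, h2, h3⟩
    refine ⟨h1.const_smul c, fun x hx => by simp [h2 x hx], fun s hs => ?_⟩
    obtain ⟨a, ha⟩ := h3 s hs
    exact ⟨c • a, fun x hx => by simp [ha hx]⟩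

/-- The patches `ω_{v,k}`: `ω_{v,0}` is the part in `Ω` of the union of the elements with vertex
`v`, and `ω_{v,k+1}` is the part in `Ω` of the interior of the union of the elements that meet the
closure of `ω_{v,k}`. -/
def patch (v : E d) : ℕ → Set (E d)
  | 0 => (⋃ s ∈ {s | s ∈ M.elements ∧ v ∈ s}, convexHull ℝ (s : Set (E d))) ∩ Ω
  | k + 1 => interior (⋃ s ∈ {s | s ∈ M.elements ∧
      (convexHull ℝ (s : Set (E d)) ∩ closure (patch v k)).Nonempty},
        convexHull ℝ (s : Set (E d))) ∩ Ω

/-! ### Quasi-interpolation and the fine-scale space -/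

variable (Λ : Set (E d)) (β : ℝ)

/-- `P` is the weighted `L²` projection onto `V_H` restricted to the patch `ω_v`. An element of
`V_H|_{ω_v}` is represented by an element of `V_H`; only its restriction to `ω_v` is determined. -/
def IsLocalProj (v : E d) (P : L2 Ω Λ β →ₗ[ℝ] M.VH) : Prop :=
  ∀ (u : L2 Ω Λ β) (g : M.VH),
    ∫ x in M.patch v 0, (P u : E d → ℝ) x * (g : E d → ℝ) x ∂(wMeasure Ω Λ β) =
      ∫ x in M.patch v 0, u x * (g : E d → ℝ) x ∂(wMeasure Ω Λ β)

/-- The weighted local projection `P_v : L²_β → V_H|_{ω_v}`. -/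
def localProj (v : E d) : L2 Ω Λ β →ₗ[ℝ] M.VH :=
  open Classical in if h : ∃ P, M.IsLocalProj Λ β v P then h.choose else 0

/-- The quasi-interpolation operator `u ↦ ∑_v (P_v u)(v) λ_v`, the sum over the interior nodes. -/
def quasiInterp : L2 Ω Λ β →ₗ[ℝ] (E d → ℝ) where
  toFun u x := ∑ v ∈ M.intNodes, (M.localProj Λ β v u : E d → ℝ) v * M.hat v x
  map_add' u w := by
    funext x
    simp [add_mul, Finset.sum_add_distrib]
  map_smul' c u := by
    funext x
    simp [mul_assoc, Finset.mul_sum]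

/-- The fine-scale space `V^f_β`: the kernel of the quasi-interpolation in `H¹_{0,β}(Ω)`. -/
def fineSpace : Submodule ℝ (L2 Ω Λ β × L2Vec Ω Λ β) :=
  H10 Ω Λ β ⊓ LinearMap.ker (M.quasiInterp Λ β ∘ₗ LinearMap.fst ℝ _ _)

/-- The localized fine-scale space `V^f_β(S) = {w ∈ V^f_β | w = 0 on Ω \ S}`. -/
def fineSpaceOn (S : Set (E d)) : Set (M.fineSpace Λ β) :=
  {w | ∀ᵐ x ∂(wMeasure Ω Λ β), x ∈ Ω \ S → w.1.1 x = 0}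

end Mesh

/-! ### The diffusion coefficient -/

/-- A coefficient `A ∈ L^∞(Ω)^{d×d}`, symmetric, with `γ₁|ξ|² ≤ ⟨A(x)ξ, ξ⟩ ≤ γ₂|ξ|²` for almost
every `x ∈ Ω` and all `ξ`; the upper bound makes the entries essentially bounded. -/
structure IsCoefficient {d : ℕ} (Ω : Set (E d)) (γ₁ γ₂ : ℝ)
    (A : E d → Matrix (Fin d) (Fin d) ℝ) : Prop where
  aemeasurable : ∀ i j, AEMeasurable (fun x => A x i j) (volume.restrict Ω)
  symm : ∀ᵐ x ∂(volume.restrict Ω), (A x).IsSymm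
  bounds : ∀ᵐ x ∂(volume.restrict Ω), ∀ ξ : E d,
    γ₁ * ‖ξ‖ ^ 2 ≤ inner ℝ (Matrix.toEuclideanCLM (n := Fin d) (𝕜 := ℝ) (A x) ξ) ξ ∧
      inner ℝ (Matrix.toEuclideanCLM (n := Fin d) (𝕜 := ℝ) (A x) ξ) ξ ≤ γ₂ * ‖ξ‖ ^ 2

/-- The weighted bilinear form `∫_Ω A G · K dist(x, Λ)^(2β) dx` on vector fields. -/
def energy {d : ℕ} {Ω Λ : Set (E d)} {β : ℝ} (A : E d → Matrix (Fin d) (Fin d) ℝ)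
    (G K : L2Vec Ω Λ β) : ℝ :=
  ∫ x, inner ℝ (Matrix.toEuclideanCLM (n := Fin d) (𝕜 := ℝ) (A x) (G x)) (K x)
    ∂(wMeasure Ω Λ β)

end DistWeightedLOD

end

open MeasureTheory Set
open scoped ENNReal ContDiff Gradient

noncomputable section

namespace DistWeightedLOD

open scoped NNReal
open Metric (infDist closedBall ball diam)

/-! ### Distance weights -/

section Weights

variable {d ℓ : ℕ} {c : ℝ} {Λ : Set (E d)}

/-! For |β| < (d - ℓ)/2 the weight dist(·, Λ)^(2β) belongs to the Muckenhoupt class A₂, with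
constants that depend on Λ only through ℓ and c. The Caccioppoli argument for exponential decay of
correctors therefore works in the weighted spaces, uniformly in Λ, in the coefficient and in the
mesh.

Weight. A volume bound for tubes about Λ gives the A₁ property of the negative powers of the
distance (`lintegral_infDist_rpow_le`). It yields A₂ (`exists_lintegral_weight_mul_le`) and the
boundedness of averages over balls of a fixed radius (`exists_weighted_averaging`), and the latter
yields weighted Poincaré and Friedrichs inequalities on balls.

Fine-scale functions are small: on a ball of radius H, the norm of p is at most a constant times H
times the norm of ∇p on the ball of radius 5H (`Mesh.exists_local_estimate`). Near ∂Ω this is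
Friedrichs' inequality, because a Lipschitz domain leaves a fixed share of each such ball uncovered.
Inside Ω it is Poincaré's inequality: the local projections reproduce constants there and the nodal
values of the quasi-interpolation of p are zero, which controls the mean of p.

Decay. Let η be a cutoff in the Euclidean distance to v. Since the quasi-interpolation I_H is a
projection onto V_H, w = ηu - I_H(ηu) is again a fine-scale function (`Mesh.exists_truncation`); it
vanishes on ω_{v,1}, so F(w) = 0, and ∇w differs from η∇u only in an annulus of width of order H, by
an amount bounded by ∇u there. Testing with w and filling the hole gives a fixed factor θ < 1 for
each increase of the radius by 20H (`exists_energy_decay`).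

Geometry. Euclidean balls are compared with patches by `Mesh.exists_ball_subset_patch`: Lipschitz
domains are quasiconvex, so a point of Ω at distance r from v is joined to v by a number of segments
of length at most H that grows linearly in r/H, and each segment is absorbed by a bounded number of
mesh layers. -/

theorem volume_closedBall_eq (x : E d) {r : ℝ} (hr : 0 ≤ r) :
    volume (closedBall x r) = ENNReal.ofReal (r ^ d) * volume (closedBall (0 : E d) 1) := by
  simpa using Measure.addHaar_closedBall' (volume : Measure (E d)) x hr

/-- Fubini for Lebesgue measure against ν, the ℓ-dimensional Hausdorff measure on Λ. Each point of
the tube sees ν-mass at least s^ℓ/c within distance 2s, each point of Λ sees volume of order s^d,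
and the points of Λ involved lie in the ball of radius 3R about z, of ν-mass at most c(3R)^ℓ. -/
theorem volume_tube_le (d ℓ : ℕ) {c : ℝ} (hc : 0 < c) : ∃ C : ℝ≥0, ∀ Λ : Set (E d),
    IsRegularSet ℓ c Λ → ∀ z ∈ Λ, ∀ s R : ℝ, 0 < s → s ≤ R →
      volume (closedBall z R ∩ {y | infDist y Λ ≤ s}) ≤
        C * ENNReal.ofReal (s ^ d * (R / s) ^ ℓ) := by
  set V := volume (closedBall (0 : E d) 1) with hV
  have hVt : V ≠ ⊤ := measure_closedBall_lt_top.ne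
  have hCt : ENNReal.ofReal (2 ^ d * (1 + c ^ 2 * 3 ^ ℓ)) * V ≠ ⊤ :=
    ENNReal.mul_ne_top ENNReal.ofReal_ne_top hVt
  refine ⟨(ENNReal.ofReal (2 ^ d * (1 + c ^ 2 * 3 ^ ℓ)) * V).toNNReal, ?_⟩
  intro Λ hΛ z hz s R hs hsR
  rw [ENNReal.coe_toNNReal hCt]
  have hR : 0 < R := hs.trans_le hsR
  have hRs : 1 ≤ (R / s) ^ ℓ := one_le_pow₀ ((one_le_div hs).2 hsR)
  have key : ∀ y, infDist y Λ ≤ s → ∃ p ∈ Λ, dist y p ≤ s := by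
    intro y hy
    obtain ⟨p, hp, h⟩ := hΛ.isCompact.exists_infDist_eq_dist hΛ.nonempty y
    exact ⟨p, hp, h ▸ hy⟩
  -- Regularity speaks only of radii up to diam Λ. If s exceeds it, for instance if Λ is a point,
  -- the tube lies in a single ball of radius 2s.
  rcases lt_or_ge (diam Λ) s with hdiam | hdiam
  · have hsub : closedBall z R ∩ {y | infDist y Λ ≤ s} ⊆ closedBall z (2 * s) := by
      rintro y ⟨_, hy⟩
      obtain ⟨p, hp, h⟩ := key y hy
      have := Metric.dist_le_diam_of_mem hΛ.isCompact.isBounded hp hz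
      rw [Metric.mem_closedBall]
      linarith [dist_triangle y p z]
    refine (measure_mono hsub).trans ?_
    rw [volume_closedBall_eq _ (by positivity), mul_assoc, mul_comm V, ← mul_assoc,
      ← ENNReal.ofReal_mul (by positivity)]
    gcongr
    rw [mul_pow, mul_assoc]
    have h1 : s ^ d ≤ s ^ d * (R / s) ^ ℓ := le_mul_of_one_le_right (by positivity) hRs
    have h2 : s ^ d * (R / s) ^ ℓ ≤ (1 + c ^ 2 * 3 ^ ℓ) * (s ^ d * (R / s) ^ ℓ) :=
      le_mul_of_one_le_left (by positivity) (le_add_of_nonneg_right (by positivity))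
    gcongr
    exact h1.trans h2
  · set ν : Measure (E d) := (Measure.hausdorffMeasure (ℓ : ℝ)).restrict Λ with hν
    have hdp : 0 < diam Λ := hs.trans_le hdiam
    have hΛm : MeasurableSet Λ := hΛ.isCompact.isClosed.measurableSet
    have hνapp : ∀ S, MeasurableSet S →
        ν S = Measure.hausdorffMeasure (ℓ : ℝ) (Λ ∩ S) := fun S hS => by
      rw [hν, Measure.restrict_apply hS, inter_comm]
    have hall : Λ ∩ closedBall z (diam Λ) = Λ := by
      refine inter_eq_left.2 fun p hp => ?_
      exact Metric.dist_le_diam_of_mem hΛ.isCompact.isBounded hp hz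
    have hνfin : IsFiniteMeasure ν := by
      refine ⟨?_⟩
      rw [hνapp _ MeasurableSet.univ, inter_univ, ← hall]
      exact ((hΛ.regular z hz _ hdp le_rfl).2).trans_lt ENNReal.ofReal_lt_top
    have hup : ν (closedBall z (3 * R)) ≤ ENNReal.ofReal (c * (3 * R) ^ ℓ) := by
      rw [hνapp _ Metric.isClosed_closedBall.measurableSet]
      -- If 3R exceeds the diameter, regularity is used at radius diam Λ, where the ball already
      -- contains all of Λ.
      rcases le_total (3 * R) (diam Λ) with h | h
      · exact (hΛ.regular z hz _ (by positivity) h).2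
      · refine (measure_mono inter_subset_left).trans ?_
        rw [← hall]
        refine (hΛ.regular z hz _ hdp le_rfl).2.trans ?_
        gcongr
    set S := closedBall z R ∩ {y | infDist y Λ ≤ s} with hS
    have hSm : MeasurableSet S := by
      refine (Metric.isClosed_closedBall.inter ?_).measurableSet
      exact isClosed_le (Metric.continuous_infDist_pt Λ) continuous_const
    have hlow : ∀ y ∈ S, ENNReal.ofReal (c⁻¹ * s ^ ℓ) ≤ ν (closedBall y (2 * s)) := by
      rintro y ⟨_, hy⟩
      obtain ⟨p, hp, h⟩ := key y hy
      rw [hνapp _ Metric.isClosed_closedBall.measurableSet]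
      refine (hΛ.regular p hp s hs hdiam).1.trans (measure_mono ?_)
      refine inter_subset_inter_right _ fun x hx => ?_
      rw [Metric.mem_closedBall] at hx ⊢
      linarith [dist_triangle x p y, dist_comm p y]
    have hm : MeasurableSet {q : E d × E d | dist q.1 q.2 ≤ 2 * s} :=
      (isClosed_le (continuous_fst.dist continuous_snd) continuous_const).measurableSet
    have h1 : ENNReal.ofReal (c⁻¹ * s ^ ℓ) * volume S ≤
        ∫⁻ y in S, ∫⁻ p, {q : E d × E d | dist q.1 q.2 ≤ 2 * s}.indicator 1 (y, p) ∂ν := by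
      rw [← setLIntegral_const]
      refine setLIntegral_mono' hSm fun y hy => ?_
      refine (hlow y hy).trans (le_of_eq ?_)
      rw [← lintegral_indicator_one Metric.isClosed_closedBall.measurableSet]
      refine lintegral_congr fun p => ?_
      simp [indicator, dist_comm p y]
    have h2 : ∫⁻ y in S, ∫⁻ p, {q : E d × E d | dist q.1 q.2 ≤ 2 * s}.indicator 1 (y, p) ∂ν =
        ∫⁻ p, (∫⁻ y in S, {q : E d × E d | dist q.1 q.2 ≤ 2 * s}.indicator 1 (y, p)) ∂ν := by
      refine lintegral_lintegral_swap (Measurable.aemeasurable ?_)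
      exact measurable_one.indicator hm
    have h3 : ∫⁻ p, (∫⁻ y in S, {q : E d × E d | dist q.1 q.2 ≤ 2 * s}.indicator 1 (y, p)) ∂ν ≤
        ∫⁻ p in closedBall z (3 * R), ENNReal.ofReal ((2 * s) ^ d) * V ∂ν := by
      rw [← lintegral_indicator Metric.isClosed_closedBall.measurableSet]
      refine lintegral_mono fun p => ?_
      by_cases hp : p ∈ closedBall z (3 * R)
      · rw [indicator_of_mem hp, ← volume_closedBall_eq p (by positivity),
          ← lintegral_indicator_one Metric.isClosed_closedBall.measurableSet]
        refine (setLIntegral_le_lintegral _ _).trans (lintegral_mono fun y => le_of_eq ?_)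
        simp [indicator]
      -- A point at distance more than 3R from z has distance more than 2s from the tube, because s
      -- ≤ R.
      · rw [indicator_of_notMem hp, nonpos_iff_eq_zero]
        rw [setLIntegral_eq_zero_iff hSm]
        · refine Filter.Eventually.of_forall fun y hy => ?_
          simp only [indicator, mem_ofPred_eq, Pi.one_apply, ite_eq_right_iff, one_ne_zero,
            imp_false, not_le]
          by_contra! h
          have := hy.1
          rw [Metric.mem_closedBall] at hp this
          linarith [dist_triangle p y z, dist_comm p y]
        · exact (measurable_one.indicator hm).comp measurable_prodMk_right
    have h4 : ENNReal.ofReal (c⁻¹ * s ^ ℓ) * volume S ≤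
        ENNReal.ofReal ((2 * s) ^ d) * V * ENNReal.ofReal (c * (3 * R) ^ ℓ) := by
      refine h1.trans (h2.trans_le (h3.trans ?_))
      rw [setLIntegral_const]
      gcongr
    have hpos : 0 < c⁻¹ * s ^ ℓ := by positivity
    have h5 : volume S ≤ ENNReal.ofReal (c⁻¹ * s ^ ℓ)⁻¹ *
        (ENNReal.ofReal ((2 * s) ^ d) * V * ENNReal.ofReal (c * (3 * R) ^ ℓ)) := by
      refine le_trans (le_of_eq ?_) (mul_le_mul_right h4 _)
      rw [← mul_assoc, ← ENNReal.ofReal_mul (by positivity), inv_mul_cancel₀ hpos.ne']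
      simp
    refine h5.trans ?_
    have e : ENNReal.ofReal (c⁻¹ * s ^ ℓ)⁻¹ * (ENNReal.ofReal ((2 * s) ^ d) * V *
        ENNReal.ofReal (c * (3 * R) ^ ℓ)) =
        ENNReal.ofReal ((c⁻¹ * s ^ ℓ)⁻¹ * (2 * s) ^ d * (c * (3 * R) ^ ℓ)) * V := by
      rw [ENNReal.ofReal_mul (p := (c⁻¹ * s ^ ℓ)⁻¹ * (2 * s) ^ d) (by positivity),
        ENNReal.ofReal_mul (p := (c⁻¹ * s ^ ℓ)⁻¹) (by positivity)]
      ring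
    rw [e, mul_right_comm (ENNReal.ofReal (2 ^ d * _)) V, ← ENNReal.ofReal_mul (by positivity)]
    refine mul_le_mul_left (ENNReal.ofReal_le_ofReal ?_) _
    have : (c⁻¹ * s ^ ℓ)⁻¹ * (2 * s) ^ d * (c * (3 * R) ^ ℓ) =
        2 ^ d * (c ^ 2 * 3 ^ ℓ) * (s ^ d * (R / s) ^ ℓ) := by
      rw [mul_pow, mul_pow, div_pow]
      field_simp
    rw [this]
    gcongr
    linarith

theorem IsRegularSet.isClosed (hΛ : IsRegularSet ℓ c Λ) : IsClosed Λ := hΛ.isCompact.isClosed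

theorem IsRegularSet.infDist_pos (hΛ : IsRegularSet ℓ c Λ) {x : E d} (hx : x ∉ Λ) :
    0 < infDist x Λ :=
  (hΛ.isClosed.notMem_iff_infDist_pos hΛ.nonempty).1 hx

theorem measurable_ofReal_infDist_rpow (Λ : Set (E d)) (a : ℝ) :
    Measurable fun x => ENNReal.ofReal (infDist x Λ ^ a) :=
  ((Metric.continuous_infDist_pt Λ).measurable.pow_const a).ennreal_ofReal

/-- Dyadic decomposition in the distance to Λ: the part of the ball within R/2^j of Λ has volume of
order R^d 2^(-j(d-ℓ)), and on the j-th shell the integrand is of order R^(-a) 2^(ja). The resulting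
series is geometric with ratio 2^(a+ℓ-d) < 1. -/
theorem lintegral_infDist_rpow_centered (hc : 0 < c) {a : ℝ} (ha : 0 ≤ a) (had : a < (d : ℝ) - ℓ) :
    ∃ C : ℝ≥0, ∀ Λ : Set (E d), IsRegularSet ℓ c Λ → ∀ z ∈ Λ, ∀ R : ℝ, 0 < R →
      ∫⁻ y in closedBall z R, ENNReal.ofReal (infDist y Λ ^ (-a)) ≤
        C * ENNReal.ofReal (R ^ d * R ^ (-a)) := by
  obtain ⟨C, hC⟩ := volume_tube_le d ℓ hc
  set θ : ℝ := 2 ^ (a + ℓ - d) with hθ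
  have hθ1 : θ < 1 := Real.rpow_lt_one_of_one_lt_of_neg (by norm_num) (by linarith)
  have hθ0 : 0 < θ := by positivity
  have hfin : (C : ℝ≥0∞) * ENNReal.ofReal (2 ^ a) * (1 - ENNReal.ofReal θ)⁻¹ ≠ ⊤ := by
    refine ENNReal.mul_ne_top (ENNReal.mul_ne_top ENNReal.coe_ne_top ENNReal.ofReal_ne_top) ?_
    rw [ENNReal.inv_ne_top]
    exact (tsub_pos_of_lt (by simpa using hθ1)).ne'
  refine ⟨((C : ℝ≥0∞) * ENNReal.ofReal (2 ^ a) * (1 - ENNReal.ofReal θ)⁻¹).toNNReal, ?_⟩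
  intro Λ hΛ z hz R hR
  rw [ENNReal.coe_toNNReal hfin]
  set T : ℕ → Set (E d) := fun j => {y | infDist y Λ ≤ R * (1 / 2) ^ j} with hT
  have hTm : ∀ j, MeasurableSet (T j) := fun j =>
    (isClosed_le (Metric.continuous_infDist_pt Λ) continuous_const).measurableSet
  have hpt : ∀ y ∈ closedBall z R, ENNReal.ofReal (infDist y Λ ^ (-a)) ≤
      ∑' j, (T j).indicator (fun _ => ENNReal.ofReal ((R * (1 / 2) ^ (j + 1)) ^ (-a))) y := by
    intro y hy
    have hyR : infDist y Λ ≤ R := (Metric.infDist_le_dist_of_mem hz).trans hy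
    rcases (Metric.infDist_nonneg (x := y) (s := Λ)).eq_or_lt with h0 | h0
    -- On Λ itself the real power has the value 1 for a = 0 and the default value 0 for a > 0.
    · rcases ha.eq_or_lt with ha0 | ha0
      · refine le_trans ?_ (ENNReal.le_tsum 0)
        rw [indicator_of_mem (by simpa [hT] using hyR)]
        simp [← ha0]
      · rw [← h0, Real.zero_rpow (by linarith)]
        simp
    · obtain ⟨j, hj1, hj2⟩ := exists_nat_pow_near_of_lt_one (div_pos h0 hR)
        ((div_le_one hR).2 hyR) (show (0 : ℝ) < 1 / 2 by norm_num) (by norm_num)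
      refine le_trans ?_ (ENNReal.le_tsum j)
      rw [div_le_iff₀ hR] at hj2
      rw [lt_div_iff₀ hR] at hj1
      rw [indicator_of_mem (by simp only [hT, mem_ofPred_eq]; linarith)]
      refine ENNReal.ofReal_le_ofReal ?_
      exact Real.rpow_le_rpow_of_nonpos (by positivity) (by linarith) (by linarith)
  calc ∫⁻ y in closedBall z R, ENNReal.ofReal (infDist y Λ ^ (-a))
      ≤ ∫⁻ y in closedBall z R, ∑' j, (T j).indicator
          (fun _ => ENNReal.ofReal ((R * (1 / 2) ^ (j + 1)) ^ (-a))) y :=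
        setLIntegral_mono' Metric.isClosed_closedBall.measurableSet hpt
    _ = ∑' j, ENNReal.ofReal ((R * (1 / 2) ^ (j + 1)) ^ (-a)) * volume (closedBall z R ∩ T j) := by
        rw [lintegral_tsum fun j => (measurable_const.indicator (hTm j)).aemeasurable]
        refine tsum_congr fun j => ?_
        rw [lintegral_indicator (hTm j), setLIntegral_const, Measure.restrict_apply (hTm j),
          inter_comm]
    _ ≤ ∑' j, (C * ENNReal.ofReal (2 ^ a)) * ENNReal.ofReal (R ^ d * R ^ (-a)) *
          ENNReal.ofReal θ ^ j := by
        refine ENNReal.tsum_le_tsum fun j => ?_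
        refine (mul_le_mul_right (hC Λ hΛ z hz (R * (1 / 2) ^ j) R (by positivity) ?_) _).trans ?_
        · exact mul_le_of_le_one_right hR.le (pow_le_one₀ (by norm_num) (by norm_num))
        rw [mul_left_comm, ← ENNReal.ofReal_mul (by positivity), mul_assoc (C : ℝ≥0∞),
          ← ENNReal.ofReal_mul (by positivity), mul_assoc (C : ℝ≥0∞), ← ENNReal.ofReal_pow hθ0.le,
          ← ENNReal.ofReal_mul (by positivity)]
        refine mul_le_mul_right (ENNReal.ofReal_le_ofReal (le_of_eq ?_)) _
        have e1 : R / (R * (1 / 2) ^ j) = 2 ^ j := by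
          rw [div_mul_cancel_left₀ hR.ne', one_div, inv_pow, inv_inv]
        have e2 : (R * (1 / 2 : ℝ) ^ (j + 1)) ^ (-a) = R ^ (-a) * (2 ^ a * ((2 : ℝ) ^ a) ^ j) := by
          rw [Real.mul_rpow hR.le (by positivity), one_div, inv_pow, Real.inv_rpow (by positivity),
            Real.rpow_neg (by positivity : (0 : ℝ) ≤ 2 ^ (j + 1)), inv_inv, ← pow_succ',
            ← Real.rpow_natCast, ← Real.rpow_natCast, ← Real.rpow_mul (by norm_num),
            ← Real.rpow_mul (by norm_num), mul_comm a]
        have e3 : θ = 2 ^ a * 2 ^ ℓ * (1 / 2) ^ d := by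
          rw [hθ, Real.rpow_sub (by norm_num), Real.rpow_add (by norm_num), Real.rpow_natCast,
            Real.rpow_natCast, one_div, inv_pow]
          rfl
        rw [e1, e2, e3, mul_pow, mul_pow, mul_pow, ← pow_mul, ← pow_mul, ← pow_mul, mul_comm j d,
          mul_comm j ℓ]
        ring
    _ = _ := by
        rw [ENNReal.tsum_mul_left, ENNReal.tsum_geometric]
        ring

/-- The `A₁` property of the negative powers of the distance. -/
theorem lintegral_infDist_rpow_le (hc : 0 < c) {a : ℝ} (ha : 0 ≤ a) (had : a < (d : ℝ) - ℓ) :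
    ∃ C : ℝ≥0, ∀ Λ : Set (E d), IsRegularSet ℓ c Λ → ∀ x ∉ Λ, ∀ r : ℝ, 0 < r →
      ∫⁻ y in closedBall x r, ENNReal.ofReal (infDist y Λ ^ (-a)) ≤
        C * ENNReal.ofReal (r ^ d) * ENNReal.ofReal (infDist x Λ ^ (-a)) := by
  obtain ⟨C, hC⟩ := lintegral_infDist_rpow_centered (d := d) (ℓ := ℓ) hc ha had
  set V := volume (closedBall (0 : E d) 1) with hV
  have hVt : V ≠ ⊤ := measure_closedBall_lt_top.ne
  have hfin : (C : ℝ≥0∞) * ENNReal.ofReal (3 ^ d) + ENNReal.ofReal (2 ^ a) * V ≠ ⊤ :=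
    ENNReal.add_ne_top.2 ⟨ENNReal.mul_ne_top ENNReal.coe_ne_top ENNReal.ofReal_ne_top,
      ENNReal.mul_ne_top ENNReal.ofReal_ne_top hVt⟩
  refine ⟨((C : ℝ≥0∞) * ENNReal.ofReal (3 ^ d) + ENNReal.ofReal (2 ^ a) * V).toNNReal, ?_⟩
  intro Λ hΛ x hx r hr
  have hxp := hΛ.infDist_pos hx
  rw [ENNReal.coe_toNNReal hfin, add_mul, add_mul]
  -- Far from Λ, the distance on the ball is at least half its value at x. Near Λ, the ball lies in
  -- one of radius 3r centred on Λ.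
  rcases le_or_gt (2 * r) (infDist x Λ) with h | h
  · refine le_add_left ?_
    calc ∫⁻ y in closedBall x r, ENNReal.ofReal (infDist y Λ ^ (-a))
        ≤ ∫⁻ y in closedBall x r, ENNReal.ofReal (2 ^ a * infDist x Λ ^ (-a)) := by
          refine setLIntegral_mono' Metric.isClosed_closedBall.measurableSet fun y hy => ?_
          refine ENNReal.ofReal_le_ofReal ?_
          have h1 : infDist x Λ / 2 ≤ infDist y Λ := by
            have := Metric.infDist_le_infDist_add_dist (s := Λ) (x := x) (y := y)
            rw [Metric.mem_closedBall, dist_comm] at hy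
            linarith
          refine (Real.rpow_le_rpow_of_nonpos (by positivity) h1 (by linarith)).trans_eq ?_
          rw [Real.div_rpow hxp.le (by norm_num), Real.rpow_neg (by norm_num : (0 : ℝ) ≤ 2),
            div_inv_eq_mul, mul_comm]
      _ = _ := by
          rw [setLIntegral_const, volume_closedBall_eq x hr.le, ENNReal.ofReal_mul (by positivity)]
          ring
  · refine le_add_right ?_
    obtain ⟨z, hz, hxz⟩ := (Metric.infDist_lt_iff hΛ.nonempty).1 h
    have hsub : closedBall x r ⊆ closedBall z (3 * r) := fun y hy => by
      rw [Metric.mem_closedBall] at hy ⊢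
      linarith [dist_triangle y x z]
    refine (lintegral_mono_set hsub).trans ((hC Λ hΛ z hz (3 * r) (by positivity)).trans ?_)
    rw [mul_assoc, mul_assoc, ← ENNReal.ofReal_mul (by positivity),
      ← ENNReal.ofReal_mul (by positivity), mul_pow, ← mul_assoc]
    have h2 : (3 * r) ^ (-a) ≤ infDist x Λ ^ (-a) :=
      Real.rpow_le_rpow_of_nonpos hxp (by linarith) (by linarith)
    gcongr

end Weights

/-! ### Bounded averages on the weighted spaces, and the A₂ property. -/

section Averaging

variable {d ℓ : ℕ} {c : ℝ} {Λ : Set (E d)}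

theorem sq_lintegral_mul_le {α : Type*} [MeasurableSpace α] (μ : Measure α) {f g : α → ℝ≥0∞}
    (hf : AEMeasurable f μ) (hg : AEMeasurable g μ) :
    (∫⁻ x, f x * g x ∂μ) ^ 2 ≤ (∫⁻ x, f x ^ 2 ∂μ) * ∫⁻ x, g x ^ 2 ∂μ := by
  have h := ENNReal.lintegral_mul_le_Lp_mul_Lq μ Real.HolderConjugate.two_two hf hg
  simp only [Pi.mul_apply, ENNReal.rpow_two] at h
  refine (ENNReal.pow_le_pow_left h).trans_eq ?_
  rw [mul_pow, ← ENNReal.rpow_natCast, ← ENNReal.rpow_natCast, ← ENNReal.rpow_mul,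
    ← ENNReal.rpow_mul]
  norm_num

/-- Cauchy-Schwarz for g = (w^(1/2) g) · w'^(1/2). Unweighted integrals are traded in this way for
weighted ones, at the price of the integral of the dual weight. -/
theorem sq_lintegral_le_mul {α : Type*} [MeasurableSpace α] (μ : Measure α) {g w w' : α → ℝ≥0∞}
    (hg : AEMeasurable g μ) (hw : AEMeasurable w μ) (hw' : AEMeasurable w' μ)
    (h1 : ∀ᵐ x ∂μ, w x * w' x = 1) :
    (∫⁻ x, g x ∂μ) ^ 2 ≤ (∫⁻ x, w x * g x ^ 2 ∂μ) * ∫⁻ x, w' x ∂μ := by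
  have e : ∀ x : ℝ≥0∞, (x ^ (1 / 2 : ℝ)) ^ 2 = x := fun x => by
    rw [← ENNReal.rpow_natCast, ← ENNReal.rpow_mul]
    norm_num
  have h := sq_lintegral_mul_le μ ((hw.pow_const (1 / 2 : ℝ)).mul hg) (hw'.pow_const (1 / 2 : ℝ))
  simp only [Pi.mul_apply, mul_pow, e] at h
  refine le_trans (le_of_eq ?_) h
  congr 1
  refine lintegral_congr_ae ?_
  filter_upwards [h1] with x hx
  rw [mul_right_comm, ← ENNReal.mul_rpow_of_nonneg _ _ (by norm_num), hx]
  simp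

/-- The tube of width s about Λ has volume of order s^(d-ℓ), which tends to 0 with s. -/
theorem IsRegularSet.volume_eq_zero (hc : 0 < c) (hℓ : ℓ < d) (hΛ : IsRegularSet ℓ c Λ) :
    volume Λ = 0 := by
  obtain ⟨C, hC⟩ := volume_tube_le d ℓ hc
  obtain ⟨z, hz⟩ := hΛ.nonempty
  set R := diam Λ + 1 with hR
  have hRp : 0 < R := by positivity
  have hbound : ∀ s ∈ Ioc (0 : ℝ) R, volume Λ ≤ C * ENNReal.ofReal (s ^ (d - ℓ) * R ^ ℓ) := by
    intro s hs
    have h := hC Λ hΛ z hz s R hs.1 hs.2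
    have e : s ^ d * (R / s) ^ ℓ = s ^ (d - ℓ) * R ^ ℓ := by
      have hs0 := hs.1.ne'
      rw [div_pow, ← Nat.sub_add_cancel hℓ.le, pow_add, Nat.sub_add_cancel hℓ.le]
      field_simp
    rw [e] at h
    refine (measure_mono fun p hp => mem_inter ?_ ?_).trans h
    · rw [Metric.mem_closedBall]
      linarith [Metric.dist_le_diam_of_mem hΛ.isCompact.isBounded hp hz]
    · simp [Metric.infDist_zero_of_mem hp, hs.1.le]
  have hlim : Filter.Tendsto (fun s : ℝ => (C : ℝ≥0∞) * ENNReal.ofReal (s ^ (d - ℓ) * R ^ ℓ))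
      (nhdsWithin 0 (Ioi 0)) (nhds 0) := by
    have h1 : Filter.Tendsto (fun s : ℝ => s ^ (d - ℓ) * R ^ ℓ) (nhdsWithin 0 (Ioi 0))
        (nhds (0 ^ (d - ℓ) * R ^ ℓ)) :=
      ((continuous_pow _).mul continuous_const).continuousAt.tendsto.mono_left nhdsWithin_le_nhds
    rw [zero_pow (by omega), zero_mul] at h1
    have h2 := ENNReal.Tendsto.const_mul (ENNReal.tendsto_ofReal h1)
      (Or.inr (ENNReal.coe_ne_top (r := C)))
    simpa using h2
  refine le_antisymm (ge_of_tendsto hlim ?_) (zero_le)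
  filter_upwards [Ioc_mem_nhdsGT hRp] with s hs using hbound s hs

/-- The weight `dist(x, Λ)^(2β)`. -/
def weight (Λ : Set (E d)) (β : ℝ) (x : E d) : ℝ≥0∞ := ENNReal.ofReal (infDist x Λ ^ (2 * β))

theorem measurable_weight (Λ : Set (E d)) (β : ℝ) : Measurable (weight Λ β) :=
  measurable_ofReal_infDist_rpow Λ _

theorem weight_ne_top (Λ : Set (E d)) (β : ℝ) (x : E d) : weight Λ β x ≠ ⊤ := ENNReal.ofReal_ne_top

theorem IsRegularSet.weight_mul_weight_neg (hΛ : IsRegularSet ℓ c Λ) (β : ℝ) {x : E d}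
    (hx : x ∉ Λ) : weight Λ β x * weight Λ (-β) x = 1 := by
  have := hΛ.infDist_pos hx
  rw [weight, weight, ← ENNReal.ofReal_mul (by positivity), ← Real.rpow_add this]
  simp

theorem lintegral_prodMk_swap {α γ : Type*} [MeasurableSpace α] [MeasurableSpace γ]
    {μ : Measure α} {ν : Measure γ} [SFinite μ] [SFinite ν] {k : α × γ → ℝ≥0∞}
    (hk : Measurable k) :
    ∫⁻ x, (∫⁻ y, k (x, y) ∂ν) ∂μ = ∫⁻ y, (∫⁻ x, k (x, y) ∂μ) ∂ν :=
  lintegral_lintegral_swap (f := fun x y => k (x, y)) hk.aemeasurable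

theorem lintegral_lintegral_closedBall {k : E d → ℝ≥0∞} (hk : Measurable k) {r : ℝ} (hr : 0 ≤ r) :
    ∫⁻ x, ∫⁻ y in closedBall x r, k y =
      ENNReal.ofReal (r ^ d) * volume (closedBall (0 : E d) 1) * ∫⁻ y, k y := by
  have hm : MeasurableSet {q : E d × E d | dist q.1 q.2 ≤ r} :=
    (isClosed_le (continuous_fst.dist continuous_snd) continuous_const).measurableSet
  have e : ∀ x, ∫⁻ y in closedBall x r, k y =
      ∫⁻ y, {q : E d × E d | dist q.1 q.2 ≤ r}.indicator (fun q => k q.2) (x, y) := fun x => by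
    rw [← lintegral_indicator Metric.isClosed_closedBall.measurableSet]
    refine lintegral_congr fun y => ?_
    simp [indicator, dist_comm y x]
  have hm' : Measurable ({q : E d × E d | dist q.1 q.2 ≤ r}.indicator fun q => k q.2) :=
    (hk.comp measurable_snd).indicator hm
  simp_rw [e]
  rw [lintegral_prodMk_swap hm', ← lintegral_const_mul _ hk]
  refine lintegral_congr fun y => ?_
  rw [← volume_closedBall_eq y hr, mul_comm, ← setLIntegral_const,
    ← lintegral_indicator Metric.isClosed_closedBall.measurableSet]
  refine lintegral_congr fun x => ?_
  simp [indicator]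

theorem exists_lintegral_weight_neg_le (hc : 0 < c) {β : ℝ} (hβ : 0 ≤ β)
    (hβd : β < ((d : ℝ) - ℓ) / 2) :
    ∃ C : ℝ≥0, ∀ Λ : Set (E d), IsRegularSet ℓ c Λ → ∀ x ∉ Λ, ∀ r : ℝ, 0 < r →
      ∫⁻ y in closedBall x r, weight Λ (-β) y ≤
        C * ENNReal.ofReal (r ^ d) * weight Λ (-β) x := by
  obtain ⟨C, hC⟩ := lintegral_infDist_rpow_le (d := d) (ℓ := ℓ) hc (a := 2 * β) (by linarith)
    (by linarith)
  refine ⟨C, fun Λ hΛ x hx r hr => ?_⟩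
  simpa only [weight, mul_neg] using hC Λ hΛ x hx r hr

theorem ae_notMem (hc : 0 < c) (hℓ : ℓ < d) (hΛ : IsRegularSet ℓ c Λ) :
    ∀ᵐ x : E d, x ∉ Λ := by
  rw [ae_iff]
  simpa using hΛ.volume_eq_zero hc hℓ

/-- Here the dual weight is A₁. Weighted Cauchy-Schwarz produces the integral of the dual weight
over the ball about x; A₁ bounds it by the value at x, which cancels the weight outside. -/
theorem exists_weighted_averaging_pos (hc : 0 < c) (hℓ : ℓ < d) {β : ℝ} (hβ : 0 ≤ β)
    (hβd : β < ((d : ℝ) - ℓ) / 2) :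
    ∃ C : ℝ≥0, ∀ Λ : Set (E d), IsRegularSet ℓ c Λ → ∀ g : E d → ℝ≥0∞, Measurable g →
      ∀ r : ℝ, 0 < r → ∫⁻ x, weight Λ β x * (∫⁻ y in closedBall x r, g y) ^ 2 ≤
        C * ENNReal.ofReal (r ^ d) ^ 2 * ∫⁻ x, weight Λ β x * g x ^ 2 := by
  obtain ⟨C, hC⟩ := exists_lintegral_weight_neg_le (d := d) (ℓ := ℓ) hc hβ hβd
  set V := volume (closedBall (0 : E d) 1) with hV
  have hVt : V ≠ ⊤ := measure_closedBall_lt_top.ne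
  refine ⟨C * V.toNNReal, fun Λ hΛ g hg r hr => ?_⟩
  have hmk : Measurable fun y => weight Λ β y * g y ^ 2 :=
    (measurable_weight Λ β).mul (hg.pow_const 2)
  have hae := ae_notMem hc hℓ hΛ
  calc ∫⁻ x, weight Λ β x * (∫⁻ y in closedBall x r, g y) ^ 2
      ≤ ∫⁻ x, C * ENNReal.ofReal (r ^ d) * ∫⁻ y in closedBall x r, weight Λ β y * g y ^ 2 := by
        refine lintegral_mono_ae ?_
        filter_upwards [hae] with x hx
        have h1 := sq_lintegral_le_mul (volume.restrict (closedBall x r)) hg.aemeasurable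
          (measurable_weight Λ β).aemeasurable (measurable_weight Λ (-β)).aemeasurable
          (ae_restrict_of_ae (hae.mono fun y hy => hΛ.weight_mul_weight_neg β hy))
        calc weight Λ β x * (∫⁻ y in closedBall x r, g y) ^ 2
            ≤ weight Λ β x * ((∫⁻ y in closedBall x r, weight Λ β y * g y ^ 2) *
              (C * ENNReal.ofReal (r ^ d) * weight Λ (-β) x)) := by
              gcongr
              exact h1.trans (by gcongr; exact hC Λ hΛ x hx r hr)
          _ = (weight Λ β x * weight Λ (-β) x) * (C * ENNReal.ofReal (r ^ d) *
              ∫⁻ y in closedBall x r, weight Λ β y * g y ^ 2) := by ring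
          _ = _ := by rw [hΛ.weight_mul_weight_neg β hx, one_mul]
    _ = C * ENNReal.ofReal (r ^ d) * ∫⁻ x, ∫⁻ y in closedBall x r, weight Λ β y * g y ^ 2 := by
        rw [lintegral_const_mul' _ _ (ENNReal.mul_ne_top ENNReal.coe_ne_top ENNReal.ofReal_ne_top)]
    _ = _ := by
        rw [lintegral_lintegral_closedBall hmk hr.le, ENNReal.coe_mul, ENNReal.coe_toNNReal hVt]
        ring

/-- Here the weight itself is A₁: unweighted Cauchy-Schwarz in the ball, Fubini, and A₁ at the inner
point y. -/
theorem exists_weighted_averaging_neg (hc : 0 < c) (hℓ : ℓ < d) {β : ℝ} (hβ : 0 ≤ β)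
    (hβd : β < ((d : ℝ) - ℓ) / 2) :
    ∃ C : ℝ≥0, ∀ Λ : Set (E d), IsRegularSet ℓ c Λ → ∀ g : E d → ℝ≥0∞, Measurable g →
      ∀ r : ℝ, 0 < r → ∫⁻ x, weight Λ (-β) x * (∫⁻ y in closedBall x r, g y) ^ 2 ≤
        C * ENNReal.ofReal (r ^ d) ^ 2 * ∫⁻ x, weight Λ (-β) x * g x ^ 2 := by
  obtain ⟨C, hC⟩ := exists_lintegral_weight_neg_le (d := d) (ℓ := ℓ) hc hβ hβd
  set V := volume (closedBall (0 : E d) 1) with hV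
  have hVt : V ≠ ⊤ := measure_closedBall_lt_top.ne
  refine ⟨C * V.toNNReal, fun Λ hΛ g hg r hr => ?_⟩
  have hw := measurable_weight Λ (-β)
  have hae := ae_notMem hc hℓ hΛ
  have hm : MeasurableSet {q : E d × E d | dist q.1 q.2 ≤ r} :=
    (isClosed_le (continuous_fst.dist continuous_snd) continuous_const).measurableSet
  have hm' : Measurable ({q : E d × E d | dist q.1 q.2 ≤ r}.indicator
      fun q => weight Λ (-β) q.1 * g q.2 ^ 2) :=
    ((hw.comp measurable_fst).mul ((hg.comp measurable_snd).pow_const 2)).indicator hm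
  calc ∫⁻ x, weight Λ (-β) x * (∫⁻ y in closedBall x r, g y) ^ 2
      ≤ ∫⁻ x, ENNReal.ofReal (r ^ d) * V *
          ∫⁻ y in closedBall x r, weight Λ (-β) x * g y ^ 2 := by
        refine lintegral_mono fun x => ?_
        have h1 := sq_lintegral_le_mul (volume.restrict (closedBall x r)) hg.aemeasurable
          (w := 1) (w' := 1) aemeasurable_one aemeasurable_one (by simp)
        simp only [Pi.one_apply, one_mul, lintegral_one, Measure.restrict_apply_univ] at h1
        rw [volume_closedBall_eq x hr.le] at h1
        dsimp only
        rw [lintegral_const_mul _ (hg.pow_const 2)]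
        calc weight Λ (-β) x * (∫⁻ y in closedBall x r, g y) ^ 2
            ≤ weight Λ (-β) x * ((∫⁻ y in closedBall x r, g y ^ 2) *
              (ENNReal.ofReal (r ^ d) * V)) := by gcongr
          _ = _ := by ring
    _ = ENNReal.ofReal (r ^ d) * V * ∫⁻ x, ∫⁻ y, {q : E d × E d | dist q.1 q.2 ≤ r}.indicator
          (fun q => weight Λ (-β) q.1 * g q.2 ^ 2) (x, y) := by
        rw [lintegral_const_mul' _ _ (ENNReal.mul_ne_top ENNReal.ofReal_ne_top hVt)]
        congr 1
        refine lintegral_congr fun x => ?_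
        rw [← lintegral_indicator Metric.isClosed_closedBall.measurableSet]
        refine lintegral_congr fun y => ?_
        simp [indicator, dist_comm y x]
    _ = ENNReal.ofReal (r ^ d) * V * ∫⁻ y, g y ^ 2 * ∫⁻ x in closedBall y r, weight Λ (-β) x := by
        rw [lintegral_prodMk_swap hm']
        congr 1
        refine lintegral_congr fun y => ?_
        rw [← lintegral_const_mul _ hw, ← lintegral_indicator
          Metric.isClosed_closedBall.measurableSet]
        refine lintegral_congr fun x => ?_
        simp [indicator, mul_comm]
    _ ≤ ENNReal.ofReal (r ^ d) * V * ∫⁻ y, C * ENNReal.ofReal (r ^ d) *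
          (weight Λ (-β) y * g y ^ 2) := by
        refine mul_le_mul_right (lintegral_mono_ae ?_) _
        filter_upwards [hae] with y hy
        calc g y ^ 2 * ∫⁻ x in closedBall y r, weight Λ (-β) x
            ≤ g y ^ 2 * (C * ENNReal.ofReal (r ^ d) * weight Λ (-β) y) := by
              gcongr
              exact hC Λ hΛ y hy r hr
          _ = _ := by ring
    _ = _ := by
        rw [lintegral_const_mul' _ _ (ENNReal.mul_ne_top ENNReal.coe_ne_top ENNReal.ofReal_ne_top),
          ENNReal.coe_mul,
          ENNReal.coe_toNNReal hVt]
        ring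

/-- Averaging over balls of a fixed radius is bounded on the weighted `L²` space. -/
theorem exists_weighted_averaging (hc : 0 < c) (hℓ : ℓ < d) {β : ℝ}
    (hβ : β ∈ Ioo (-(((d : ℝ) - ℓ) / 2)) (((d : ℝ) - ℓ) / 2)) :
    ∃ C : ℝ≥0, ∀ Λ : Set (E d), IsRegularSet ℓ c Λ → ∀ g : E d → ℝ≥0∞, Measurable g →
      ∀ r : ℝ, 0 < r → ∫⁻ x, weight Λ β x * (∫⁻ y in closedBall x r, g y) ^ 2 ≤
        C * ENNReal.ofReal (r ^ d) ^ 2 * ∫⁻ x, weight Λ β x * g x ^ 2 := by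
  rcases le_total 0 β with h | h
  · exact exists_weighted_averaging_pos hc hℓ h hβ.2
  · have := exists_weighted_averaging_neg (c := c) hc hℓ (β := -β) (by linarith)
      (by linarith [hβ.1])
    simpa using this

theorem lintegral_closedBall_smul {g : E d → ℝ≥0∞} (hg : Measurable g) (x : E d) {t h : ℝ}
    (ht : 0 < t) :
    ∫⁻ y in closedBall 0 h, g (x + t • y) =
      ENNReal.ofReal (t ^ d)⁻¹ * ∫⁻ z in closedBall x (t * h), g z := by
  have hf : Measurable fun y : E d => (closedBall x (t * h)).indicator g (x + y) :=
    (hg.indicator Metric.isClosed_closedBall.measurableSet).comp (measurable_const_add x)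
  have h1 : ∫⁻ y in closedBall 0 h, g (x + t • y) =
      ∫⁻ y, (fun y : E d => (closedBall x (t * h)).indicator g (x + y)) (t • y) := by
    rw [← lintegral_indicator Metric.isClosed_closedBall.measurableSet]
    refine lintegral_congr fun y => ?_
    simp [indicator, norm_smul, abs_of_pos ht, mul_le_mul_iff_right₀ ht]
  have h2 := lintegral_map (μ := (volume : Measure (E d))) hf (measurable_const_smul t)
  rw [h1, ← h2, Measure.map_addHaar_smul _ ht.ne', lintegral_smul_measure,
    lintegral_add_left_eq_self (fun y : E d => (closedBall x (t * h)).indicator g y) x,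
    lintegral_indicator Metric.isClosed_closedBall.measurableSet]
  simp [abs_of_pos ht]

/-- The substitution z = x + ty gives an average at radius th, and the Jacobian t^(-d) makes up for
the smaller volume. The bound is thus uniform in t, which allows the integration over t along
segments in `exists_poincare`. -/
theorem exists_weighted_averaging_smul (hc : 0 < c) (hℓ : ℓ < d) {β : ℝ}
    (hβ : β ∈ Ioo (-(((d : ℝ) - ℓ) / 2)) (((d : ℝ) - ℓ) / 2)) :
    ∃ C : ℝ≥0, ∀ Λ : Set (E d), IsRegularSet ℓ c Λ → ∀ g : E d → ℝ≥0∞, Measurable g →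
      ∀ t h : ℝ, 0 < t → 0 < h →
        ∫⁻ x, weight Λ β x * (∫⁻ y in closedBall 0 h, g (x + t • y)) ^ 2 ≤
          C * ENNReal.ofReal (h ^ d) ^ 2 * ∫⁻ x, weight Λ β x * g x ^ 2 := by
  obtain ⟨C, hC⟩ := exists_weighted_averaging (d := d) (ℓ := ℓ) hc hℓ hβ
  refine ⟨C, fun Λ hΛ g hg t h ht hh => ?_⟩
  simp_rw [lintegral_closedBall_smul hg _ ht, mul_pow, mul_left_comm (weight Λ β _)]
  rw [lintegral_const_mul' _ _ (by simp)]
  refine (mul_le_mul_right (hC Λ hΛ g hg (t * h) (by positivity)) _).trans_eq ?_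
  have e : ENNReal.ofReal (h ^ d) = ENNReal.ofReal (t ^ d)⁻¹ * ENNReal.ofReal ((t * h) ^ d) := by
    rw [← ENNReal.ofReal_mul (by positivity), mul_pow, inv_mul_cancel_left₀ (by positivity)]
  rw [e]
  ring

/-- For almost every y in the ball, A₁ on the ball of radius 2r about y bounds the weight at y times
the integral of the dual weight by a multiple of r^d. It remains to integrate in y. -/
theorem exists_lintegral_weight_mul_le_aux (hc : 0 < c) (hℓ : ℓ < d) {β : ℝ} (hβ : 0 ≤ β)
    (hβd : β < ((d : ℝ) - ℓ) / 2) :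
    ∃ C : ℝ≥0, ∀ Λ : Set (E d), IsRegularSet ℓ c Λ → ∀ x, ∀ r : ℝ, 0 < r →
      (∫⁻ y in closedBall x r, weight Λ β y) * (∫⁻ y in closedBall x r, weight Λ (-β) y) ≤
        C * ENNReal.ofReal (r ^ d) ^ 2 := by
  obtain ⟨C, hC⟩ := exists_lintegral_weight_neg_le (d := d) (ℓ := ℓ) hc hβ hβd
  set V := volume (closedBall (0 : E d) 1) with hV
  have hVt : V ≠ ⊤ := measure_closedBall_lt_top.ne
  refine ⟨C * 2 ^ d * V.toNNReal, fun Λ hΛ x r hr => ?_⟩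
  have hae := ae_notMem hc hℓ hΛ
  rw [← lintegral_mul_const _ (measurable_weight Λ β)]
  calc ∫⁻ y in closedBall x r, weight Λ β y * ∫⁻ z in closedBall x r, weight Λ (-β) z
      ≤ ∫⁻ y in closedBall x r, C * ENNReal.ofReal ((2 * r) ^ d) := by
        refine setLIntegral_mono_ae measurable_const.aemeasurable ?_
        filter_upwards [hae] with y hy hyx
        have hsub : closedBall x r ⊆ closedBall y (2 * r) := fun z hz => by
          rw [Metric.mem_closedBall] at *
          linarith [dist_triangle z x y, dist_comm x y]
        calc weight Λ β y * ∫⁻ z in closedBall x r, weight Λ (-β) z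
            ≤ weight Λ β y * (C * ENNReal.ofReal ((2 * r) ^ d) * weight Λ (-β) y) := by
              gcongr
              exact (lintegral_mono_set hsub).trans (hC Λ hΛ y hy _ (by positivity))
          _ = (weight Λ β y * weight Λ (-β) y) * (C * ENNReal.ofReal ((2 * r) ^ d)) := by ring
          _ = _ := by rw [hΛ.weight_mul_weight_neg β hy, one_mul]
    _ = _ := by
        rw [setLIntegral_const, volume_closedBall_eq x hr.le, mul_pow,
          ENNReal.ofReal_mul (by positivity)]
        push_cast
        rw [ENNReal.coe_toNNReal hVt, ENNReal.ofReal_pow (by norm_num), ENNReal.ofReal_ofNat]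
        ring

/-- The `A₂` property of the weight. -/
theorem exists_lintegral_weight_mul_le (hc : 0 < c) (hℓ : ℓ < d) {β : ℝ}
    (hβ : β ∈ Ioo (-(((d : ℝ) - ℓ) / 2)) (((d : ℝ) - ℓ) / 2)) :
    ∃ C : ℝ≥0, ∀ Λ : Set (E d), IsRegularSet ℓ c Λ → ∀ x, ∀ r : ℝ, 0 < r →
      (∫⁻ y in closedBall x r, weight Λ β y) * (∫⁻ y in closedBall x r, weight Λ (-β) y) ≤
        C * ENNReal.ofReal (r ^ d) ^ 2 := by
  rcases le_total 0 β with h | h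
  · exact exists_lintegral_weight_mul_le_aux hc hℓ h hβ.2
  · obtain ⟨C, hC⟩ := exists_lintegral_weight_mul_le_aux (c := c) (ℓ := ℓ) (d := d) hc hℓ
      (β := -β) (by linarith) (by linarith [hβ.1])
    refine ⟨C, fun Λ hΛ x r hr => ?_⟩
    rw [mul_comm]
    simpa using hC Λ hΛ x r hr

end Averaging

/-! ### Weighted Poincaré and Friedrichs inequalities for smooth functions. -/

section Poincare

variable {d ℓ : ℕ} {c : ℝ} {Λ : Set (E d)}

theorem norm_gradient (φ : E d → ℝ) (x : E d) : ‖gradient φ x‖ = ‖fderiv ℝ φ x‖ := by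
  simp [gradient]

theorem enorm_sub_le_lintegral_gradient {φ : E d → ℝ} (hφ : ContDiff ℝ ∞ φ) {h : ℝ} {x y : E d}
    (hxy : dist x y ≤ h) :
    ‖φ x - φ y‖ₑ ≤ ENNReal.ofReal h *
      ∫⁻ t in Ioc (0 : ℝ) 1, ‖gradient φ (x + t • (y - x))‖ₑ := by
  have hd : ∀ t : ℝ, HasDerivAt (fun t : ℝ => φ (x + t • (y - x)))
      (fderiv ℝ φ (x + t • (y - x)) (y - x)) t := by
    intro t
    have h1 : HasDerivAt (fun t : ℝ => x + t • (y - x)) (y - x) t := by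
      simpa using ((hasDerivAt_id t).smul_const (y - x)).const_add x
    exact ((hφ.differentiable (by simp)).differentiableAt.hasFDerivAt).comp_hasDerivAt t h1
  have hcont : Continuous fun t : ℝ => fderiv ℝ φ (x + t • (y - x)) (y - x) := by
    have := hφ.continuous_fderiv (by simp)
    fun_prop
  have hint := intervalIntegral.integral_eq_sub_of_hasDerivAt (a := 0) (b := 1)
    (fun t _ => hd t) (hcont.intervalIntegrable 0 1)
  have e : φ x - φ y = - ∫ t in (0 : ℝ)..1, fderiv ℝ φ (x + t • (y - x)) (y - x) := by
    rw [hint]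
    simp
  rw [e, enorm_neg, intervalIntegral.integral_of_le zero_le_one,
    ← lintegral_const_mul' _ _ ENNReal.ofReal_ne_top]
  refine (enorm_integral_le_lintegral_enorm _).trans (lintegral_mono fun t => ?_)
  dsimp only
  rw [← ofReal_norm, ← ofReal_norm, ← ENNReal.ofReal_mul
    (dist_nonneg.trans hxy), norm_gradient, mul_comm]
  refine ENNReal.ofReal_le_ofReal ((ContinuousLinearMap.le_opNorm _ _).trans ?_)
  rw [dist_comm, dist_eq_norm] at hxy
  gcongr

/-- With z = y - x, the difference of the values is at most h times the integral over t of |∇φ| at x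
+ tz. After an exchange of integrals, what remains are integrals of |∇φ| over balls scaled by t,
bounded uniformly in t. Keeping the double difference on the left serves both versions, the one with
the mean and the one with a zero set. -/
theorem exists_poincare (hc : 0 < c) (hℓ : ℓ < d) {β : ℝ}
    (hβ : β ∈ Ioo (-(((d : ℝ) - ℓ) / 2)) (((d : ℝ) - ℓ) / 2)) :
    ∃ C : ℝ≥0, ∀ Λ : Set (E d), IsRegularSet ℓ c Λ → ∀ (K : Set (E d)) (h : ℝ), Convex ℝ K →
      MeasurableSet K → 0 < h → (∀ x ∈ K, ∀ y ∈ K, dist x y ≤ h) →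
      ∀ φ : E d → ℝ, ContDiff ℝ ∞ φ →
        ∫⁻ x in K, weight Λ β x * (∫⁻ y in K, ‖φ x - φ y‖ₑ) ^ 2 ≤
          C * ENNReal.ofReal h ^ 2 * ENNReal.ofReal (h ^ d) ^ 2 *
            ∫⁻ x in K, weight Λ β x * ‖gradient φ x‖ₑ ^ 2 := by
  obtain ⟨C, hC⟩ := exists_weighted_averaging_smul (d := d) (ℓ := ℓ) hc hℓ hβ
  refine ⟨C, fun Λ hΛ K h hK hKm hh hdist φ hφ => ?_⟩
  -- The gradient may be cut off to K because convexity keeps the segments in K.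
  set g : E d → ℝ≥0∞ := K.indicator fun z => ‖gradient φ z‖ₑ with hg
  have hgm : Measurable g := ((continuous_gradient hφ).enorm.measurable).indicator hKm
  set G : ℝ → E d → ℝ≥0∞ := fun t x => ∫⁻ y in closedBall 0 h, g (x + t • y) with hG
  have hGm : Measurable (fun p : ℝ × E d => G p.1 p.2) := by
    refine Measurable.lintegral_prod_right' (f := fun q : (ℝ × E d) × E d =>
      g (q.1.2 + q.1.1 • q.2)) (hgm.comp ?_)
    fun_prop
  have hw := measurable_weight Λ β
  have step1 : ∀ x ∈ K, ∫⁻ y in K, ‖φ x - φ y‖ₑ ≤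
      ENNReal.ofReal h * ∫⁻ t in Ioc (0 : ℝ) 1, G t x := by
    intro x hx
    have hkm : Measurable fun p : E d × ℝ => g (x + p.2 • p.1) := by
      refine hgm.comp ?_
      fun_prop
    calc ∫⁻ y in K, ‖φ x - φ y‖ₑ
        ≤ ∫⁻ y in K, ENNReal.ofReal h * ∫⁻ t in Ioc (0 : ℝ) 1, g (x + t • (y - x)) := by
          refine setLIntegral_mono' hKm fun y hy => ?_
          refine (enorm_sub_le_lintegral_gradient hφ (hdist x hx y hy)).trans ?_
          refine mul_le_mul_right (setLIntegral_mono' measurableSet_Ioc fun t ht => ?_) _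
          rw [hg, indicator_of_mem]
          exact hK.add_smul_sub_mem hx hy ⟨ht.1.le, ht.2⟩
      _ ≤ ∫⁻ y, (fun z => (closedBall (0 : E d) h).indicator (fun z => ENNReal.ofReal h *
            ∫⁻ t in Ioc (0 : ℝ) 1, g (x + t • z)) z) (y - x) := by
          rw [← lintegral_indicator hKm]
          refine lintegral_mono fun y => ?_
          by_cases hy : y ∈ K
          · rw [indicator_of_mem hy]
            dsimp only
            rw [indicator_of_mem]
            simpa [dist_eq_norm, norm_sub_rev] using hdist x hx y hy
          · rw [indicator_of_notMem hy]
            exact zero_le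
      _ = ENNReal.ofReal h * ∫⁻ t in Ioc (0 : ℝ) 1, G t x := by
          rw [lintegral_sub_right_eq_self (fun z => (closedBall (0 : E d) h).indicator (fun z =>
            ENNReal.ofReal h * ∫⁻ t in Ioc (0 : ℝ) 1, g (x + t • z)) z) x,
            lintegral_indicator Metric.isClosed_closedBall.measurableSet,
            lintegral_const_mul' _ _ ENNReal.ofReal_ne_top, lintegral_prodMk_swap hkm]
  -- Jensen's inequality on the unit interval, as Cauchy-Schwarz with both weights 1.
  have step2 : ∀ x, (∫⁻ t in Ioc (0 : ℝ) 1, G t x) ^ 2 ≤ ∫⁻ t in Ioc (0 : ℝ) 1, G t x ^ 2 := by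
    intro x
    have := sq_lintegral_le_mul (volume.restrict (Ioc (0 : ℝ) 1)) (g := fun t => G t x)
      (w := 1) (w' := 1) (hGm.comp measurable_prodMk_right).aemeasurable aemeasurable_one
      aemeasurable_one (by simp)
    simpa using this
  calc ∫⁻ x in K, weight Λ β x * (∫⁻ y in K, ‖φ x - φ y‖ₑ) ^ 2
      ≤ ∫⁻ x in K, ENNReal.ofReal h ^ 2 * ∫⁻ t in Ioc (0 : ℝ) 1, weight Λ β x * G t x ^ 2 := by
        refine setLIntegral_mono' hKm fun x hx => ?_
        rw [lintegral_const_mul' _ _ (weight_ne_top _ _ _)]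
        calc weight Λ β x * (∫⁻ y in K, ‖φ x - φ y‖ₑ) ^ 2
            ≤ weight Λ β x * (ENNReal.ofReal h * ∫⁻ t in Ioc (0 : ℝ) 1, G t x) ^ 2 := by
              gcongr
              exact step1 x hx
          _ ≤ weight Λ β x * (ENNReal.ofReal h ^ 2 * ∫⁻ t in Ioc (0 : ℝ) 1, G t x ^ 2) := by
              rw [mul_pow]
              gcongr
              exact step2 x
          _ = _ := by ring
    _ ≤ ∫⁻ x, ENNReal.ofReal h ^ 2 * ∫⁻ t in Ioc (0 : ℝ) 1, weight Λ β x * G t x ^ 2 :=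
        setLIntegral_le_lintegral _ _
    _ = ENNReal.ofReal h ^ 2 * ∫⁻ t in Ioc (0 : ℝ) 1, ∫⁻ x, weight Λ β x * G t x ^ 2 := by
        rw [lintegral_const_mul' _ _ (by simp)]
        congr 1
        exact lintegral_prodMk_swap (k := fun p : E d × ℝ => weight Λ β p.1 * G p.2 p.1 ^ 2)
          ((hw.comp measurable_fst).mul ((hGm.comp measurable_swap).pow_const 2))
    _ ≤ ENNReal.ofReal h ^ 2 * ∫⁻ t in Ioc (0 : ℝ) 1, C * ENNReal.ofReal (h ^ d) ^ 2 *
          ∫⁻ x, weight Λ β x * g x ^ 2 := by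
        refine mul_le_mul_right (setLIntegral_mono' measurableSet_Ioc fun t ht => ?_) _
        exact hC Λ hΛ g hgm t h ht.1 hh
    _ = _ := by
        have e : ∫⁻ x, weight Λ β x * g x ^ 2 =
            ∫⁻ x in K, weight Λ β x * ‖gradient φ x‖ₑ ^ 2 := by
          rw [← lintegral_indicator hKm]
          refine lintegral_congr fun x => ?_
          by_cases hx : x ∈ K <;> simp [hg, hx]
        rw [setLIntegral_const, e]
        simp only [Real.volume_Ioc, sub_zero, ENNReal.ofReal_one, mul_one]
        ring

/-- Friedrichs' inequality on a ball, for smooth functions that vanish on a substantial part of it. -/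
theorem exists_friedrichs_ball (hc : 0 < c) (hℓ : ℓ < d) {β : ℝ}
    (hβ : β ∈ Ioo (-(((d : ℝ) - ℓ) / 2)) (((d : ℝ) - ℓ) / 2)) {δ : ℝ} (hδ : 0 < δ) :
    ∃ C : ℝ≥0, ∀ Λ : Set (E d), IsRegularSet ℓ c Λ → ∀ (y : E d) (r : ℝ), 0 < r →
      ∀ S ⊆ closedBall y r, ENNReal.ofReal (δ * r ^ d) ≤ volume S →
      ∀ φ : E d → ℝ, ContDiff ℝ ∞ φ → (∀ x ∈ S, φ x = 0) →
        ∫⁻ x in closedBall y r, weight Λ β x * ‖φ x‖ₑ ^ 2 ≤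
          C * ENNReal.ofReal r ^ 2 *
            ∫⁻ x in closedBall y r, weight Λ β x * ‖gradient φ x‖ₑ ^ 2 := by
  obtain ⟨C, hC⟩ := exists_poincare (d := d) (ℓ := ℓ) hc hℓ hβ
  refine ⟨C * 4 * Real.toNNReal (δ⁻¹ * 2 ^ d) ^ 2, fun Λ hΛ y r hr S hS hvol φ hφ h0 => ?_⟩
  have h1 := hC Λ hΛ (closedBall y r) (2 * r) (convex_closedBall y r)
    Metric.isClosed_closedBall.measurableSet (by positivity) (fun x hx z hz => by
      rw [Metric.mem_closedBall] at hx hz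
      linarith [dist_triangle_right x z y]) φ hφ
  -- As φ vanishes on S, |φ x| times the volume of S is the integral over z in S of |φ x - φ z|.
  have h2 : ENNReal.ofReal (δ * r ^ d) ^ 2 *
      ∫⁻ x in closedBall y r, weight Λ β x * ‖φ x‖ₑ ^ 2 ≤
      ∫⁻ x in closedBall y r, weight Λ β x * (∫⁻ z in closedBall y r, ‖φ x - φ z‖ₑ) ^ 2 := by
    rw [← lintegral_const_mul' _ _ (by simp)]
    refine lintegral_mono fun x => ?_
    dsimp only
    rw [mul_left_comm, ← mul_pow]
    gcongr
    calc ENNReal.ofReal (δ * r ^ d) * ‖φ x‖ₑ ≤ ‖φ x‖ₑ * volume S := by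
          rw [mul_comm]
          gcongr
      _ = ∫⁻ z in S, ‖φ x‖ₑ := by rw [setLIntegral_const]
      _ ≤ ∫⁻ z in S, ‖φ x - φ z‖ₑ := by
          refine setLIntegral_mono (by have := hφ.continuous; fun_prop) fun z hz => ?_
          rw [h0 z hz, sub_zero]
      _ ≤ _ := lintegral_mono_set hS
  have h3 := h2.trans h1
  have hpos : 0 < δ * r ^ d := by positivity
  have h4 : ∫⁻ x in closedBall y r, weight Λ β x * ‖φ x‖ₑ ^ 2 =
      ENNReal.ofReal (δ * r ^ d)⁻¹ ^ 2 * (ENNReal.ofReal (δ * r ^ d) ^ 2 *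
      ∫⁻ x in closedBall y r, weight Λ β x * ‖φ x‖ₑ ^ 2) := by
    rw [← mul_assoc, ← mul_pow, ← ENNReal.ofReal_mul (by positivity), inv_mul_cancel₀ hpos.ne']
    simp
  rw [h4]
  refine (mul_le_mul_right h3 _).trans_eq ?_
  have e1 : ENNReal.ofReal (2 * r) = 2 * ENNReal.ofReal r := by
    rw [ENNReal.ofReal_mul (by norm_num), ENNReal.ofReal_ofNat]
  have e2 : ENNReal.ofReal (δ * r ^ d)⁻¹ * ENNReal.ofReal ((2 * r) ^ d) =
      ((δ⁻¹ * 2 ^ d).toNNReal : ℝ≥0∞) := by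
    rw [← ENNReal.ofReal_mul (by positivity), mul_inv, mul_pow, ENNReal.ofReal]
    congr 2
    field_simp
  push_cast
  rw [← e2, e1]
  ring

/-- Poincaré's inequality on a ball, for smooth functions. -/
theorem exists_poincare_ball (hc : 0 < c) (hℓ : ℓ < d) {β : ℝ}
    (hβ : β ∈ Ioo (-(((d : ℝ) - ℓ) / 2)) (((d : ℝ) - ℓ) / 2)) :
    ∃ C : ℝ≥0, ∀ Λ : Set (E d), IsRegularSet ℓ c Λ → ∀ (y : E d) (r : ℝ), 0 < r →
      ∀ φ : E d → ℝ, ContDiff ℝ ∞ φ → ∃ m : ℝ,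
        ∫⁻ x in closedBall y r, weight Λ β x * ‖φ x - m‖ₑ ^ 2 ≤
          C * ENNReal.ofReal r ^ 2 *
            ∫⁻ x in closedBall y r, weight Λ β x * ‖gradient φ x‖ₑ ^ 2 := by
  obtain ⟨C, hC⟩ := exists_poincare (d := d) (ℓ := ℓ) hc hℓ hβ
  set V := volume (closedBall (0 : E d) 1) with hV
  have hVt : V ≠ ⊤ := measure_closedBall_lt_top.ne
  have hV0 : V ≠ 0 := (Metric.measure_closedBall_pos _ _ one_pos).ne'
  refine ⟨C * 4 * (V.toNNReal⁻¹ * 2 ^ d) ^ 2, fun Λ hΛ y r hr φ hφ => ?_⟩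
  set B := closedBall y r with hB
  have hBV : volume B = ENNReal.ofReal (r ^ d) * V := volume_closedBall_eq y hr.le
  have hBt : volume B ≠ ⊤ := measure_closedBall_lt_top.ne
  have hB0 : volume B ≠ 0 := (Metric.measure_closedBall_pos _ _ hr).ne'
  have hφi : IntegrableOn φ B :=
    hφ.continuous.continuousOn.integrableOn_compact (isCompact_closedBall y r)
  have h1 := hC Λ hΛ B (2 * r) (convex_closedBall y r)
    Metric.isClosed_closedBall.measurableSet (by positivity) (fun x hx z hz => by
      rw [hB, Metric.mem_closedBall] at hx hz
      linarith [dist_triangle_right x z y]) φ hφ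
  refine ⟨⨍ z in B, φ z, ?_⟩
  -- φ x minus the mean of φ is the mean over z of φ x - φ z.
  have h2 : volume B ^ 2 * ∫⁻ x in B, weight Λ β x * ‖φ x - ⨍ z in B, φ z‖ₑ ^ 2 ≤
      ∫⁻ x in B, weight Λ β x * (∫⁻ z in B, ‖φ x - φ z‖ₑ) ^ 2 := by
    rw [← lintegral_const_mul' _ _ (by simp [hBt])]
    refine lintegral_mono fun x => ?_
    dsimp only
    rw [mul_left_comm, ← mul_pow]
    gcongr
    have e : volume.real B • (φ x - ⨍ z in B, φ z) = ∫ z in B, (φ x - φ z) := by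
      have hci : IntegrableOn (fun _ : E d => φ x) B volume := integrableOn_const hBt
      rw [integral_sub hci hφi, setIntegral_const, smul_sub,
        measure_smul_setAverage _ hBt]
    have e2 : volume B * ‖φ x - ⨍ z in B, φ z‖ₑ = ‖∫ z in B, (φ x - φ z)‖ₑ := by
      rw [← e, enorm_smul, Real.enorm_eq_ofReal measureReal_nonneg, ofReal_measureReal hBt]
    rw [e2]
    exact enorm_integral_le_lintegral_enorm _
  have h3 := h2.trans h1
  have h4 : ∫⁻ x in B, weight Λ β x * ‖φ x - ⨍ z in B, φ z‖ₑ ^ 2 =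
      (volume B)⁻¹ ^ 2 * (volume B ^ 2 *
      ∫⁻ x in B, weight Λ β x * ‖φ x - ⨍ z in B, φ z‖ₑ ^ 2) := by
    rw [← mul_assoc, ← mul_pow, ENNReal.inv_mul_cancel hB0 hBt]
    simp
  rw [h4]
  refine (mul_le_mul_right h3 _).trans_eq ?_
  have e1 : ENNReal.ofReal (2 * r) = 2 * ENNReal.ofReal r := by
    rw [ENNReal.ofReal_mul (by norm_num), ENNReal.ofReal_ofNat]
  have hrd : ENNReal.ofReal (r ^ d) ≠ 0 := by
    simpa using pow_pos hr d
  have e2 : (volume B)⁻¹ * ENNReal.ofReal ((2 * r) ^ d) = V⁻¹ * 2 ^ d := by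
    rw [hBV, ENNReal.mul_inv (Or.inl hrd) (Or.inl ENNReal.ofReal_ne_top), mul_pow,
      ENNReal.ofReal_mul (by positivity), ENNReal.ofReal_pow (by norm_num : (0 : ℝ) ≤ 2),
      ENNReal.ofReal_ofNat]
    calc (ENNReal.ofReal (r ^ d))⁻¹ * V⁻¹ * (2 ^ d * ENNReal.ofReal (r ^ d))
        = (ENNReal.ofReal (r ^ d) * (ENNReal.ofReal (r ^ d))⁻¹) * (V⁻¹ * 2 ^ d) := by ring
      _ = _ := by rw [ENNReal.mul_inv_cancel hrd ENNReal.ofReal_ne_top, one_mul]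
  have e3 : (V.toNNReal⁻¹ : ℝ≥0) = V⁻¹ := by
    rw [ENNReal.coe_inv (by simp [ENNReal.toNNReal_eq_zero_iff, hV0, hVt]),
      ENNReal.coe_toNNReal hVt]
  push_cast
  rw [e3, ← e2, e1]
  ring

end Poincare

/-! ### Lipschitz domains -/

section Domain

variable {d : ℕ} {Ω : Set (E d)}

/-- The ball of radius `ρ` about `z` is a Lipschitz chart for `Ω`. -/
def IsChart (Ω : Set (E d)) (L : ℝ≥0) (ρ : ℝ) (z e : E d) (g : E d → ℝ) : Prop :=
  ‖e‖ = 1 ∧ LipschitzWith L g ∧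
    ∀ y ∈ ball z ρ, (y ∈ Ω ↔ g (y - inner ℝ e y • e) < inner ℝ e y)

theorem IsLipschitzDomain.isCompact_frontier (hΩ : IsLipschitzDomain Ω) :
    IsCompact (frontier Ω) :=
  hΩ.isBounded.isCompact_closure.of_isClosed_subset isClosed_frontier frontier_subset_closure

/-- Compactness of the boundary: a chart ball of radius r serves all boundary points of its
concentric half, with radius r/2, and finitely many halves cover. -/
theorem IsLipschitzDomain.exists_uniform_chart (hΩ : IsLipschitzDomain Ω) :
    ∃ (L : ℝ≥0) (ρ : ℝ), 0 < ρ ∧ ∀ z ∈ frontier Ω, ∃ e g, IsChart Ω L ρ z e g := by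
  refine hΩ.isCompact_frontier.induction_on
    (p := fun s => ∃ (L : ℝ≥0) (ρ : ℝ), 0 < ρ ∧ ∀ z ∈ s, ∃ e g, IsChart Ω L ρ z e g) ?_ ?_ ?_ ?_
  · exact ⟨0, 1, one_pos, fun z hz => absurd hz (notMem_empty z)⟩
  · rintro s t hst ⟨L, ρ, hρ, h⟩
    exact ⟨L, ρ, hρ, fun z hz => h z (hst hz)⟩
  · rintro s t ⟨L, ρ, hρ, h⟩ ⟨L', ρ', hρ', h'⟩
    refine ⟨max L L', min ρ ρ', lt_min hρ hρ', ?_⟩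
    rintro z (hz | hz)
    · obtain ⟨e, g, h1, h2, h3⟩ := h z hz
      exact ⟨e, g, h1, h2.weaken (le_max_left _ _), fun y hy =>
        h3 y (Metric.ball_subset_ball (min_le_left _ _) hy)⟩
    · obtain ⟨e, g, h1, h2, h3⟩ := h' z hz
      exact ⟨e, g, h1, h2.weaken (le_max_right _ _), fun y hy =>
        h3 y (Metric.ball_subset_ball (min_le_right _ _) hy)⟩
  · intro x hx
    obtain ⟨e, g, L, r, h1, h2, hr, h3⟩ := hΩ.lipschitz x hx
    refine ⟨ball x (r / 2), mem_nhdsWithin_of_mem_nhds (Metric.ball_mem_nhds _ (half_pos hr)),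
      L, r / 2, half_pos hr, fun z hz => ⟨e, g, h1, h2, fun y hy => h3 y ?_⟩⟩
    rw [Metric.mem_ball] at *
    linarith [dist_triangle y z x]

theorem norm_sub_inner_smul_le {e : E d} (he : ‖e‖ = 1) (y : E d) :
    ‖y - inner ℝ e y • e‖ ≤ ‖y‖ := by
  have h : ‖y - inner ℝ e y • e‖ ^ 2 = ‖y‖ ^ 2 - inner ℝ e y ^ 2 := by
    rw [norm_sub_sq_real, inner_smul_right, real_inner_comm, norm_smul, he]
    simp only [Real.norm_eq_abs, mul_one, sq_abs]
    ring
  refine abs_le_of_sq_le_sq' ?_ (norm_nonneg _) |>.2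
  rw [h]
  nlinarith [sq_nonneg (inner ℝ e y : ℝ)]

/-- A shift along e does not change the argument of g, so only the component of y orthogonal to e
matters. -/
theorem IsChart.le_add {L : ℝ≥0} {ρ : ℝ} {z e : E d} {g : E d → ℝ} (h : IsChart Ω L ρ z e g)
    (x y : E d) (t : ℝ) :
    g (x + t • e + y - inner ℝ e (x + t • e + y) • e) ≤ g (x - inner ℝ e x • e) + L * ‖y‖ := by
  have h1 : inner ℝ e e = (1 : ℝ) := by simp [h.1]
  have h2 : x + t • e + y - inner ℝ e (x + t • e + y) • e =
      (x - inner ℝ e x • e) + (y - inner ℝ e y • e) := by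
    simp only [inner_add_right, inner_smul_right, h1]
    module
  have h3 := h.2.1.dist_le_mul (x + t • e + y - inner ℝ e (x + t • e + y) • e)
    (x - inner ℝ e x • e)
  rw [h2, dist_eq_norm, dist_eq_norm, add_sub_cancel_left] at h3
  rw [h2]
  have := (Real.norm_eq_abs _ ▸ le_abs_self _ : _ ≤ ‖g ((x - inner ℝ e x • e) +
    (y - inner ℝ e y • e)) - g (x - inner ℝ e x • e)‖)
  have h4 : L * ‖y - inner ℝ e y • e‖ ≤ L * ‖y‖ := by
    gcongr
    exact norm_sub_inner_smul_le h.1 y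
  linarith

theorem IsChart.inner_add {L : ℝ≥0} {ρ : ℝ} {z e : E d} {g : E d → ℝ} (h : IsChart Ω L ρ z e g)
    (x y : E d) (t : ℝ) :
    |inner ℝ e (x + t • e + y) - (inner ℝ e x + t)| ≤ ‖y‖ := by
  have h1 : inner ℝ e e = (1 : ℝ) := by simp [h.1]
  have h2 : inner ℝ e (x + t • e + y) - (inner ℝ e x + t) = (inner ℝ e y : ℝ) := by
    simp only [inner_add_right, inner_smul_right, h1]
    ring
  rw [h2]
  simpa [h.1] using abs_real_inner_le_norm e y

/-- Interior cone condition: the shift by t raises the point by t, while the perturbation y can lift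
the graph by at most L‖y‖ and lower the point by at most ‖y‖. -/
theorem IsChart.add_mem {L : ℝ≥0} {ρ : ℝ} {z e : E d} {g : E d → ℝ} (h : IsChart Ω L ρ z e g)
    {x y : E d} {t : ℝ} (hx : x ∈ Ω) (hxb : x ∈ ball z ρ) (hb : x + t • e + y ∈ ball z ρ)
    (hy : (L + 1) * ‖y‖ ≤ t) : x + t • e + y ∈ Ω := by
  rw [h.2.2 _ hb]
  have h1 := (h.2.2 _ hxb).1 hx
  have h2 := h.le_add x y t
  have h3 := (abs_le.1 (h.inner_add x y t)).1
  linarith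

/-- Exterior cone condition, the mirror image of `IsChart.add_mem`. -/
theorem IsChart.sub_notMem {L : ℝ≥0} {ρ : ℝ} {z e : E d} {g : E d → ℝ} (h : IsChart Ω L ρ z e g)
    {y : E d} {t : ℝ} (hz : z ∉ Ω) (hρ : 0 < ρ) (hb : z - t • e + y ∈ ball z ρ)
    (hy : (L + 1) * ‖y‖ ≤ t) : z - t • e + y ∉ Ω := by
  rw [h.2.2 _ hb, not_lt]
  have h1 := (h.2.2 z (Metric.mem_ball_self hρ)).not.1 hz
  rw [not_lt] at h1
  have h2 := h.le_add (z - t • e + y) (-y) t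
  rw [show z - t • e + y + t • e + -y = z by abel, norm_neg] at h2
  have h3 := (abs_le.1 (h.inner_add z y (-t))).2
  rw [neg_smul, ← sub_eq_add_neg] at h3
  linarith

theorem IsChart.ball_disjoint {L : ℝ≥0} {ρ : ℝ} {z e : E d} {g : E d → ℝ}
    (h : IsChart Ω L ρ z e g) {t : ℝ} (hz : z ∉ Ω) (ht : 0 < t) (htρ : 2 * t < ρ) :
    closedBall (z - t • e) (t / (L + 1)) ⊆ closedBall z (2 * t) \ Ω := by
  intro y hy
  have hL : (0 : ℝ) < L + 1 := by positivity
  rw [Metric.mem_closedBall, dist_eq_norm, le_div_iff₀ hL] at hy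
  have hle : ‖y - (z - t • e)‖ ≤ t := by
    have : 0 ≤ L * ‖y - (z - t • e)‖ := by positivity
    linarith
  have hyz : dist y z ≤ 2 * t := by
    rw [dist_eq_norm]
    calc ‖y - z‖ = ‖(y - (z - t • e)) - t • e‖ := by congr 1; abel
      _ ≤ ‖y - (z - t • e)‖ + ‖t • e‖ := norm_sub_le _ _
      _ ≤ 2 * t := by
        rw [norm_smul, h.1, Real.norm_eq_abs, abs_of_pos ht]
        linarith
  refine ⟨hyz, ?_⟩
  have e1 : z - t • e + (y - (z - t • e)) = y := by abel
  have := h.sub_notMem (y := y - (z - t • e)) (t := t) hz (by linarith)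
    (by rw [e1, Metric.mem_ball]; linarith) (by linarith)
  rwa [e1] at this

theorem notMem_of_mem_frontier (hΩ : IsOpen Ω) {z : E d} (hz : z ∈ frontier Ω) : z ∉ Ω := by
  rw [hΩ.frontier_eq] at hz
  exact hz.2

/-- Arbitrarily close to a boundary point there are balls in the exterior, so no boundary point is
interior to the closure. This excludes slits, and it places the interiors of the mesh elements in Ω.
-/
theorem IsLipschitzDomain.interior_closure (hΩ : IsLipschitzDomain Ω) :
    interior (closure Ω) = Ω := by
  refine Subset.antisymm (fun z hz => ?_) (hΩ.isOpen.subset_interior_iff.2 subset_closure)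
  by_contra hzΩ
  have hzf : z ∈ frontier Ω := by
    rw [hΩ.isOpen.frontier_eq]
    exact ⟨interior_subset hz, hzΩ⟩
  obtain ⟨L, ρ, hρ, h⟩ := hΩ.exists_uniform_chart
  obtain ⟨e, g, hc⟩ := h z hzf
  obtain ⟨ε, hε, hεz⟩ := Metric.isOpen_iff.1 isOpen_interior z hz
  set t := min (ε / 2) (ρ / 4) with ht
  have ht0 : 0 < t := by positivity
  have h1 : z - t • e ∈ closure Ω := by
    refine interior_subset (hεz ?_)
    rw [Metric.mem_ball, dist_eq_norm, sub_sub_cancel_left, norm_neg, norm_smul, hc.1,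
      Real.norm_eq_abs, abs_of_pos ht0]
    linarith [min_le_left (ε / 2) (ρ / 4)]
  have h2 := hc.ball_disjoint hzΩ ht0 (by linarith [min_le_right (ε / 2) (ρ / 4)])
  obtain ⟨y, hy, hyΩ⟩ := Metric.mem_closure_iff.1 h1 (t / (L + 1)) (by positivity)
  refine (h2 ?_).2 hy
  rw [Metric.mem_closedBall, dist_comm]
  exact hyΩ.le

/-- The exterior of a Lipschitz domain is substantial near each boundary point. -/
theorem IsLipschitzDomain.exists_volume_diff_ge (hΩ : IsLipschitzDomain Ω) {Rmax : ℝ}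
    (hR : 0 < Rmax) : ∃ δ : ℝ, 0 < δ ∧ ∀ z ∈ frontier Ω, ∀ r : ℝ, 0 < r → r ≤ Rmax →
      ENNReal.ofReal (δ * r ^ d) ≤ volume (closedBall z r \ Ω) := by
  obtain ⟨L, ρ, hρ, h⟩ := hΩ.exists_uniform_chart
  set V := volume (closedBall (0 : E d) 1) with hV
  have hVt : V ≠ ⊤ := measure_closedBall_lt_top.ne
  have hV0 : 0 < V := Metric.measure_closedBall_pos _ _ one_pos
  -- The shift rs along the axis must be at most r/2, to remain in the ball of radius r, and at most
  -- ρ/4, to remain in the chart for every r ≤ Rmax.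
  set s := min (1 / 2) (ρ / (4 * Rmax)) with hs
  have hs0 : 0 < s := by positivity
  refine ⟨(s / (L + 1)) ^ d * V.toReal, mul_pos (by positivity) (ENNReal.toReal_pos hV0.ne' hVt),
    fun z hz r hr hrR => ?_⟩
  obtain ⟨e, g, hc⟩ := h z hz
  have h1 : r * s ≤ r / 2 := by
    have := mul_le_mul_of_nonneg_left (min_le_left (1 / 2) (ρ / (4 * Rmax))) hr.le
    linarith
  have h2 : r * s ≤ ρ / 4 := by
    calc r * s ≤ Rmax * (ρ / (4 * Rmax)) := by
          gcongr
          exact min_le_right _ _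
      _ = ρ / 4 := by field_simp
  have h3 := hc.ball_disjoint (notMem_of_mem_frontier hΩ.isOpen hz) (t := r * s) (by positivity)
    (by linarith)
  have h4 : closedBall (z - (r * s) • e) (r * s / (L + 1)) ⊆ closedBall z r \ Ω :=
    h3.trans (sdiff_subset_sdiff_left (Metric.closedBall_subset_closedBall (by linarith)))
  refine le_trans (le_of_eq ?_) (measure_mono h4)
  rw [volume_closedBall_eq _ (by positivity), ← hV, mul_div_assoc, mul_pow,
    mul_comm (r ^ d), mul_right_comm, ENNReal.ofReal_mul (by positivity),
    ENNReal.ofReal_toReal hVt]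

/-! #### Chains of segments -/

/-- `y` can be reached from `x` by at most `B` segments in `Ω` of length at most `s`. -/
inductive Reach (Ω : Set (E d)) (s : ℝ) : ℕ → E d → E d → Prop
  | refl (x : E d) : Reach Ω s 0 x x
  | step {n : ℕ} {x y z : E d} : Reach Ω s n x y → segment ℝ y z ⊆ Ω → dist y z ≤ s →
      Reach Ω s (n + 1) x z

theorem Reach.trans {s : ℝ} {n m : ℕ} {x y z : E d} (h : Reach Ω s n x y)
    (h' : Reach Ω s m y z) : Reach Ω s (n + m) x z := by
  induction h' with
  | refl => exact h
  | step _ h1 h2 ih => exact (ih h).step h1 h2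

theorem Reach.single {s : ℝ} {x y : E d} (h1 : segment ℝ x y ⊆ Ω) (h2 : dist x y ≤ s) :
    Reach Ω s 1 x y := (Reach.refl x).step h1 h2

theorem Reach.symm {s : ℝ} {n : ℕ} {x y : E d} (h : Reach Ω s n x y) : Reach Ω s n y x := by
  induction h with
  | refl => exact .refl _
  | @step n x y z _ h1 h2 ih =>
    rw [add_comm]
    exact (Reach.single (segment_symm ℝ y z ▸ h1) (dist_comm y z ▸ h2)).trans ih

theorem Reach.of_segment {s : ℝ} (n : ℕ) : ∀ {x y : E d}, segment ℝ x y ⊆ Ω →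
    dist x y ≤ n * s → Reach Ω s n x y := by
  induction n with
  | zero =>
    intro x y _ h
    have : x = y := dist_le_zero.1 (by simpa using h)
    exact this ▸ .refl x
  | succ n ih =>
    intro x y h1 h2
    have hn : (0 : ℝ) < n + 1 := by positivity
    have hz : AffineMap.lineMap x y ((n : ℝ) / (n + 1)) ∈ segment ℝ x y := by
      rw [segment_eq_image_lineMap]
      exact ⟨_, ⟨by positivity, (div_le_one hn).2 (by linarith)⟩, rfl⟩
    refine (ih (y := AffineMap.lineMap x y ((n : ℝ) / (n + 1))) ?_ ?_).step ?_ ?_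
    · exact ((convex_segment x y).segment_subset (left_mem_segment ℝ x y) hz).trans h1
    · rw [dist_left_lineMap, Real.norm_of_nonneg (by positivity), div_mul_eq_mul_div,
        div_le_iff₀ hn, mul_assoc]
      push_cast at h2
      gcongr
      linarith
    · exact ((convex_segment x y).segment_subset hz (right_mem_segment ℝ x y)).trans h1
    · push_cast at h2
      have : (1 : ℝ) - n / (n + 1) = 1 / (n + 1) := by field_simp; ring
      rw [dist_lineMap_right, this, Real.norm_of_nonneg (by positivity), div_mul_eq_mul_div,
        div_le_iff₀ hn]
      linarith

theorem Reach.exists_of_segment {s a : ℝ} (hs : 0 < s) (ha : 0 ≤ a) {x y : E d}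
    (h1 : segment ℝ x y ⊆ Ω) (h2 : dist x y ≤ a) :
    ∃ n : ℕ, (n : ℝ) ≤ a / s + 1 ∧ Reach Ω s n x y := by
  refine ⟨⌈a / s⌉₊, (Nat.ceil_lt_add_one (by positivity)).le, .of_segment _ h1 (h2.trans ?_)⟩
  rw [← div_le_iff₀ hs]
  exact Nat.le_ceil _

theorem exists_mem_frontier_of_segment (hΩ : IsOpen Ω) {x y : E d} (hx : x ∈ Ω)
    (h : ¬ segment ℝ x y ⊆ Ω) : ∃ z ∈ frontier Ω, dist x z ≤ dist x y := by
  by_contra! hcon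
  refine h ?_
  have hpc : IsPreconnected (segment ℝ x y) := (convex_segment x y).isPreconnected
  refine hpc.subset_of_closure_inter_subset hΩ ⟨x, left_mem_segment ℝ x y, hx⟩ ?_
  rintro z ⟨hz1, hz2⟩
  by_contra hz3
  refine absurd (hcon z (by rw [hΩ.frontier_eq]; exact ⟨hz1, hz3⟩)) (not_lt.2 ?_)
  have := dist_add_dist_of_mem_segment hz2
  linarith [dist_nonneg (x := z) (y := y)]

/-- If the straight segment leaves Ω, a boundary point is near and its chart applies: both points
are lifted along e by (L + 1) dist x y, and by the cone condition the segment between the lifted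
points stays in Ω. The path has three pieces of length at most (L + 1) dist x y, and rounding up
adds at most one link to each. -/
theorem IsLipschitzDomain.exists_local_reach (hΩ : IsLipschitzDomain Ω) :
    ∃ a ρ : ℝ, 0 < a ∧ 0 < ρ ∧ ∀ x ∈ Ω, ∀ y ∈ Ω, dist x y ≤ ρ → ∀ s : ℝ, 0 < s →
      ∃ n : ℕ, (n : ℝ) ≤ a * (dist x y / s) + 3 ∧ Reach Ω s n x y := by
  obtain ⟨L, ρ, hρ, h⟩ := hΩ.exists_uniform_chart
  have hL : (0 : ℝ) < L + 4 := by positivity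
  refine ⟨3 * (L + 1), ρ / (2 * (L + 4)), by positivity, by positivity, fun x hx y hy hxy s hs => ?_⟩
  have hd0 : 0 ≤ dist x y := dist_nonneg
  by_cases hseg : segment ℝ x y ⊆ Ω
  · obtain ⟨n, hn, hr⟩ := Reach.exists_of_segment hs hd0 hseg le_rfl
    refine ⟨n, hn.trans ?_, hr⟩
    have h1 : dist x y / s ≤ 3 * (L + 1) * (dist x y / s) :=
      le_mul_of_one_le_left (by positivity) (by linarith [L.2])
    linarith
  · obtain ⟨z, hz, hxz⟩ := exists_mem_frontier_of_segment hΩ.isOpen hx hseg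
    obtain ⟨e, g, hc⟩ := h z hz
    set η := dist x y with hη
    have hηρ : (L + 4) * η < ρ := by
      rw [le_div_iff₀ (by positivity)] at hxy
      nlinarith
    set t := (L + 1) * η with ht
    have ht0 : 0 ≤ t := by positivity
    have hLη : 0 ≤ L * η := by positivity
    have hmem : ∀ p : E d, ‖p - x‖ ≤ t + η → p ∈ ball z ρ := by
      intro p hp
      rw [Metric.mem_ball]
      rw [← dist_eq_norm] at hp
      have := dist_triangle p x z
      nlinarith
    have hxb : x ∈ ball z ρ := hmem x (by simp; positivity)
    have hyx : ‖y - x‖ = η := by rw [hη, dist_comm, dist_eq_norm]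
    have hyb : y ∈ ball z ρ := hmem y (by rw [hyx]; linarith)
    have hn : ∀ τ : ℝ, 0 ≤ τ → ‖τ • e‖ = τ := fun τ hτ => by
      rw [norm_smul, hc.1, mul_one, Real.norm_of_nonneg hτ]
    have s1 : segment ℝ x (x + t • e) ⊆ Ω := by
      rw [segment_eq_image']
      rintro _ ⟨θ, hθ, rfl⟩
      have hθt : θ * t ≤ t := mul_le_of_le_one_left ht0 hθ.2
      have hθ0 : 0 ≤ θ * t := mul_nonneg hθ.1 ht0
      have := hc.add_mem (y := 0) (t := θ * t) hx hxb
        (hmem _ (by simp [hn _ hθ0]; linarith)) (by simpa using hθ0)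
      simpa [smul_smul] using this
    have s2 : segment ℝ (y + t • e) y ⊆ Ω := by
      rw [segment_symm, segment_eq_image']
      rintro _ ⟨θ, hθ, rfl⟩
      have hθt : θ * t ≤ t := mul_le_of_le_one_left ht0 hθ.2
      have hθ0 : 0 ≤ θ * t := mul_nonneg hθ.1 ht0
      have := hc.add_mem (y := 0) (t := θ * t) hy hyb
        (hmem _ (by
          rw [add_zero, add_sub_right_comm]
          exact (norm_add_le _ _).trans (by rw [hn _ hθ0, hyx]; linarith)))
        (by simpa using hθ0)
      simpa [smul_smul] using this
    have s3 : segment ℝ (x + t • e) (y + t • e) ⊆ Ω := by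
      rw [segment_eq_image']
      rintro _ ⟨θ, hθ, rfl⟩
      have hle : ‖θ • (y - x)‖ ≤ η := by
        rw [norm_smul, hyx, Real.norm_of_nonneg hθ.1]
        exact mul_le_of_le_one_left hd0 hθ.2
      have := hc.add_mem (y := θ • (y - x)) (t := t) hx hxb
        (hmem _ (by
          rw [add_assoc, add_sub_cancel_left]
          exact (norm_add_le _ _).trans (by rw [hn _ ht0]; linarith)))
        (by rw [ht]; gcongr)
      simpa using this
    obtain ⟨n1, hn1, r1⟩ := Reach.exists_of_segment hs ht0 s1 (by simp [hn _ ht0])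
    obtain ⟨n2, hn2, r2⟩ := Reach.exists_of_segment hs ht0 s3
      (by simp only [dist_add_right]; rw [← hη]; linarith)
    obtain ⟨n3, hn3, r3⟩ := Reach.exists_of_segment hs ht0 s2 (by simp [hn _ ht0])
    refine ⟨n1 + n2 + n3, ?_, (r1.trans r2).trans r3⟩
    push_cast
    have : 3 * (L + 1) * (η / s) = 3 * (t / s) := by rw [ht]; ring
    linarith

/-- Lipschitz domains are quasiconvex. -/
theorem IsLipschitzDomain.exists_reach (hΩ : IsLipschitzDomain Ω) :
    ∃ K : ℝ, 0 < K ∧ ∀ x ∈ Ω, ∀ y ∈ Ω, ∀ s : ℝ, 0 < s →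
      ∃ n : ℕ, (n : ℝ) ≤ K * (dist x y / s) + K ∧ Reach Ω s n x y := by
  obtain ⟨a, ρ, ha, hρ, hloc⟩ := hΩ.exists_local_reach
  obtain ⟨x₀, hx₀⟩ := hΩ.isConnected.nonempty
  -- P K y says that y is reached from the base point x₀ by at most K/s + K links at every scale s.
  -- The points with some such K form an open and relatively closed subset of Ω, hence all of it,
  -- and compactness of the closure makes K uniform.
  set P : ℝ → E d → Prop := fun K y => ∀ s : ℝ, 0 < s →
    ∃ n : ℕ, (n : ℝ) ≤ K / s + K ∧ Reach Ω s n x₀ y with hP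
  have hstep : ∀ K, ∀ y ∈ Ω, ∀ y' ∈ Ω, dist y y' ≤ ρ → P K y → P (K + (a * ρ + 3)) y' := by
    intro K y hy y' hy' hyy h s hs
    obtain ⟨n, hn, hr⟩ := h s hs
    obtain ⟨m, hm, hr'⟩ := hloc y hy y' hy' hyy s hs
    refine ⟨n + m, ?_, hr.trans hr'⟩
    push_cast
    have h1 : a * (dist y y' / s) ≤ a * ρ / s := by
      rw [mul_div_assoc]
      gcongr
    have h2 : (0 : ℝ) ≤ 3 / s := by positivity
    have h3 : 0 ≤ a * ρ := by positivity
    rw [add_div, add_div]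
    linarith
  have hpt : ∀ y ∈ Ω, ∃ K, P K y := by
    set U := {y | y ∈ Ω ∧ ∃ K, P K y} with hU
    have hUo : IsOpen U := by
      rw [Metric.isOpen_iff]
      rintro y ⟨hy, K, hK⟩
      obtain ⟨ε, hε, hεy⟩ := Metric.isOpen_iff.1 hΩ.isOpen y hy
      refine ⟨min ε ρ, lt_min hε hρ, fun y' hy' => ?_⟩
      have hy'Ω := hεy (Metric.ball_subset_ball (min_le_left _ _) hy')
      refine ⟨hy'Ω, _, hstep K y hy y' hy'Ω ?_ hK⟩
      rw [dist_comm]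
      exact (Metric.mem_ball.1 (Metric.ball_subset_ball (min_le_right _ _) hy')).le
    have hsub : Ω ⊆ U := by
      refine hΩ.isConnected.isPreconnected.subset_of_closure_inter_subset hUo
        ⟨x₀, hx₀, hx₀, 0, fun s hs => ⟨0, by simp, .refl _⟩⟩ ?_
      rintro y ⟨hy1, hy2⟩
      obtain ⟨y', ⟨hy', K, hK⟩, hd⟩ := Metric.mem_closure_iff.1 hy1 ρ hρ
      exact ⟨hy2, _, hstep K y' hy' y hy2 (by rw [dist_comm]; exact hd.le) hK⟩
    exact fun y hy => (hsub hy).2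
  have hmono : ∀ K K' y, K ≤ K' → P K y → P K' y := by
    intro K K' y hKK h s hs
    obtain ⟨n, hn, hr⟩ := h s hs
    refine ⟨n, hn.trans ?_, hr⟩
    gcongr
  obtain ⟨K, hK⟩ : ∃ K, ∀ y ∈ closure Ω ∩ Ω, P K y := by
    have := hΩ.isBounded.isCompact_closure.induction_on
      (p := fun t => ∃ K, ∀ y ∈ t ∩ Ω, P K y) ⟨0, by simp⟩ ?_ ?_ ?_
    · exact this
    · rintro t t' htt ⟨K, hK⟩
      exact ⟨K, fun y hy => hK y ⟨htt hy.1, hy.2⟩⟩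
    · rintro t t' ⟨K, hK⟩ ⟨K', hK'⟩
      refine ⟨max K K', ?_⟩
      rintro y ⟨hy | hy, hyΩ⟩
      · exact hmono _ _ _ (le_max_left _ _) (hK y ⟨hy, hyΩ⟩)
      · exact hmono _ _ _ (le_max_right _ _) (hK' y ⟨hy, hyΩ⟩)
    · intro x _
      refine ⟨ball x (ρ / 2), mem_nhdsWithin_of_mem_nhds (Metric.ball_mem_nhds _ (half_pos hρ)), ?_⟩
      rcases (ball x (ρ / 2) ∩ Ω).eq_empty_or_nonempty with h | ⟨y, hy, hyΩ⟩
      · exact ⟨0, by simp [h]⟩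
      · obtain ⟨K, hK⟩ := hpt y hyΩ
        refine ⟨_, fun y' hy' => hstep K y hyΩ y' hy'.2 ?_ hK⟩
        have := Metric.mem_ball.1 hy'.1
        have := Metric.mem_ball.1 hy
        linarith [dist_triangle_right y y' x]
  have hK0 : ∀ y ∈ Ω, P (max K 0) y := fun y hy =>
    hmono _ _ _ (le_max_left _ _) (hK y ⟨subset_closure hy, hy⟩)
  set K₁ := max K 0 with hK₁
  have hK₁0 : 0 ≤ K₁ := le_max_right _ _
  refine ⟨a + 3 + 2 * K₁ + 2 * K₁ / ρ, by positivity, fun x hx y hy s hs => ?_⟩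
  have hdist : 0 ≤ dist x y / s := by positivity
  have hρK : 0 ≤ 2 * K₁ / ρ := by positivity
  -- Near points are joined locally. Far points are joined through x₀, and the cost of order 1/s of
  -- this detour is of order dist x y / s because dist x y > ρ.
  rcases le_or_gt (dist x y) ρ with hxy | hxy
  · obtain ⟨n, hn, hr⟩ := hloc x hx y hy hxy s hs
    refine ⟨n, hn.trans ?_, hr⟩
    have : a * (dist x y / s) ≤ (a + 3 + 2 * K₁ + 2 * K₁ / ρ) * (dist x y / s) := by
      gcongr
      linarith
    linarith
  · obtain ⟨n, hn, hr⟩ := hK0 x hx s hs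
    obtain ⟨m, hm, hr'⟩ := hK0 y hy s hs
    refine ⟨n + m, ?_, hr.symm.trans hr'⟩
    push_cast
    have h1 : K₁ / s ≤ K₁ / ρ * (dist x y / s) := by
      rw [div_mul_div_comm, div_le_div_iff₀ hs (by positivity)]
      have : K₁ * ρ * s ≤ K₁ * dist x y * s := by gcongr
      linarith
    have h2 : 2 * (K₁ / ρ * (dist x y / s)) ≤
        (a + 3 + 2 * K₁ + 2 * K₁ / ρ) * (dist x y / s) := by
      rw [← mul_assoc]
      gcongr
      have : 2 * (K₁ / ρ) = 2 * K₁ / ρ := by ring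
      linarith
    linarith

end Domain

/-! ### Finite elements on simplicial complexes -/

section Gluing

/-- A neighbourhood of p avoids the finitely many closed sets that do not contain p, so y and p lie
in a common member of the cover. -/
theorem eventually_dist_le_of_closed_cover {X ι : Type*} [PseudoMetricSpace X] [Finite ι]
    {A : ι → Set X} (hA : ∀ i, IsClosed (A i)) {f : X → ℝ} {K : ℝ≥0}
    (hf : ∀ i, LipschitzOnWith K f (A i)) {p : X} (hp : ∀ᶠ y in nhds p, y ∈ ⋃ i, A i) :
    ∀ᶠ y in nhds p, dist (f y) (f p) ≤ K * dist y p := by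
  have h1 : ∀ᶠ y in nhds p, ∀ i, p ∉ A i → y ∉ A i := by
    rw [Filter.eventually_all]
    intro i
    by_cases hi : p ∈ A i
    · simp [hi]
    · filter_upwards [(hA i).isOpen_compl.mem_nhds hi] with y hy _ using hy
  filter_upwards [h1, hp] with y hy1 hy2
  obtain ⟨i, hi⟩ := mem_iUnion.1 hy2
  have hpi : p ∈ A i := by
    by_contra h
    exact hy1 i h hi
  exact (hf i).dist_le_mul y hi p hpi

/-- Along the segment from x to y, the distance of the value of f to f x has right slopes bounded by
K dist y x; the mean value inequality for slopes integrates this. Comparison with the centre p alone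
is enough. -/
theorem lipschitzWith_of_eventually {F : Type*} [NormedAddCommGroup F] [NormedSpace ℝ F]
    {f : F → ℝ} {K : ℝ≥0} (hf : ∀ p, ∀ᶠ y in nhds p, dist (f y) (f p) ≤ K * dist y p) :
    LipschitzWith K f := by
  have hcont : Continuous f := by
    rw [continuous_iff_continuousAt]
    intro p
    rw [ContinuousAt, tendsto_iff_dist_tendsto_zero]
    refine squeeze_zero' (Filter.Eventually.of_forall fun _ => dist_nonneg) (hf p) ?_
    have : Continuous fun y => K * dist y p := by fun_prop
    simpa using this.tendsto p
  refine LipschitzWith.of_dist_le_mul fun y x => ?_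
  set γ : ℝ → F := fun t => x + t • (y - x) with hγ
  have hγc : Continuous γ := by fun_prop
  set K' : ℝ := K * dist y x with hK'
  have hloc : ∀ t : ℝ, ∀ᶠ z in nhds t, dist (f (γ z)) (f (γ t)) ≤ K' * dist z t := by
    intro t
    filter_upwards [hγc.continuousAt.eventually (hf (γ t))] with z hz
    refine hz.trans (le_of_eq ?_)
    rw [hγ, dist_add_left, dist_eq_norm (z • (y - x)), ← sub_smul, norm_smul, dist_eq_norm z t,
      hK', dist_eq_norm y x]
    ring
  have key := image_le_of_liminf_slope_right_le_deriv_boundary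
    (f := fun t => dist (f (γ t)) (f x)) (a := 0) (b := 1) (B := fun t => K' * t)
    (B' := fun _ => K') (by fun_prop) (by simp [hγ]) (by fun_prop)
    (fun t _ => by simpa using ((hasDerivAt_id t).const_mul K').hasDerivWithinAt) ?_
    (right_mem_Icc.2 zero_le_one)
  · simpa [hγ] using key
  · intro t _ r hr
    refine Filter.Eventually.frequently ?_
    filter_upwards [mem_nhdsWithin_of_mem_nhds (hloc t), self_mem_nhdsWithin] with z hz hzt
    refine lt_of_le_of_lt ?_ hr
    have hzt' : 0 < z - t := sub_pos.2 hzt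
    rw [slope_def_field, div_le_iff₀ hzt']
    rw [Real.dist_eq z t, abs_of_pos hzt'] at hz
    linarith [dist_triangle (f (γ z)) (f (γ t)) (f x)]

end Gluing

/-! ### Barycentric coordinates. -/

section Barycentric

variable {d : ℕ}

theorem affineMap_sum_smul (a : E d →ᵃ[ℝ] ℝ) {s : Finset (E d)} {w : E d → ℝ}
    (hw : ∑ y ∈ s, w y = 1) : a (∑ y ∈ s, w y • y) = ∑ y ∈ s, w y * a y := by
  rw [a.decomp]
  simp only [Pi.add_apply, map_sum, map_smul, smul_eq_mul, mul_add, Finset.sum_add_distrib,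
    ← Finset.sum_mul, hw, one_mul]

theorem eq_of_sum_smul_eq {s : Finset (E d)}
    (hs : AffineIndependent ℝ (Subtype.val : s → E d)) {w w' : E d → ℝ}
    (hw : ∑ y ∈ s, w y = 1) (hw' : ∑ y ∈ s, w' y = 1)
    (h : ∑ y ∈ s, w y • y = ∑ y ∈ s, w' y • y) : ∀ y ∈ s, w y = w' y := by
  intro y hy
  have := affineIndependent_iff.1 hs Finset.univ (fun z => w z - w' z) ?_ ?_ ⟨y, hy⟩
    (Finset.mem_univ _)
  · linarith
  · rw [Finset.sum_coe_sort s (fun z => w z - w' z), Finset.sum_sub_distrib, hw, hw', sub_self]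
  · rw [Finset.sum_coe_sort s (fun z => (w z - w' z) • z)]
    simp [sub_smul, Finset.sum_sub_distrib, h]

/-- `w` is the family of barycentric coordinates of the point `x` in the simplex `s`, extended by
`0` to the other vertices. -/
structure IsWeight (s : Finset (E d)) (w : E d → ℝ) (x : E d) : Prop where
  nonneg : ∀ y, 0 ≤ w y
  eq_zero : ∀ y, y ∉ s → w y = 0
  sum_eq : ∑ y ∈ s, w y = 1
  sum_smul_eq : ∑ y ∈ s, w y • y = x

theorem exists_isWeight {s : Finset (E d)} {x : E d} (hx : x ∈ convexHull ℝ (s : Set (E d))) :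
    ∃ w, IsWeight s w x := by
  classical
  obtain ⟨w, h1, h2, h3⟩ := Finset.mem_convexHull'.1 hx
  refine ⟨fun y => if y ∈ s then w y else 0, fun y => ?_, fun y hy => if_neg hy, ?_, ?_⟩
  · split_ifs with hy
    exacts [h1 y hy, le_rfl]
  · rw [← h2]
    exact Finset.sum_congr rfl fun y hy => if_pos hy
  · rw [← h3]
    exact Finset.sum_congr rfl fun y hy => by rw [if_pos hy]

theorem IsWeight.mem {s : Finset (E d)} {w : E d → ℝ} {x : E d} (h : IsWeight s w x) :
    x ∈ convexHull ℝ (s : Set (E d)) :=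
  Finset.mem_convexHull'.2 ⟨w, fun y _ => h.nonneg y, h.sum_eq, h.sum_smul_eq⟩

theorem IsWeight.mono {s t : Finset (E d)} {w : E d → ℝ} {x : E d} (h : IsWeight s w x)
    (hst : s ⊆ t) : IsWeight t w x := by
  refine ⟨h.nonneg, fun y hy => h.eq_zero y fun hys => hy (hst hys), ?_, ?_⟩
  · rw [← h.sum_eq]
    exact (Finset.sum_subset hst fun y _ hy => h.eq_zero y hy).symm
  · rw [← h.sum_smul_eq]
    exact (Finset.sum_subset hst fun y _ hy => by rw [h.eq_zero y hy, zero_smul]).symm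

theorem IsWeight.eq {s : Finset (E d)} (hs : AffineIndependent ℝ (Subtype.val : s → E d))
    {w w' : E d → ℝ} {x : E d} (h : IsWeight s w x) (h' : IsWeight s w' x) : w = w' := by
  funext y
  by_cases hy : y ∈ s
  · exact eq_of_sum_smul_eq hs h.sum_eq h'.sum_eq (h.sum_smul_eq.trans h'.sum_smul_eq.symm) y hy
  · rw [h.eq_zero y hy, h'.eq_zero y hy]

theorem IsWeight.bary_eq {s : Finset (E d)} (hs : AffineIndependent ℝ (Subtype.val : s → E d))
    {w : E d → ℝ} {x : E d} (h : IsWeight s w x) {v : E d} (hv : v ∈ s) : bary s v x = w v := by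
  rw [bary, dif_pos h.mem]
  have h1 := (Finset.mem_convexHull'.1 h.mem).choose_spec
  exact eq_of_sum_smul_eq hs h1.2.1 h.sum_eq (h1.2.2.trans h.sum_smul_eq.symm) v hv

/-- An affinely independent set of any other cardinality spans a proper affine subspace. -/
theorem volume_convexHull_eq_zero {s : Finset (E d)}
    (hs : AffineIndependent ℝ (Subtype.val : s → E d)) (hc : s.card ≠ d + 1) :
    volume (convexHull ℝ (s : Set (E d))) = 0 := by
  refine measure_mono_null (convexHull_subset_affineSpan _) (Measure.addHaar_affineSubspace _ _ ?_)
  intro h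
  have := hs.affineSpan_eq_top_iff_card_eq_finrank_add_one.1 (by simpa using h)
  simp at this
  exact hc this

end Barycentric

/-! ### Nodal basis functions, elements and the mesh size. -/

namespace Mesh

variable {d : ℕ} {Ω : Set (E d)} (M : Mesh Ω)

/-- Conformity: a point common to two simplices lies in the hull of their common vertices, and by
uniqueness its coordinates in either are those in this common face, extended by zero. The simplex
chosen in the definition of `hat` is therefore irrelevant. -/
theorem hat_eq {s : Finset (E d)} (hs : s ∈ M.cplx.faces) {w : E d → ℝ} {x : E d}
    (h : IsWeight s w x) (v : E d) : M.hat v x = w v := by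
  classical
  rw [hat]
  split_ifs with hex
  · obtain ⟨ht, hvt, hxt⟩ := hex.choose_spec
    set t := hex.choose
    have hx : x ∈ convexHull ℝ ((s ∩ t : Finset (E d)) : Set (E d)) := by
      rw [Finset.coe_inter]
      exact M.cplx.inter_subset_convexHull hs ht ⟨h.mem, hxt⟩
    obtain ⟨w', hw'⟩ := exists_isWeight hx
    rw [h.eq (M.cplx.indep hs) (hw'.mono Finset.inter_subset_left),
      (hw'.mono Finset.inter_subset_right).bary_eq (M.cplx.indep ht) hvt]
  · refine (h.eq_zero v fun hv => hex ⟨s, hs, hv, h.mem⟩).symm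

theorem isWeight_hat {s : Finset (E d)} (hs : s ∈ M.cplx.faces) {x : E d}
    (hx : x ∈ convexHull ℝ (s : Set (E d))) : IsWeight s (fun v => M.hat v x) x := by
  obtain ⟨w, hw⟩ := exists_isWeight hx
  have : (fun v => M.hat v x) = w := funext fun v => M.hat_eq hs hw v
  rwa [this]

theorem hat_of_notMem_space {x : E d} (hx : x ∉ M.cplx.space) (v : E d) : M.hat v x = 0 := by
  rw [hat, dif_neg]
  rintro ⟨s, hs, _, h⟩
  exact hx (Geometry.SimplicialComplex.mem_space_iff.2 ⟨s, hs, h⟩)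

theorem hat_nonneg (v x : E d) : 0 ≤ M.hat v x := by
  by_cases hx : x ∈ M.cplx.space
  · obtain ⟨s, hs, hxs⟩ := Geometry.SimplicialComplex.mem_space_iff.1 hx
    exact (M.isWeight_hat hs hxs).nonneg v
  · rw [M.hat_of_notMem_space hx]

theorem hat_le_one (v x : E d) : M.hat v x ≤ 1 := by
  by_cases hx : x ∈ M.cplx.space
  · obtain ⟨s, hs, hxs⟩ := Geometry.SimplicialComplex.mem_space_iff.1 hx
    have h := M.isWeight_hat hs hxs
    by_cases hv : v ∈ s
    · rw [← h.sum_eq]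
      exact Finset.single_le_sum (f := fun v => M.hat v x) (fun y _ => h.nonneg y) hv
    · rw [h.eq_zero v hv]
      exact zero_le_one
  · rw [M.hat_of_notMem_space hx]
    exact zero_le_one

theorem mem_of_hat_ne_zero {s : Finset (E d)} (hs : s ∈ M.cplx.faces) {x v : E d}
    (hx : x ∈ convexHull ℝ (s : Set (E d))) (h : M.hat v x ≠ 0) : v ∈ s := by
  by_contra hv
  exact h ((M.isWeight_hat hs hx).eq_zero v hv)

theorem isWeight_single [DecidableEq (E d)] (v : E d) :
    IsWeight {v} (fun y => if y = v then 1 else 0) v := by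
  refine ⟨fun y => ?_, fun y hy => if_neg (by simpa using hy), by simp, by simp⟩
  split_ifs <;> norm_num

theorem hat_self {v : E d} (hv : v ∈ M.cplx.vertices) : M.hat v v = 1 := by
  classical
  simpa using M.hat_eq hv (isWeight_single v) v

theorem hat_of_ne {v w : E d} (hv : v ∈ M.cplx.vertices) (h : w ≠ v) : M.hat w v = 0 := by
  classical
  simpa [h] using M.hat_eq hv (isWeight_single v) w

theorem exists_affine_hat {s : Finset (E d)} (hs : s ∈ M.elements) (v : E d) :
    ∃ a : E d →ᵃ[ℝ] ℝ, EqOn (M.hat v) a (convexHull ℝ (s : Set (E d))) := by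
  by_cases hv : v ∈ s
  · have hind := M.cplx.indep hs.1
    have htop : affineSpan ℝ (range (Subtype.val : s → E d)) = ⊤ := by
      rw [hind.affineSpan_eq_top_iff_card_eq_finrank_add_one]
      simpa using hs.2
    set b : AffineBasis s ℝ (E d) := ⟨Subtype.val, hind, htop⟩ with hb
    refine ⟨b.coord ⟨v, hv⟩, fun x hx => ?_⟩
    have h := M.isWeight_hat hs.1 hx
    conv_rhs => rw [← h.sum_smul_eq]
    rw [affineMap_sum_smul _ h.sum_eq, Finset.sum_eq_single v]
    · have : b.coord ⟨v, hv⟩ v = 1 := b.coord_apply_eq ⟨v, hv⟩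
      rw [this, mul_one]
    · intro y hy hyv
      have : b.coord ⟨v, hv⟩ y = 0 :=
        b.coord_apply_ne (i := ⟨v, hv⟩) (j := ⟨y, hy⟩) (by simpa [Subtype.ext_iff] using hyv.symm)
      rw [this, mul_zero]
    · exact fun h => absurd hv h
  · exact ⟨0, fun x hx => (M.isWeight_hat hs.1 hx).eq_zero v hv⟩

theorem finite_elements : M.elements.Finite := M.finite.subset fun _ hs => hs.1

theorem isCompact_convexHull (s : Finset (E d)) : IsCompact (convexHull ℝ (s : Set (E d))) :=
  s.finite_toSet.isCompact_convexHull ℝ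

theorem isClosed_biUnion {S : Set (Finset (E d))} (hS : S ⊆ M.elements) :
    IsClosed (⋃ s ∈ S, convexHull ℝ (s : Set (E d))) :=
  (M.finite_elements.subset hS).isClosed_biUnion fun s _ => (isCompact_convexHull s).isClosed

theorem convexHull_subset_closure {s : Finset (E d)} (hs : s ∈ M.cplx.faces) :
    convexHull ℝ (s : Set (E d)) ⊆ closure Ω := by
  rw [← M.space_eq]
  exact Geometry.SimplicialComplex.convexHull_subset_space hs

/-- The complex need not be pure. Simplices that are not of full dimension are null sets, so the
part of Ω missed by the closed union of the elements is both open and null, hence empty. -/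
theorem closure_subset_biUnion (hΩ : IsOpen Ω) :
    closure Ω ⊆ ⋃ s ∈ M.elements, convexHull ℝ (s : Set (E d)) := by
  have hcl := M.isClosed_biUnion (S := M.elements) subset_rfl
  refine closure_minimal ?_ hcl
  have hnull : volume (Ω \ ⋃ s ∈ M.elements, convexHull ℝ (s : Set (E d))) = 0 := by
    refine measure_mono_null (t := ⋃ s ∈ M.cplx.faces \ M.elements,
      convexHull ℝ (s : Set (E d))) ?_ ?_
    · rintro x ⟨hx, hxe⟩
      have : x ∈ M.cplx.space := M.space_eq ▸ subset_closure hx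
      obtain ⟨s, hs, hxs⟩ := Geometry.SimplicialComplex.mem_space_iff.1 this
      refine mem_iUnion₂.2 ⟨s, ⟨hs, fun h => hxe (mem_iUnion₂.2 ⟨s, h, hxs⟩)⟩, hxs⟩
    · rw [measure_biUnion_null_iff (M.finite.subset sdiff_subset).countable]
      rintro s ⟨hs, hse⟩
      exact volume_convexHull_eq_zero (M.cplx.indep hs) fun h => hse ⟨hs, h⟩
  have := (hΩ.sdiff hcl).measure_eq_zero_iff (volume : Measure (E d)) |>.1 hnull
  exact sdiff_eq_empty.1 this

theorem exists_element (hΩ : IsOpen Ω) {x : E d} (hx : x ∈ closure Ω) :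
    ∃ s ∈ M.elements, x ∈ convexHull ℝ (s : Set (E d)) := by
  simpa using M.closure_subset_biUnion hΩ hx

/-- `H` bounds the diameters of the elements, each of which contains a ball of radius `σ * H`. -/
structure HasSize (H σ : ℝ) : Prop where
  pos : 0 < H
  pos' : 0 < σ
  dist_le : ∀ s ∈ M.elements, ∀ x ∈ convexHull ℝ (s : Set (E d)),
    ∀ y ∈ convexHull ℝ (s : Set (E d)), dist x y ≤ H
  exists_ball : ∀ s ∈ M.elements, ∃ x, closedBall x (σ * H) ⊆ convexHull ℝ (s : Set (E d))

theorem exists_hasSize (hΩ : IsLipschitzDomain Ω) (hd : 0 < d) {κ τ : ℝ} (hκ : 0 < κ) (hτ : 0 < τ)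
    (h1 : M.IsShapeRegular κ) (h2 : M.IsQuasiUniform τ) :
    ∃ H, M.HasSize H (κ / τ ^ 2) ∧ H ≤ τ * diam (closure Ω) := by
  obtain ⟨x, hx⟩ := hΩ.isConnected.nonempty
  obtain ⟨s₀, hs₀, hxs⟩ := M.exists_element hΩ.isOpen (subset_closure hx)
  have hdiam : ∀ s : Finset (E d), diam (convexHull ℝ (s : Set (E d))) = diam (s : Set (E d)) :=
    fun s => convexHull_diam _
  have hpos : 0 < diam (s₀ : Set (E d)) := by
    have hcard : 1 < s₀.card := by rw [hs₀.2]; omega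
    obtain ⟨a, ha, b, hb, hab⟩ := Finset.one_lt_card.1 hcard
    exact (dist_pos.2 hab).trans_le
      (Metric.dist_le_diam_of_mem s₀.finite_toSet.isBounded ha hb)
  -- With H = τ diam s₀, quasi-uniformity bounds all diameters by H. Conversely H ≤ τ² diam s for
  -- each element s, so a radius κ diam s is at least (κ/τ²)H.
  refine ⟨τ * diam (s₀ : Set (E d)), ⟨by positivity, by positivity, ?_, ?_⟩, ?_⟩
  · intro s hs y hy z hz
    refine le_trans ?_ (h2 s hs s₀ hs₀)
    rw [← hdiam]
    exact Metric.dist_le_diam_of_mem (isCompact_convexHull s).isBounded hy hz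
  · intro s hs
    obtain ⟨p, hp⟩ := h1 s hs
    refine ⟨p, (Metric.closedBall_subset_closedBall ?_).trans hp⟩
    have h3 := h2 s₀ hs₀ s hs
    calc κ / τ ^ 2 * (τ * diam (s₀ : Set (E d))) = κ / τ * diam (s₀ : Set (E d)) := by
          field_simp
      _ ≤ κ / τ * (τ * diam (s : Set (E d))) := by gcongr
      _ = _ := by field_simp
  · gcongr
    rw [← hdiam]
    exact Metric.diam_mono (M.convexHull_subset_closure hs₀.1) hΩ.isBounded.closure

end Mesh

/-! ### Slopes of affine functions that are bounded on a ball. -/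

section AffineBounds

variable {d : ℕ}

/-- Half the difference of the values at p + u and p - u, with ‖u‖ = ρ, is the linear part at u; the
rest is scaling. -/
theorem abs_linear_le {a : E d →ᵃ[ℝ] ℝ} {p : E d} {ρ m : ℝ} (hρ : 0 < ρ)
    (h : ∀ x ∈ closedBall p ρ, |a x| ≤ m) (w : E d) : |a.linear w| ≤ m / ρ * ‖w‖ := by
  rcases eq_or_ne w 0 with rfl | hw
  · simp
  have hw' : 0 < ‖w‖ := norm_pos_iff.2 hw
  set u : E d := (ρ / ‖w‖) • w with hu
  have hun : ‖u‖ = ρ := by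
    rw [hu, norm_smul, Real.norm_of_nonneg (by positivity)]
    field_simp
  have h1 := h (u + p) (by simp [hun])
  have h2 := h (-u + p) (by simp [hun])
  have e1 : a (u + p) = a.linear u + a p := a.map_vadd p u
  have e2 : a (-u + p) = -a.linear u + a p := by
    rw [← map_neg]
    exact a.map_vadd p (-u)
  rw [e1, abs_le] at h1
  rw [e2, abs_le] at h2
  have h3 : |a.linear u| ≤ m := abs_le.2 ⟨by linarith, by linarith⟩
  have e3 : w = (‖w‖ / ρ) • u := by
    rw [hu, smul_smul]
    field_simp
    simp
  conv_lhs => rw [e3, map_smul, smul_eq_mul, abs_mul, abs_of_nonneg (by positivity : 0 ≤ ‖w‖ / ρ)]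
  calc ‖w‖ / ρ * |a.linear u| ≤ ‖w‖ / ρ * m := by gcongr
    _ = _ := by ring

theorem lipschitzWith_affine {a : E d →ᵃ[ℝ] ℝ} {p : E d} {ρ m : ℝ} (hρ : 0 < ρ)
    (h : ∀ x ∈ closedBall p ρ, |a x| ≤ m) : LipschitzWith (m / ρ).toNNReal a := by
  refine LipschitzWith.of_dist_le_mul fun x y => ?_
  have hm : 0 ≤ m := (abs_nonneg _).trans (h p (Metric.mem_closedBall_self hρ.le))
  rw [Real.coe_toNNReal _ (by positivity), Real.dist_eq, dist_eq_norm]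
  have := abs_linear_le hρ h (x - y)
  rwa [← vsub_eq_sub x y, a.linearMap_vsub] at this

end AffineBounds

/-! ### Piecewise affine functions and the coarse space. -/

namespace Mesh

variable {d : ℕ} {Ω : Set (E d)} (M : Mesh Ω) {H σ : ℝ}

/-- `f` is affine on each element. -/
def IsPiecewiseAffine (f : E d → ℝ) : Prop :=
  ∀ s ∈ M.elements, ∃ a : E d →ᵃ[ℝ] ℝ, EqOn f a (convexHull ℝ (s : Set (E d)))

variable {M}

theorem HasSize.lipschitzOnWith (hs : M.HasSize H σ) {f : E d → ℝ} (hf : M.IsPiecewiseAffine f)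
    {s : Finset (E d)} (hse : s ∈ M.elements) {m : ℝ}
    (hm : ∀ x ∈ convexHull ℝ (s : Set (E d)), |f x| ≤ m) :
    LipschitzOnWith (m / (σ * H)).toNNReal f (convexHull ℝ (s : Set (E d))) := by
  obtain ⟨a, ha⟩ := hf s hse
  obtain ⟨p, hp⟩ := hs.exists_ball s hse
  have := lipschitzWith_affine (a := a) (p := p) (ρ := σ * H) (m := m)
    (mul_pos hs.pos' hs.pos) (fun x hx => by rw [← ha (hp hx)]; exact hm x (hp hx))
  intro x hx y hy
  rw [ha hx, ha hy]
  exact this x y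

/-- The bounds on single elements are glued along the finite closed cover by the elements and the
complement of Ω, where f is zero. -/
theorem HasSize.lipschitzWith (hs : M.HasSize H σ) (hΩ : IsOpen Ω) {f : E d → ℝ}
    (hf : M.IsPiecewiseAffine f) (h0 : ∀ x, x ∉ Ω → f x = 0) {m : ℝ} (hm : ∀ x, |f x| ≤ m) :
    LipschitzWith (m / (σ * H)).toNNReal f := by
  have : Finite M.elements := M.finite_elements
  refine lipschitzWith_of_eventually fun p => ?_
  refine eventually_dist_le_of_closed_cover (ι := Option M.elements)
    (A := fun i => i.elim Ωᶜ fun s => convexHull ℝ (s.1 : Set (E d))) ?_ ?_ ?_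
  · rintro (_ | s)
    · exact hΩ.isClosed_compl
    · exact (isCompact_convexHull s.1).isClosed
  · rintro (_ | s)
    · intro x hx y hy
      simp [h0 x hx, h0 y hy]
    · exact hs.lipschitzOnWith hf s.2 fun x _ => hm x
  · refine Filter.Eventually.of_forall fun y => ?_
    by_cases hy : y ∈ Ω
    · obtain ⟨s, hse, hys⟩ := M.exists_element hΩ (subset_closure hy)
      exact mem_iUnion.2 ⟨some ⟨s, hse⟩, hys⟩
    · exact mem_iUnion.2 ⟨none, hy⟩

theorem mem_intNodes {v : E d} : v ∈ M.intNodes ↔ v ∈ M.cplx.vertices ∧ v ∈ Ω := by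
  simp [intNodes]

variable (M) in
theorem isPiecewiseAffine_hat (v : E d) : M.IsPiecewiseAffine (M.hat v) :=
  fun _ hs => M.exists_affine_hat hs v

theorem abs_hat_le_one (v x : E d) : |M.hat v x| ≤ 1 := by
  rw [abs_of_nonneg (M.hat_nonneg v x)]
  exact M.hat_le_one v x

/-- Around a point of Ω the elements alone form a closed cover, so continuity there needs no
information on the values off Ω. This avoids circularity in `HasSize.hat_eq_zero`. -/
theorem HasSize.eventually_hat (hs : M.HasSize H σ) (hΩ : IsLipschitzDomain Ω) {v p : E d}
    (hp : p ∈ Ω) {m : ℝ} (hm : m < M.hat v p) : ∀ᶠ q in nhds p, q ∈ Ω ∧ m < M.hat v q := by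
  have : Finite M.elements := M.finite_elements
  have h1 : ∀ᶠ y in nhds p, dist (M.hat v y) (M.hat v p) ≤
      (1 / (σ * H)).toNNReal * dist y p := by
    refine eventually_dist_le_of_closed_cover (ι := M.elements)
      (A := fun s => convexHull ℝ (s.1 : Set (E d)))
      (fun s => (isCompact_convexHull s.1).isClosed)
      (fun s => hs.lipschitzOnWith (M.isPiecewiseAffine_hat v) s.2 fun x _ => abs_hat_le_one v x) ?_
    filter_upwards [hΩ.isOpen.mem_nhds hp] with y hy
    obtain ⟨s, hse, hys⟩ := M.exists_element hΩ.isOpen (subset_closure hy)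
    exact mem_iUnion.2 ⟨⟨s, hse⟩, hys⟩
  have h2 : Filter.Tendsto (fun y => ((1 / (σ * H)).toNNReal : ℝ) * dist y p) (nhds p) (nhds 0) := by
    have : Continuous fun y => ((1 / (σ * H)).toNNReal : ℝ) * dist y p := by fun_prop
    simpa using this.tendsto p
  filter_upwards [h1, h2.eventually_lt_const (sub_pos.2 hm), hΩ.isOpen.mem_nhds hp] with q h3 h4 h5
  refine ⟨h5, ?_⟩
  rw [Real.dist_eq] at h3
  linarith [(abs_le.1 h3).1]

/-- If the value at x ∉ Ω were positive, then for small δ the point v + δ(x - v) would lie in Ω with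
coordinate at v larger than 1 - δ. The same holds for v + δ(y - v) with y near x; that point lies in
an element t with vertex v, and undoing the contraction shows y ∈ t. So x would be interior to the
closure of Ω, which is Ω. -/
theorem HasSize.hat_eq_zero (hs : M.HasSize H σ) (hΩ : IsLipschitzDomain Ω) {v x : E d}
    (hv : v ∈ M.intNodes) (hx : x ∉ Ω) : M.hat v x = 0 := by
  classical
  by_contra hne
  have hvΩ := (mem_intNodes.1 hv).2
  have hθ : 0 < M.hat v x := (M.hat_nonneg v x).lt_of_ne' hne
  have hxs : x ∈ M.cplx.space := by
    by_contra h
    exact hne (M.hat_of_notMem_space h v)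
  obtain ⟨s, hsf, hxs⟩ := Geometry.SimplicialComplex.mem_space_iff.1 hxs
  have hvs := M.mem_of_hat_ne_zero hsf hxs hne
  obtain ⟨δ, hδ0, hδ1, hδΩ⟩ : ∃ δ : ℝ, 0 < δ ∧ δ < 1 ∧ v + δ • (x - v) ∈ Ω := by
    have hc : Continuous fun δ : ℝ => v + δ • (x - v) := by fun_prop
    have h1 : ∀ᶠ δ in nhds (0 : ℝ), v + δ • (x - v) ∈ Ω := by
      refine hc.continuousAt.eventually (hΩ.isOpen.mem_nhds ?_)
      simpa using hvΩ
    have h2 : ∀ᶠ δ in nhdsWithin (0 : ℝ) (Ioi 0), δ ∈ Ioo (0 : ℝ) 1 :=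
      Ioo_mem_nhdsGT one_pos
    obtain ⟨δ, h3, h4⟩ := ((h1.filter_mono nhdsWithin_le_nhds).and h2).exists
    exact ⟨δ, h4.1, h4.2, h3⟩
  have hw := M.isWeight_hat hsf hxs
  have hxδ : M.hat v (v + δ • (x - v)) = δ * M.hat v x + (1 - δ) := by
    rw [M.hat_eq hsf (w := fun y => δ * M.hat y x + (1 - δ) * if y = v then 1 else 0)]
    · simp
    · refine ⟨fun y => ?_, fun y hy => ?_, ?_, ?_⟩
      · have := M.hat_nonneg y x
        have : 0 < 1 - δ := by linarith
        positivity
      · rw [hw.eq_zero y hy, if_neg (by rintro rfl; exact hy hvs)]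
        simp
      · rw [Finset.sum_add_distrib, ← Finset.mul_sum, hw.sum_eq, ← Finset.mul_sum]
        simp [hvs]
      · simp only [add_smul, Finset.sum_add_distrib, mul_smul, ← Finset.smul_sum, hw.sum_smul_eq,
          ite_smul, one_smul, zero_smul, Finset.sum_ite_eq', hvs, if_true]
        module
  have hev := hs.eventually_hat hΩ hδΩ (v := v) (m := 1 - δ) (by rw [hxδ]; nlinarith)
  have hc : Continuous fun y : E d => v + δ • (y - v) := by fun_prop
  refine hx ?_
  rw [← hΩ.interior_closure, mem_interior_iff_mem_nhds]
  filter_upwards [hc.continuousAt.eventually hev] with y hy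
  obtain ⟨t, ht, hyt⟩ := M.exists_element hΩ.isOpen (subset_closure hy.1)
  have hb := M.isWeight_hat ht.1 hyt
  have hvt : v ∈ t := M.mem_of_hat_ne_zero ht.1 hyt (by
    have : 0 < M.hat v (v + δ • (y - v)) := by linarith [hy.2]
    exact this.ne')
  -- The coordinates of y arise by subtracting 1 - δ at v and dividing by δ. Nonnegativity at v is
  -- exactly the bound by 1 - δ.
  refine M.convexHull_subset_closure ht.1 (IsWeight.mem (w := fun u => δ⁻¹ *
    (M.hat u (v + δ • (y - v)) - (1 - δ) * if u = v then 1 else 0)) ⟨fun u => ?_, fun u hu => ?_,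
    ?_, ?_⟩)
  · refine mul_nonneg (by positivity) ?_
    by_cases huv : u = v
    · rw [if_pos huv, huv]
      linarith [hy.2]
    · rw [if_neg huv, mul_zero, sub_zero]
      exact M.hat_nonneg _ _
  · rw [hb.eq_zero u hu, if_neg (by rintro rfl; exact hu hvt)]
    simp
  · rw [← Finset.mul_sum, Finset.sum_sub_distrib, hb.sum_eq, ← Finset.mul_sum]
    simp only [Finset.sum_ite_eq', hvt, if_true]
    field_simp
    ring
  · simp only [mul_smul, ← Finset.smul_sum, sub_smul, Finset.sum_sub_distrib, hb.sum_smul_eq,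
      ite_smul, one_smul, zero_smul, Finset.sum_ite_eq', hvt, if_true]
    rw [show v + δ • (y - v) - (v - δ • v) = δ • y by module, smul_smul, inv_mul_cancel₀ hδ0.ne',
      one_smul]

theorem HasSize.lipschitzWith_hat (hs : M.HasSize H σ) (hΩ : IsLipschitzDomain Ω) {v : E d}
    (hv : v ∈ M.intNodes) : LipschitzWith (1 / (σ * H)).toNNReal (M.hat v) :=
  hs.lipschitzWith hΩ.isOpen (M.isPiecewiseAffine_hat v) (fun _ hx => hs.hat_eq_zero hΩ hv hx)
    (abs_hat_le_one v)

theorem HasSize.hat_mem_VH (hs : M.HasSize H σ) (hΩ : IsLipschitzDomain Ω) {v : E d}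
    (hv : v ∈ M.intNodes) : M.hat v ∈ M.VH :=
  ⟨(hs.lipschitzWith_hat hΩ hv).continuous, fun _ hx => hs.hat_eq_zero hΩ hv hx,
    M.isPiecewiseAffine_hat v⟩

theorem mem_vertices_of_mem {s : Finset (E d)} (hs : s ∈ M.cplx.faces) {v : E d} (hv : v ∈ s) :
    v ∈ M.cplx.vertices := by
  rw [Geometry.SimplicialComplex.vertices_eq]
  exact mem_biUnion hs hv

theorem eq_sum_of_affine {f : E d → ℝ} (hf : M.IsPiecewiseAffine f) {s : Finset (E d)}
    (hs : s ∈ M.elements) {x : E d} (hx : x ∈ convexHull ℝ (s : Set (E d))) :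
    f x = ∑ v ∈ s, M.hat v x * f v := by
  obtain ⟨a, ha⟩ := hf s hs
  have hw := M.isWeight_hat hs.1 hx
  rw [ha hx]
  conv_lhs => rw [← hw.sum_smul_eq, affineMap_sum_smul a hw.sum_eq]
  exact Finset.sum_congr rfl fun v hv => by rw [ha (subset_convexHull ℝ _ hv)]

theorem HasSize.eq_sum_intNodes (hs : M.HasSize H σ) (hΩ : IsLipschitzDomain Ω) {g : E d → ℝ}
    (hg : g ∈ M.VH) (x : E d) : g x = ∑ v ∈ M.intNodes, g v * M.hat v x := by
  classical
  by_cases hx : x ∈ Ω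
  · obtain ⟨s, hse, hxs⟩ := M.exists_element hΩ.isOpen (subset_closure hx)
    rw [eq_sum_of_affine hg.2.2 hse hxs, ← Finset.sum_subset (s₁ := s ∩ M.intNodes)
      Finset.inter_subset_left, ← Finset.sum_subset (s₁ := s ∩ M.intNodes) (s₂ := M.intNodes)
      Finset.inter_subset_right]
    · exact Finset.sum_congr rfl fun _ _ => mul_comm _ _
    · intro v hv hvs
      have : v ∉ s := fun h => hvs (Finset.mem_inter.2 ⟨h, hv⟩)
      rw [(M.isWeight_hat hse.1 hxs).eq_zero v this, mul_zero]
    · intro v hv hvi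
      rw [hg.2.1 v, mul_zero]
      exact fun h => hvi (Finset.mem_inter.2
        ⟨hv, mem_intNodes.2 ⟨mem_vertices_of_mem hse.1 hv, h⟩⟩)
  · rw [hg.2.1 x hx, Finset.sum_eq_zero]
    intro v hv
    rw [hs.hat_eq_zero hΩ hv hx, mul_zero]

theorem HasSize.finiteDimensional_VH (hs : M.HasSize H σ) (hΩ : IsLipschitzDomain Ω) :
    FiniteDimensional ℝ M.VH := by
  let ev : M.VH →ₗ[ℝ] (M.intNodes → ℝ) :=
    { toFun := fun g v => (g : E d → ℝ) v
      map_add' := fun _ _ => rfl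
      map_smul' := fun _ _ => rfl }
  refine FiniteDimensional.of_injective ev fun g g' h => ?_
  ext x
  rw [hs.eq_sum_intNodes hΩ g.2, hs.eq_sum_intNodes hΩ g'.2]
  refine Finset.sum_congr rfl fun v hv => ?_
  have : (g : E d → ℝ) v = (g' : E d → ℝ) v := congrFun h ⟨v, hv⟩
  rw [this]

theorem HasSize.abs_le_sum (hs : M.HasSize H σ) (hΩ : IsLipschitzDomain Ω) {g : E d → ℝ}
    (hg : g ∈ M.VH) (x : E d) : |g x| ≤ ∑ v ∈ M.intNodes, |g v| := by
  rw [hs.eq_sum_intNodes hΩ hg x]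
  refine (Finset.abs_sum_le_sum_abs _ _).trans (Finset.sum_le_sum fun v _ => ?_)
  rw [abs_mul]
  exact mul_le_of_le_one_right (abs_nonneg _) (abs_hat_le_one v x)

theorem HasSize.exists_lipschitzWith (hs : M.HasSize H σ) (hΩ : IsLipschitzDomain Ω)
    {g : E d → ℝ} (hg : g ∈ M.VH) : ∃ K, LipschitzWith K g :=
  ⟨_, hs.lipschitzWith hΩ.isOpen hg.2.2 hg.2.1 (hs.abs_le_sum hΩ hg)⟩

end Mesh

/-! ### Growth of the patches. -/

namespace Mesh

variable {d : ℕ} {Ω : Set (E d)} {M : Mesh Ω} {H σ : ℝ}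

/-- Distinct elements meet in the hull of their common vertices, which is null, and an open null set
is empty. -/
theorem disjoint_interior {s t : Finset (E d)} (hs : s ∈ M.elements) (ht : t ∈ M.elements)
    (hst : s ≠ t) : Disjoint (interior (convexHull ℝ (s : Set (E d))))
      (interior (convexHull ℝ (t : Set (E d)))) := by
  classical
  rw [disjoint_iff_inter_eq_empty]
  refine ((isOpen_interior.inter isOpen_interior).measure_eq_zero_iff
    (volume : Measure (E d))).1 ?_
  refine measure_mono_null (t := convexHull ℝ ((s ∩ t : Finset (E d)) : Set (E d))) ?_ ?_
  · rw [Finset.coe_inter, ← M.cplx.convexHull_inter_convexHull hs.1 ht.1]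
    exact inter_subset_inter interior_subset interior_subset
  · refine volume_convexHull_eq_zero ?_ ?_
    · exact (M.cplx.indep hs.1).mono (t := (s : Set (E d)))
        (s := ((s ∩ t : Finset (E d)) : Set (E d))) (by simp)
    · have h1 : s ∩ t ⊂ s := by
        refine Finset.inter_subset_left.ssubset_of_ne fun h => hst ?_
        refine Finset.eq_of_subset_of_card_le (Finset.inter_eq_left.1 h) ?_
        rw [hs.2, ht.2]
      have := Finset.card_lt_card h1
      rw [hs.2] at this
      exact this.ne

/-- The number of elements that meet a ball is bounded. -/
theorem HasSize.card_le (hs : M.HasSize H σ) {x : E d} {r : ℝ} (hr : 0 ≤ r)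
    {F : Finset (Finset (E d))} (hF : ∀ s ∈ F, s ∈ M.elements)
    (hx : ∀ s ∈ F, (convexHull ℝ (s : Set (E d)) ∩ closedBall x (r * H)).Nonempty) :
    (F.card : ℝ) ≤ ((r + 1) / σ) ^ d := by
  set V := volume (closedBall (0 : E d) 1) with hV
  have hVt : V ≠ ⊤ := measure_closedBall_lt_top.ne
  have hV0 : V ≠ 0 := (Metric.measure_closedBall_pos _ _ one_pos).ne'
  have hH := hs.pos
  have hσ := hs.pos'
  have hint : ∀ s ∈ F, ∃ p, closedBall p (σ * H / 2) ⊆ interior (convexHull ℝ (s : Set (E d))) ∧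
      ball p (σ * H) ⊆ interior (convexHull ℝ (s : Set (E d))) := by
    intro s hsF
    obtain ⟨p, hp⟩ := hs.exists_ball s (hF s hsF)
    have : ball p (σ * H) ⊆ interior (convexHull ℝ (s : Set (E d))) :=
      Metric.isOpen_ball.subset_interior_iff.2 (Metric.ball_subset_closedBall.trans hp)
    exact ⟨p, (Metric.closedBall_subset_ball (by linarith [mul_pos hσ hH])).trans this, this⟩
  choose! p hp hp' using hint
  -- Volume comparison: the inscribed balls of radius σH are disjoint and lie in the ball of radius
  -- (r + 1)H about x.
  have hdisj : (F : Set (Finset (E d))).PairwiseDisjoint fun s => ball (p s) (σ * H) := by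
    intro s hsF t htF hst
    exact (disjoint_interior (hF s hsF) (hF t htF) hst).mono (hp' s hsF) (hp' t htF)
  have hsub : (⋃ s ∈ F, ball (p s) (σ * H)) ⊆ closedBall x ((r + 1) * H) := by
    refine iUnion₂_subset fun s hsF y hy => ?_
    obtain ⟨z, hz1, hz2⟩ := hx s hsF
    have h1 := hs.dist_le s (hF s hsF) y (interior_subset (hp' s hsF hy)) z hz1
    rw [Metric.mem_closedBall] at hz2 ⊢
    linarith [dist_triangle y z x]
  have h1 := measure_mono (μ := volume) hsub
  rw [measure_biUnion_finset hdisj fun s _ => Metric.isOpen_ball.measurableSet,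
    volume_closedBall_eq _ (by positivity)] at h1
  have h2 : ∀ s ∈ F, volume (ball (p s) (σ * H)) = ENNReal.ofReal ((σ * H) ^ d) * V := by
    intro s _
    rw [Measure.addHaar_ball_of_pos _ _ (by positivity), hV,
      Measure.addHaar_unitClosedBall_eq_addHaar_unitBall]
    simp
  rw [Finset.sum_congr rfl h2, Finset.sum_const, nsmul_eq_mul, ← mul_assoc, ← hV,
    ENNReal.mul_le_mul_iff_left hV0 hVt, ← ENNReal.ofReal_natCast, ← ENNReal.ofReal_mul (by simp),
    ENNReal.ofReal_le_ofReal_iff (by positivity), mul_pow, mul_pow, ← mul_assoc] at h1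
  rw [div_pow, le_div_iff₀ (by positivity)]
  exact le_of_mul_le_mul_right h1 (by positivity)

theorem HasSize.interior_nonempty (hs : M.HasSize H σ) {s : Finset (E d)} (hse : s ∈ M.elements) :
    (interior (convexHull ℝ (s : Set (E d)))).Nonempty := by
  obtain ⟨p, hp⟩ := hs.exists_ball s hse
  refine ⟨p, ?_⟩
  exact (interior_mono hp) (Metric.ball_subset_interior_closedBall
    (Metric.mem_ball_self (mul_pos hs.pos' hs.pos)))

theorem HasSize.closure_interior (hs : M.HasSize H σ) {s : Finset (E d)} (hse : s ∈ M.elements) :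
    closure (interior (convexHull ℝ (s : Set (E d)))) = convexHull ℝ (s : Set (E d)) := by
  rw [(convex_convexHull ℝ _).closure_interior_eq_closure_of_nonempty_interior
    (hs.interior_nonempty hse), (isCompact_convexHull s).isClosed.closure_eq]

theorem interior_subset_domain (hΩ : IsLipschitzDomain Ω) {s : Finset (E d)}
    (hse : s ∈ M.elements) : interior (convexHull ℝ (s : Set (E d))) ⊆ Ω := by
  rw [← hΩ.interior_closure]
  exact interior_mono (M.convexHull_subset_closure hse.1)

theorem patch_subset_domain (v : E d) (k : ℕ) : M.patch v k ⊆ Ω := by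
  cases k <;> exact inter_subset_right

/-- The elements that meet the closure of the patch. -/
def layer (M : Mesh Ω) (v : E d) (k : ℕ) : Set (Finset (E d)) :=
  {s | s ∈ M.elements ∧ (convexHull ℝ (s : Set (E d)) ∩ closure (M.patch v k)).Nonempty}

theorem layer_subset (v : E d) (k : ℕ) : M.layer v k ⊆ M.elements := fun _ h => h.1

theorem HasSize.patch_subset_closedBall (hs : M.HasSize H σ) (v : E d) (k : ℕ) :
    M.patch v k ⊆ closedBall v ((k + 1) * H) := by
  induction k with
  | zero =>
    rintro x ⟨hx, -⟩
    obtain ⟨s, ⟨hse, hvs⟩, hxs⟩ := mem_iUnion₂.1 hx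
    simpa using hs.dist_le s hse x hxs v (subset_convexHull ℝ _ hvs)
  | succ k ih =>
    rintro x ⟨hx, -⟩
    obtain ⟨s, ⟨hse, z, hzs, hz⟩, hxs⟩ := mem_iUnion₂.1 (interior_subset hx)
    have h1 := hs.dist_le s hse x hxs z hzs
    have h2 := closure_minimal ih Metric.isClosed_closedBall hz
    rw [Metric.mem_closedBall] at h2 ⊢
    push_cast
    linarith [dist_triangle x z v]

theorem HasSize.subset_closure_patch_succ (hs : M.HasSize H σ) (hΩ : IsLipschitzDomain Ω)
    {v : E d} {k : ℕ} {s : Finset (E d)} (h : s ∈ M.layer v k) :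
    convexHull ℝ (s : Set (E d)) ⊆ closure (M.patch v (k + 1)) := by
  rw [← hs.closure_interior h.1]
  refine closure_mono (subset_inter ?_ (interior_subset_domain hΩ h.1))
  exact interior_mono (subset_biUnion_of_mem (u := fun s : Finset (E d) =>
    convexHull ℝ (s : Set (E d))) h)

theorem HasSize.layer_subset_succ (hs : M.HasSize H σ) (hΩ : IsLipschitzDomain Ω) (v : E d)
    (k : ℕ) : M.layer v k ⊆ M.layer v (k + 1) := by
  intro s h
  obtain ⟨z, hz⟩ := hs.interior_nonempty h.1
  exact ⟨h.1, z, interior_subset hz, hs.subset_closure_patch_succ hΩ h (interior_subset hz)⟩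

theorem isClosed_layer (v : E d) (k : ℕ) :
    IsClosed (⋃ s ∈ M.layer v k, convexHull ℝ (s : Set (E d))) :=
  M.isClosed_biUnion (layer_subset v k)

/-- The elements outside the layer form a closed set. If x avoids it, so does a neighbourhood of x,
which is then covered by the layer. -/
theorem mem_patch_succ_or (hΩ : IsOpen Ω) {v x : E d} {k : ℕ} (hx : x ∈ Ω) :
    x ∈ M.patch v (k + 1) ∨ ∃ t ∈ M.elements, t ∉ M.layer v k ∧
      x ∈ convexHull ℝ (t : Set (E d)) := by
  by_contra! hcon
  refine hcon.1 ⟨?_, hx⟩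
  have hcl := M.isClosed_biUnion (S := M.elements \ M.layer v k) sdiff_subset
  have hx' : x ∉ ⋃ s ∈ M.elements \ M.layer v k, convexHull ℝ (s : Set (E d)) := by
    simp only [mem_iUnion, not_exists]
    exact fun t ht => hcon.2 t ht.1 ht.2
  rw [mem_interior_iff_mem_nhds]
  filter_upwards [hcl.isOpen_compl.mem_nhds hx', hΩ.mem_nhds hx] with y hy1 hy2
  obtain ⟨s, hse, hys⟩ := M.exists_element hΩ (subset_closure hy2)
  refine mem_iUnion₂.2 ⟨s, ?_, hys⟩
  by_contra h
  exact hy1 (mem_iUnion₂.2 ⟨s, ⟨hse, h⟩, hys⟩)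

theorem closure_patch_subset_succ (hΩ : IsOpen Ω) {v : E d} {k : ℕ} :
    closure (M.patch v k) ∩ Ω ⊆ M.patch v (k + 1) := by
  rintro x ⟨hx, hxΩ⟩
  rcases mem_patch_succ_or hΩ (v := v) (k := k) hxΩ with h | ⟨t, ht, htl, hxt⟩
  · exact h
  · exact absurd ⟨ht, x, hxt, hx⟩ htl

theorem patch_mono (hΩ : IsOpen Ω) (v : E d) : Monotone (M.patch v) :=
  monotone_nat_of_le_succ fun k _ hx =>
    closure_patch_subset_succ hΩ ⟨subset_closure hx, patch_subset_domain v k hx⟩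

/-- If the connected set S is not absorbed, it has a point y in the union of the layer but not in
the next patch. An element outside the layer contains y and joins the next layer, since y is in the
closure of the next patch. Each failure is thus paid for by a new element that meets S. -/
theorem HasSize.subset_patch_or (hs : M.HasSize H σ) (hΩ : IsLipschitzDomain Ω) {v : E d} {k : ℕ}
    {S : Set (E d)} (hS : IsPreconnected S) (hSΩ : S ⊆ Ω)
    (hne : (S ∩ closure (M.patch v k)).Nonempty) :
    S ⊆ M.patch v (k + 1) ∨ ((S ∩ closure (M.patch v (k + 1))).Nonempty ∧
      ∃ t ∈ M.layer v (k + 1) \ M.layer v k, (convexHull ℝ (t : Set (E d)) ∩ S).Nonempty) := by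
  by_contra! hcon
  obtain ⟨x, hxS, hx⟩ := hne
  have hxp := closure_patch_subset_succ hΩ.isOpen ⟨hx, hSΩ hxS⟩
  refine hcon.1 ?_
  set B := ⋃ s ∈ M.layer v k, convexHull ℝ (s : Set (E d)) with hB
  have hBcl : IsClosed B := isClosed_layer v k
  have hsub : S ⊆ interior B := by
    refine hS.subset_of_closure_inter_subset isOpen_interior ⟨x, hxS, hxp.1⟩ ?_
    rintro y ⟨hy1, hy2⟩
    have hyB : y ∈ B := closure_minimal interior_subset hBcl hy1
    rcases mem_patch_succ_or hΩ.isOpen (v := v) (k := k) (hSΩ hy2) with h | ⟨t, ht, htl, hyt⟩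
    · exact h.1
    · obtain ⟨s, hsl, hys⟩ := mem_iUnion₂.1 hyB
      have hyc := hs.subset_closure_patch_succ hΩ hsl hys
      have := hcon.2 ⟨y, hy2, hyc⟩ t ⟨⟨ht, y, hyt, hyc⟩, htl⟩
      exact absurd (this ▸ (⟨hyt, hy2⟩ : y ∈ convexHull ℝ (t : Set (E d)) ∩ S))
        (notMem_empty y)
  exact subset_inter hsub hSΩ

/-- Every step that fails to absorb S adds to the layer an element meeting S, and at most (2/σ)^d
elements meet a ball of radius H. -/
theorem HasSize.subset_patch_add (hs : M.HasSize H σ) (hΩ : IsLipschitzDomain Ω) {v : E d} {k : ℕ}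
    {S : Set (E d)} (hS : IsPreconnected S) (hSΩ : S ⊆ Ω) {x : E d} (hSx : S ⊆ closedBall x H)
    (hne : (S ∩ closure (M.patch v k)).Nonempty) :
    S ⊆ M.patch v (k + (⌈(2 / σ) ^ d⌉₊ + 1)) := by
  classical
  set N := ⌈(2 / σ) ^ d⌉₊ with hN
  set F : ℕ → Finset (Finset (E d)) := fun j => M.finite_elements.toFinset.filter fun s =>
    s ∈ M.layer v j ∧ (convexHull ℝ (s : Set (E d)) ∩ S).Nonempty with hF
  have hcard : ∀ j, (F j).card ≤ N := by
    intro j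
    have := hs.card_le (x := x) (r := 1) zero_le_one (F := F j)
      (fun s h => (Finset.mem_filter.1 h).2.1.1) (fun s h => by
        rw [one_mul]
        exact (Finset.mem_filter.1 h).2.2.mono (inter_subset_inter_right _ hSx))
    norm_num at this
    exact_mod_cast this.trans (Nat.le_ceil _)
  have key : ∀ j, S ⊆ M.patch v (k + j) ∨
      ((S ∩ closure (M.patch v (k + j))).Nonempty ∧ j ≤ (F (k + j)).card) := by
    intro j
    induction j with
    | zero => exact Or.inr ⟨hne, Nat.zero_le _⟩
    | succ j ih =>
      rcases ih with h | ⟨h1, h2⟩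
      · exact Or.inl (h.trans (patch_mono hΩ.isOpen v (by omega)))
      · rcases hs.subset_patch_or hΩ hS hSΩ h1 with h | ⟨h3, t, ht, hts⟩
        · exact Or.inl h
        · refine Or.inr ⟨h3, Nat.succ_le_of_lt (h2.trans_lt (Finset.card_lt_card ?_))⟩
          refine Finset.ssubset_iff_subset_ne.2 ⟨fun s h => ?_, fun h => ?_⟩
          · rw [Finset.mem_filter] at h ⊢
            exact ⟨h.1, hs.layer_subset_succ hΩ v _ h.2.1, h.2.2⟩
          · have h4 : t ∈ F (k + (j + 1)) := Finset.mem_filter.2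
              ⟨M.finite_elements.mem_toFinset.2 ht.1.1, ht.1, hts⟩
            rw [← h] at h4
            exact ht.2 (Finset.mem_filter.1 h4).2.1
  rcases key (N + 1) with h | ⟨-, h⟩
  · exact h
  · exact absurd (h.trans (hcard _)) (by omega)

theorem mem_patch_zero (hΩ : IsLipschitzDomain Ω) {v : E d} (hv : v ∈ M.intNodes) :
    v ∈ M.patch v 0 := by
  obtain ⟨hv1, hv2⟩ := mem_intNodes.1 hv
  obtain ⟨s, hse, hvs⟩ := M.exists_element hΩ.isOpen (subset_closure hv2)
  refine ⟨mem_iUnion₂.2 ⟨s, ⟨hse, ?_⟩, hvs⟩, hv2⟩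
  exact (Geometry.SimplicialComplex.vertex_mem_convexHull_iff hv1 hse.1).1 hvs

/-- The patches exhaust the domain at a linear rate. -/
theorem exists_ball_subset_patch (hΩ : IsLipschitzDomain Ω) {σ : ℝ} (hσ : 0 < σ) :
    ∃ K : ℝ, 0 < K ∧ ∀ (M : Mesh Ω) (H : ℝ), M.HasSize H σ → ∀ v ∈ M.intNodes, ∀ x ∈ Ω, ∀ k : ℕ,
      K * (dist v x / H) + K ≤ k → x ∈ M.patch v k := by
  obtain ⟨K, hK, hreach⟩ := hΩ.exists_reach
  set N := ⌈(2 / σ) ^ d⌉₊ + 1 with hN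
  have hN0 : (0 : ℝ) < N := by positivity
  refine ⟨K * N, by positivity, fun M H hs v hv x hx k hk => ?_⟩
  have hvΩ := (mem_intNodes.1 hv).2
  obtain ⟨n, hn, hr⟩ := hreach v hvΩ x hx H hs.pos
  -- Each link is a segment of length at most H and costs at most N layers.
  have hind : ∀ (n : ℕ) (y x : E d), Reach Ω H n y x → y ∈ M.patch v 0 →
      x ∈ M.patch v (n * N) := by
    intro n y x hr hy
    induction hr with
    | refl => simpa using hy
    | @step n _ y z h1 h2 h3 ih =>
      have := hs.subset_patch_add hΩ (convex_segment y z).isPreconnected h2 (x := y) (k := n * N)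
        (v := v) ((convex_closedBall y H).segment_subset (Metric.mem_closedBall_self hs.pos.le)
          (by rwa [Metric.mem_closedBall, dist_comm]))
        ⟨y, left_mem_segment ℝ y z, subset_closure (ih hy)⟩
      rw [add_mul, one_mul]
      exact this (right_mem_segment ℝ y z)
  refine patch_mono hΩ.isOpen v ?_ (hind n v x hr (mem_patch_zero hΩ hv))
  have : ((n * N : ℕ) : ℝ) ≤ k := by
    push_cast
    calc (n : ℝ) * N ≤ (K * (dist v x / H) + K) * N := by gcongr
      _ = K * N * (dist v x / H) + K * N := by ring
      _ ≤ k := hk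
  exact_mod_cast this

end Mesh

/-! ### Weighted Sobolev spaces -/

open Filter Topology

section WeightedSobolev

variable {d : ℕ} {Ω Λ : Set (E d)} {β : ℝ}

/-- The properties of the weight on the domain that the theory of the weighted Sobolev spaces
uses: the weight and its inverse are integrable. -/
structure AdmissibleWeight (Ω Λ : Set (E d)) (β : ℝ) : Prop where
  isOpen : IsOpen Ω
  isBounded : Bornology.IsBounded Ω
  ae_mul_eq_one : ∀ᵐ x, weight Λ β x * weight Λ (-β) x = 1
  lintegral_ne_top : ∫⁻ x in Ω, weight Λ β x ≠ ⊤
  lintegral_neg_ne_top : ∫⁻ x in Ω, weight Λ (-β) x ≠ ⊤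

/-- In [0, ∞] a finite product bounds its first factor only if the second is not 0, which f g = 1
guarantees. -/
theorem ne_top_of_mul_ae_pos {μ : Measure (E d)} {f g : E d → ℝ≥0∞} (hμ : μ ≠ 0)
    (hg : AEMeasurable g μ) (hpos : ∀ᵐ x ∂μ, f x * g x = 1)
    (h : (∫⁻ x, f x ∂μ) * (∫⁻ x, g x ∂μ) ≠ ⊤) : ∫⁻ x, f x ∂μ ≠ ⊤ := by
  intro h1
  have h2 : ∫⁻ x, g x ∂μ ≠ 0 := by
    rw [Ne, lintegral_eq_zero_iff' hg]
    intro h3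
    have : ∀ᵐ x ∂μ, False := by
      filter_upwards [hpos, h3] with x h4 h5
      simp [h5] at h4
    rw [eventually_false_iff_eq_bot, ae_eq_bot] at this
    exact hμ this
  rw [h1, ENNReal.top_mul h2] at h
  exact h rfl

theorem IsLipschitzDomain.admissibleWeight {ℓ : ℕ} {c : ℝ} (hΩ : IsLipschitzDomain Ω) (hc : 0 < c)
    (hℓ : ℓ < d) (hβ : β ∈ Ioo (-(((d : ℝ) - ℓ) / 2)) (((d : ℝ) - ℓ) / 2))
    (hΛ : IsRegularSet ℓ c Λ) : AdmissibleWeight Ω Λ β := by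
  have hae : ∀ᵐ x, weight Λ β x * weight Λ (-β) x = 1 :=
    (ae_notMem hc hℓ hΛ).mono fun x hx => hΛ.weight_mul_weight_neg β hx
  obtain ⟨C, hC⟩ := exists_lintegral_weight_mul_le (d := d) hc hℓ hβ
  obtain ⟨r, hr, hsub⟩ := hΩ.isBounded.subset_closedBall_lt 0 0
  have hne : volume.restrict (closedBall (0 : E d) r) ≠ 0 := by
    rw [Ne, Measure.restrict_eq_zero]
    exact (Metric.measure_closedBall_pos volume _ hr).ne'
  have hfin : (∫⁻ y in closedBall 0 r, weight Λ β y) * (∫⁻ y in closedBall 0 r, weight Λ (-β) y)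
      ≠ ⊤ := ne_top_of_le_ne_top
    (ENNReal.mul_ne_top ENNReal.coe_ne_top (ENNReal.pow_ne_top ENNReal.ofReal_ne_top))
    (hC Λ hΛ 0 r hr)
  refine ⟨hΩ.isOpen, hΩ.isBounded, hae, ?_, ?_⟩
  · exact ne_top_of_le_ne_top (ne_top_of_mul_ae_pos hne (measurable_weight _ _).aemeasurable
      (ae_restrict_of_ae hae) hfin) (lintegral_mono_set hsub)
  · refine ne_top_of_le_ne_top (ne_top_of_mul_ae_pos hne (measurable_weight Λ β).aemeasurable
      (ae_restrict_of_ae (hae.mono fun x hx => by rwa [mul_comm])) ?_) (lintegral_mono_set hsub)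
    rwa [mul_comm]

theorem lintegral_wMeasure (f : E d → ℝ≥0∞) :
    ∫⁻ x, f x ∂(wMeasure Ω Λ β) = ∫⁻ x in Ω, weight Λ β x * f x :=
  lintegral_withDensity_eq_lintegral_mul_non_measurable _ (measurable_weight Λ β)
    (Eventually.of_forall fun x => (weight_ne_top Λ β x).lt_top) f

theorem wMeasure_restrict {S : Set (E d)} (hS : MeasurableSet S) :
    (wMeasure Ω Λ β).restrict S = wMeasure (S ∩ Ω) Λ β := by
  rw [wMeasure, wMeasure, restrict_withDensity hS, Measure.restrict_restrict hS]

theorem setLIntegral_wMeasure {S : Set (E d)} (hS : MeasurableSet S) (f : E d → ℝ≥0∞) :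
    ∫⁻ x in S, f x ∂(wMeasure Ω Λ β) = ∫⁻ x in S ∩ Ω, weight Λ β x * f x := by
  rw [wMeasure_restrict hS, lintegral_wMeasure]

theorem wMeasure_absolutelyContinuous : wMeasure Ω Λ β ≪ volume.restrict Ω :=
  withDensity_absolutelyContinuous _ _

theorem AdmissibleWeight.absolutelyContinuous (h : AdmissibleWeight Ω Λ β) :
    volume.restrict Ω ≪ wMeasure Ω Λ β := by
  refine withDensity_absolutelyContinuous' (measurable_weight Λ β).aemeasurable
    (ae_restrict_of_ae (h.ae_mul_eq_one.mono fun x hx h0 => ?_))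
  change weight Λ β x = 0 at h0
  simp [h0] at hx

theorem AdmissibleWeight.isFiniteMeasure (h : AdmissibleWeight Ω Λ β) :
    IsFiniteMeasure (wMeasure Ω Λ β) :=
  isFiniteMeasure_withDensity h.lintegral_ne_top

theorem enorm_sq_eq_lintegral {α F : Type*} [MeasurableSpace α] [NormedAddCommGroup F]
    {μ : Measure α} (f : Lp F 2 μ) : ‖f‖ₑ ^ 2 = ∫⁻ x, ‖f x‖ₑ ^ 2 ∂μ := by
  have := eLpNorm_nnreal_pow_eq_lintegral (f := (f : α → F)) (μ := μ) (p := 2) (by norm_num)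
  rw [Lp.enorm_def]
  simpa using this

/-- Cauchy-Schwarz against the integrable dual weight embeds L²_β(Ω) in L¹(Ω). Limits in the
weighted norm may therefore be taken in the unweighted identity that defines weak gradients. -/
theorem AdmissibleWeight.exists_lintegral_enorm_le (h : AdmissibleWeight Ω Λ β) :
    ∃ K : ℝ≥0, ∀ {F : Type} [NormedAddCommGroup F] (f : Lp F 2 (wMeasure Ω Λ β)),
      ∫⁻ x in Ω, ‖f x‖ₑ ≤ K * ‖f‖ₑ := by
  refine ⟨((∫⁻ x in Ω, weight Λ (-β) x) ^ (1 / 2 : ℝ)).toNNReal, fun f => ?_⟩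
  have hm : AEMeasurable (fun x => ‖f x‖ₑ) (volume.restrict Ω) :=
    ((Lp.aestronglyMeasurable f).mono_ac h.absolutelyContinuous).enorm
  have h1 := sq_lintegral_le_mul (volume.restrict Ω) hm (measurable_weight Λ β).aemeasurable
    (measurable_weight Λ (-β)).aemeasurable (ae_restrict_of_ae h.ae_mul_eq_one)
  rw [← lintegral_wMeasure, ← enorm_sq_eq_lintegral] at h1
  rw [ENNReal.coe_toNNReal (ENNReal.rpow_ne_top_of_nonneg (by norm_num) h.lintegral_neg_ne_top)]
  rw [← ENNReal.pow_le_pow_left_iff (n := 2) (by norm_num), mul_pow, ← ENNReal.rpow_natCast,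
    ← ENNReal.rpow_natCast, ← ENNReal.rpow_mul, ← ENNReal.rpow_natCast]
  simpa [mul_comm] using h1

theorem AdmissibleWeight.integrableOn (h : AdmissibleWeight Ω Λ β) {F : Type}
    [NormedAddCommGroup F] (f : Lp F 2 (wMeasure Ω Λ β)) : IntegrableOn f Ω := by
  obtain ⟨K, hK⟩ := h.exists_lintegral_enorm_le
  refine ⟨(Lp.aestronglyMeasurable f).mono_ac h.absolutelyContinuous, ?_⟩
  exact (hK f).trans_lt (ENNReal.mul_lt_top ENNReal.coe_lt_top (by simp [enorm]))

theorem AdmissibleWeight.tendsto_lintegral (h : AdmissibleWeight Ω Λ β) {F : Type}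
    [NormedAddCommGroup F] {f : ℕ → Lp F 2 (wMeasure Ω Λ β)} {g : Lp F 2 (wMeasure Ω Λ β)}
    (hf : Tendsto f atTop (𝓝 g)) :
    Tendsto (fun n => ∫⁻ x in Ω, ‖f n x - g x‖ₑ) atTop (𝓝 0) := by
  obtain ⟨K, hK⟩ := h.exists_lintegral_enorm_le
  have h1 : Tendsto (fun n => (K : ℝ≥0∞) * ‖f n - g‖ₑ) atTop (𝓝 0) := by
    have h2 : Tendsto (fun n => ‖f n - g‖ₑ) atTop (𝓝 0) := by
      have := (continuous_enorm.tendsto (0 : Lp F 2 (wMeasure Ω Λ β))).comp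
        (tendsto_sub_nhds_zero_iff.2 hf)
      simpa [Function.comp_def] using this
    simpa using ENNReal.Tendsto.const_mul h2 (Or.inr ENNReal.coe_ne_top)
  refine tendsto_of_tendsto_of_tendsto_of_le_of_le tendsto_const_nhds h1 (fun _ => bot_le)
    fun n => ?_
  refine le_trans (le_of_eq (lintegral_congr_ae ?_)) (hK (f n - g))
  filter_upwards [h.absolutelyContinuous.ae_le (Lp.coeFn_sub (f n) g)] with x hx
  rw [hx]; rfl

theorem integral_smul_gradient {φ ψ : E d → ℝ} (hφ : ContDiff ℝ ∞ φ) (hc : HasCompactSupport φ)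
    (hψ : ContDiff ℝ ∞ ψ) :
    ∫ x, φ x • gradient ψ x = - ∫ x, ψ x • gradient φ x := by
  have i1 : Integrable fun x => φ x • gradient ψ x :=
    (hφ.continuous.smul (continuous_gradient hψ)).integrable_of_hasCompactSupport hc.smul_right
  have hcg : HasCompactSupport (gradient φ) :=
    hc.of_isClosed_subset (isClosed_tsupport _) (tsupport_gradient_subset φ)
  have i2 : Integrable fun x => ψ x • gradient φ x :=
    (hψ.continuous.smul (continuous_gradient hφ)).integrable_of_hasCompactSupport hcg.smul_left
  have key : ∀ (χ : E d → ℝ) x v, inner ℝ v (gradient χ x) = fderiv ℝ χ x v := fun χ x v => by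
    rw [real_inner_comm, gradient, InnerProductSpace.toDual_symm_apply]
  refine ext_inner_left ℝ fun v => ?_
  rw [inner_neg_right, ← integral_inner i1, ← integral_inner i2]
  simp only [inner_smul_right, key]
  have j1 : Integrable fun x => φ x * fderiv ℝ ψ x v := by
    simpa only [inner_smul_right, key] using i1.const_inner (𝕜 := ℝ) v
  have j2 : Integrable fun x => ψ x * fderiv ℝ φ x v := by
    simpa only [inner_smul_right, key] using i2.const_inner (𝕜 := ℝ) v
  have := integral_mul_fderiv_eq_neg_fderiv_mul_of_integrable (𝕜 := ℝ) (μ := (volume : Measure (E d)))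
    (f := φ) (g := ψ) (v := v) (by simpa only [mul_comm] using j2) j1
    ((hφ.continuous.mul hψ.continuous).integrable_of_hasCompactSupport hc.mul_right)
    (fun x _ => hφ.differentiable (by simp) x) (fun x _ => hψ.differentiable (by simp) x)
  rw [this]
  simp only [mul_comm]

theorem hasWeakGradient_of_contDiff {φ : E d → ℝ} (hφ : ContDiff ℝ ∞ φ)
    (hc : HasCompactSupport φ) (hs : tsupport φ ⊆ Ω) : HasWeakGradient Ω φ (gradient φ) := by
  refine ⟨hφ.continuous.locallyIntegrable.locallyIntegrableOn _,
    (continuous_gradient hφ).locallyIntegrable.locallyIntegrableOn _, fun ψ h1 h2 h3 => ?_⟩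
  rw [setIntegral_eq_integral_of_forall_compl_eq_zero, setIntegral_eq_integral_of_forall_compl_eq_zero,
    integral_smul_gradient hφ hc h1]
  · intro x hx
    simp [image_eq_zero_of_notMem_tsupport fun h => hx (h3 h)]
  · intro x hx
    simp [image_eq_zero_of_notMem_tsupport fun h => hx (hs h)]

/-- Weighted convergence implies L¹ convergence, and both sides of the integration by parts formula
are continuous for it because ψ and ∇ψ are bounded. -/
theorem AdmissibleWeight.closure_testPairs_subset (h : AdmissibleWeight Ω Λ β) :
    closure (testPairs Ω Λ β) ⊆ (H1 Ω Λ β : Set (L2 Ω Λ β × L2Vec Ω Λ β)) := by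
  intro p hp
  obtain ⟨q, hq, hlim⟩ := mem_closure_iff_seq_limit.1 hp
  refine ⟨p.1, p.2, EventuallyEq.rfl, EventuallyEq.rfl,
    IntegrableOn.locallyIntegrableOn (h.integrableOn p.1),
    IntegrableOn.locallyIntegrableOn (h.integrableOn p.2), fun ψ h1 h2 h3 => ?_⟩
  have hg := continuous_gradient h1
  have hgs := tsupport_gradient_subset ψ
  have hgc : HasCompactSupport (gradient ψ) := h2.of_isClosed_subset (isClosed_tsupport _) hgs
  obtain ⟨B₁, hB₁⟩ := hgc.exists_bound_of_continuous hg
  obtain ⟨B₂, hB₂⟩ := h2.exists_bound_of_continuous h1.continuous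
  have l1 := h.tendsto_lintegral ((continuous_fst.tendsto p).comp hlim)
  have l2 := h.tendsto_lintegral ((continuous_snd.tendsto p).comp hlim)
  have t1 : Tendsto (fun n => ∫ x in Ω, (q n).1 x • gradient ψ x) atTop
      (𝓝 (∫ x in Ω, p.1 x • gradient ψ x)) := by
    refine tendsto_integral_of_L1 _ (integrableOn_smul_of_test' hg hgc (hgs.trans h3)
      (h.integrableOn p.1).locallyIntegrableOn).aestronglyMeasurable (Eventually.of_forall fun n =>
      integrableOn_smul_of_test' hg hgc (hgs.trans h3) (h.integrableOn (q n).1).locallyIntegrableOn) ?_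
    have := ENNReal.Tendsto.const_mul (a := ENNReal.ofReal B₁) l1 (Or.inr ENNReal.ofReal_ne_top)
    rw [mul_zero] at this
    refine tendsto_of_tendsto_of_tendsto_of_le_of_le tendsto_const_nhds this (fun _ => bot_le)
      fun n => ?_
    simp only [Function.comp_apply]
    rw [← lintegral_const_mul' _ _ ENNReal.ofReal_ne_top]
    refine lintegral_mono fun x => ?_
    simp only
    rw [← sub_smul, enorm_smul, mul_comm]
    gcongr
    rw [← ofReal_norm]
    exact ENNReal.ofReal_le_ofReal (hB₁ x)
  have t2 : Tendsto (fun n => ∫ x in Ω, ψ x • (q n).2 x) atTop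
      (𝓝 (∫ x in Ω, ψ x • p.2 x)) := by
    refine tendsto_integral_of_L1 _ (integrableOn_smul_of_test h1.continuous h2 h3
      (h.integrableOn p.2).locallyIntegrableOn).aestronglyMeasurable (Eventually.of_forall fun n =>
      integrableOn_smul_of_test h1.continuous h2 h3 (h.integrableOn (q n).2).locallyIntegrableOn) ?_
    have := ENNReal.Tendsto.const_mul (a := ENNReal.ofReal B₂) l2 (Or.inr ENNReal.ofReal_ne_top)
    rw [mul_zero] at this
    refine tendsto_of_tendsto_of_tendsto_of_le_of_le tendsto_const_nhds this (fun _ => bot_le)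
      fun n => ?_
    simp only [Function.comp_apply]
    rw [← lintegral_const_mul' _ _ ENNReal.ofReal_ne_top]
    refine lintegral_mono fun x => ?_
    simp only
    rw [← smul_sub, enorm_smul]
    gcongr
    rw [← ofReal_norm]
    exact ENNReal.ofReal_le_ofReal (hB₂ x)
  refine tendsto_nhds_unique t1 (t2.neg.congr fun n => ?_)
  obtain ⟨φ, hφ, hφc, hφs, e1, e2⟩ := hq n
  have e1' := h.absolutelyContinuous.ae_le e1
  have e2' := h.absolutelyContinuous.ae_le e2
  have := (hasWeakGradient_of_contDiff hφ hφc hφs).2.2 ψ h1 h2 h3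
  rw [integral_congr_ae (g := fun x => ψ x • gradient φ x)
      (by filter_upwards [e2'] with x hx; rw [hx]), ← this]
  exact integral_congr_ae (by filter_upwards [e1'] with x hx; rw [hx])

theorem span_testPairs :
    (Submodule.span ℝ (testPairs Ω Λ β) : Set (L2 Ω Λ β × L2Vec Ω Λ β)) = testPairs Ω Λ β := by
  have hgs := fun φ : E d → ℝ => tsupport_gradient_subset φ
  refine Subset.antisymm (fun p hp => ?_) Submodule.subset_span
  refine Submodule.span_induction (p := fun p _ => p ∈ testPairs Ω Λ β) (fun _ h => h) ?_ ?_ ?_ hp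
  · refine ⟨0, contDiff_const, HasCompactSupport.zero, by simp, Lp.coeFn_zero _ _ _, ?_⟩
    have : gradient (0 : E d → ℝ) = 0 := by
      funext x; simp [gradient]
    rw [this]
    exact Lp.coeFn_zero _ _ _
  · rintro p q - - ⟨φ, h1, h2, h3, h4, h5⟩ ⟨ψ, k1, k2, k3, k4, k5⟩
    refine ⟨φ + ψ, h1.add k1, h2.add k2, (tsupport_add φ ψ).trans (union_subset h3 k3),
      (Lp.coeFn_add _ _).trans (h4.add k4), (Lp.coeFn_add _ _).trans ((h5.add k5).trans ?_)⟩
    refine Eventually.of_forall fun x => ?_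
    simp [gradient, fderiv_add (h1.differentiable (by simp) x) (k1.differentiable (by simp) x)]
  · rintro c p - ⟨φ, h1, h2, h3, h4, h5⟩
    refine ⟨c • φ, h1.const_smul c, ?_, ?_,
      (Lp.coeFn_smul _ _).trans (h4.const_smul c), (Lp.coeFn_smul _ _).trans
        ((h5.const_smul c).trans ?_)⟩
    · exact h2.mono (Function.support_const_smul_subset c φ)
    · exact (closure_mono (Function.support_const_smul_subset c φ)).trans h3
    · refine Eventually.of_forall fun x => ?_
      simp [gradient, fderiv_const_smul (h1.differentiable (by simp) x)]

/-- The intersection with `H1` in the definition is redundant. Any closed condition on H¹_{0,β} may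
now be checked on smooth functions with compact support. -/
theorem AdmissibleWeight.mem_H10_iff (h : AdmissibleWeight Ω Λ β)
    {p : L2 Ω Λ β × L2Vec Ω Λ β} : p ∈ H10 Ω Λ β ↔ p ∈ closure (testPairs Ω Λ β) := by
  rw [H10, Submodule.mem_inf, ← SetLike.mem_coe (p := Submodule.topologicalClosure _),
    Submodule.topologicalClosure_coe, span_testPairs]
  exact ⟨fun hp => hp.2, fun hp => ⟨h.closure_testPairs_subset hp, hp⟩⟩

end WeightedSobolev

open scoped Convolution

/-! ### Products with cutoffs, and Lipschitz functions in H¹_{0,β}. -/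

section WeightedSobolevLipschitz

variable {d : ℕ} {Ω Λ : Set (E d)} {β : ℝ}

/-- Bounded continuous fields of operators act continuously on L²; pointwise products thereby become
maps under which closures can be transported. -/
theorem exists_pointwise_clm {X F F' : Type*} [TopologicalSpace X] [MeasurableSpace X]
    [OpensMeasurableSpace X] [SecondCountableTopology X] [NormedAddCommGroup F] [NormedSpace ℝ F]
    [NormedAddCommGroup F'] [NormedSpace ℝ F'] (μ : Measure X)
    {T : X → F →L[ℝ] F'} [SecondCountableTopologyEither X (F →L[ℝ] F')]
    (hT : Continuous T) {C : ℝ} (hC : ∀ x, ‖T x‖ ≤ C) :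
    ∃ L : Lp F 2 μ →L[ℝ] Lp F' 2 μ, ∀ f, L f =ᵐ[μ] fun x => T x (f x) := by
  have hm : ∀ f : Lp F 2 μ, MemLp (fun x => T x (f x)) 2 μ := fun f => by
    refine (Lp.memLp f).of_le_mul (c := C) ?_ (Eventually.of_forall fun x => ?_)
    · exact (isBoundedBilinearMap_apply (𝕜 := ℝ) (E := F) (F := F')).continuous.comp_aestronglyMeasurable
        (hT.aestronglyMeasurable.prodMk (Lp.aestronglyMeasurable f))
    · exact (T x).le_of_opNorm_le (hC x) _
  refine ⟨LinearMap.mkContinuous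
    { toFun := fun f => (hm f).toLp _
      map_add' := fun f g => ?_
      map_smul' := fun c f => ?_ } C fun f => ?_, fun f => (hm f).coeFn_toLp⟩
  · refine Lp.ext ?_
    filter_upwards [(hm (f + g)).coeFn_toLp, Lp.coeFn_add ((hm f).toLp _) ((hm g).toLp _),
      (hm f).coeFn_toLp, (hm g).coeFn_toLp, Lp.coeFn_add f g] with x h1 h2 h3 h4 h5
    refine (h1.trans ?_).trans h2.symm
    rw [h5, Pi.add_apply, Pi.add_apply, h3, h4, map_add]
  · refine Lp.ext ?_
    simp only [RingHom.id_apply]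
    filter_upwards [(hm (c • f)).coeFn_toLp, Lp.coeFn_smul c ((hm f).toLp _),
      (hm f).coeFn_toLp, Lp.coeFn_smul c f] with x h1 h2 h3 h5
    refine (h1.trans ?_).trans h2.symm
    rw [h5, Pi.smul_apply, Pi.smul_apply, h3, map_smul]
  · refine Lp.norm_le_mul_norm_of_ae_le_mul ?_
    filter_upwards [(hm f).coeFn_toLp] with x hx
    simp only [LinearMap.coe_mk, AddHom.coe_mk, hx]
    exact (T x).le_of_opNorm_le (hC x) _

theorem gradient_mul {η φ : E d → ℝ} {x : E d} (hη : DifferentiableAt ℝ η x)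
    (hφ : DifferentiableAt ℝ φ x) :
    gradient (fun y => η y * φ y) x = η x • gradient φ x + φ x • gradient η x := by
  simp [gradient, fderiv_fun_mul hη hφ]

/-- The map (u, G) ↦ (ηu, ηG + u∇η) is continuous and, by the product rule, sends test pairs to test
pairs. -/
theorem AdmissibleWeight.exists_mul_mem_H10 (h : AdmissibleWeight Ω Λ β) {η : E d → ℝ}
    (hη : ContDiff ℝ ∞ η) {B₀ B₁ : ℝ} (h0 : ∀ x, |η x| ≤ B₀) (h1 : ∀ x, ‖gradient η x‖ ≤ B₁)
    {p : L2 Ω Λ β × L2Vec Ω Λ β} (hp : p ∈ H10 Ω Λ β) :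
    ∃ q ∈ H10 Ω Λ β, q.1 =ᵐ[wMeasure Ω Λ β] (fun x => η x * p.1 x) ∧
      q.2 =ᵐ[wMeasure Ω Λ β] fun x => η x • p.2 x + p.1 x • gradient η x := by
  have hb : ∀ F : Type, ∀ [NormedAddCommGroup F] [NormedSpace ℝ F], ∀ x,
      ‖η x • ContinuousLinearMap.id ℝ F‖ ≤ B₀ := fun F _ _ x => by
    rw [norm_smul]
    exact (mul_le_of_le_one_right (norm_nonneg _) ContinuousLinearMap.norm_id_le).trans (h0 x)
  obtain ⟨L₁, hL₁⟩ := exists_pointwise_clm (wMeasure Ω Λ β)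
    (hη.continuous.smul (continuous_const (y := ContinuousLinearMap.id ℝ ℝ))) (hb ℝ)
  obtain ⟨L₂, hL₂⟩ := exists_pointwise_clm (wMeasure Ω Λ β)
    (hη.continuous.smul (continuous_const (y := ContinuousLinearMap.id ℝ (E d)))) (hb (E d))
  obtain ⟨L₃, hL₃⟩ := exists_pointwise_clm (wMeasure Ω Λ β)
    (T := fun x => ContinuousLinearMap.smulRight (1 : ℝ →L[ℝ] ℝ) (gradient η x))
    ((ContinuousLinearMap.smulRightL ℝ ℝ (E d) 1).continuous.comp (continuous_gradient hη))
    (C := B₁) (fun x => by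
      rw [ContinuousLinearMap.norm_smulRight_apply]
      simpa using h1 x)
  have hcont : Continuous fun p : L2 Ω Λ β × L2Vec Ω Λ β => (L₁ p.1, L₂ p.2 + L₃ p.1) := by
    fun_prop
  refine ⟨(L₁ p.1, L₂ p.2 + L₃ p.1), ?_, hL₁ p.1, ?_⟩
  · rw [h.mem_H10_iff] at hp ⊢
    refine map_mem_closure (f := fun p : L2 Ω Λ β × L2Vec Ω Λ β => (L₁ p.1, L₂ p.2 + L₃ p.1))
      hcont hp ?_
    rintro q ⟨φ, hφ, hc, hs, e1, e2⟩
    refine ⟨fun x => η x * φ x, hη.mul hφ, hc.mul_left, ?_, ?_, ?_⟩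
    · exact (tsupport_mul_subset_right (f := η) (g := φ)).trans hs
    · filter_upwards [hL₁ q.1, e1] with x h3 h4
      simp [h3, h4]
    · filter_upwards [hL₂ q.2, hL₃ q.1, e1, e2, Lp.coeFn_add (L₂ q.2) (L₃ q.1)] with x h3 h4 h5 h6 h7
      rw [h7, gradient_mul (hη.differentiable (by simp) x) (hφ.differentiable (by simp) x)]
      simp [h3, h4, h5, h6]
  · filter_upwards [hL₂ p.2, hL₃ p.1, Lp.coeFn_add (L₂ p.2) (L₃ p.1)] with x h3 h4 h7
    rw [h7]
    simp [h3, h4]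

theorem tendsto_Lp_of_bounded {α F : Type*} [MeasurableSpace α] [NormedAddCommGroup F]
    {μ : Measure α} [IsFiniteMeasure μ] {f : ℕ → Lp F 2 μ} {g : Lp F 2 μ} {C : ℝ≥0}
    (hb : ∀ n, ∀ᵐ x ∂μ, ‖f n x - g x‖ ≤ C)
    (hlim : ∀ᵐ x ∂μ, Tendsto (fun n => f n x) atTop (𝓝 (g x))) : Tendsto f atTop (𝓝 g) := by
  have h1 : Tendsto (fun n => ∫⁻ x, ‖f n x - g x‖ₑ ^ 2 ∂μ) atTop (𝓝 (∫⁻ _, 0 ∂μ)) := by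
    refine tendsto_lintegral_of_dominated_convergence' (fun _ => (C : ℝ≥0∞) ^ 2) (fun n => ?_)
      (fun n => ?_) ?_ ?_
    · exact (((Lp.aestronglyMeasurable (f n)).sub (Lp.aestronglyMeasurable g)).enorm).pow_const 2
    · filter_upwards [hb n] with x hx
      gcongr
      exact enorm_le_coe.2 hx
    · rw [lintegral_const]
      exact ENNReal.mul_ne_top (ENNReal.pow_ne_top ENNReal.coe_ne_top) (measure_ne_top _ _)
    · filter_upwards [hlim] with x hx
      have h2 : Tendsto (fun n => ‖f n x - g x‖ₑ) atTop (𝓝 0) := by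
        have := (continuous_enorm.tendsto (0 : F)).comp (tendsto_sub_nhds_zero_iff.2 hx)
        simpa [Function.comp_def] using this
      simpa using ENNReal.Tendsto.pow (n := 2) h2
  rw [lintegral_zero] at h1
  have h2 : ∀ n, ∫⁻ x, ‖f n x - g x‖ₑ ^ 2 ∂μ = ‖f n - g‖ₑ ^ 2 := fun n => by
    rw [enorm_sq_eq_lintegral]
    refine lintegral_congr_ae ?_
    filter_upwards [Lp.coeFn_sub (f n) g] with x hx
    rw [hx]; rfl
  simp only [h2] at h1
  have h3 : Tendsto (fun n => (‖f n - g‖ₑ ^ 2) ^ (1 / 2 : ℝ)) atTop (𝓝 0) := by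
    have := (ENNReal.continuous_rpow_const (y := 1 / 2)).tendsto (0 : ℝ≥0∞) |>.comp h1
    simpa [Function.comp_def] using this
  rw [tendsto_iff_edist_tendsto_0]
  refine h3.congr fun n => ?_
  rw [← ENNReal.rpow_natCast, ← ENNReal.rpow_mul, edist_eq_enorm_sub]
  norm_num

theorem measurable_gradient (f : E d → ℝ) : Measurable (gradient f) :=
  (InnerProductSpace.toDual ℝ (E d)).symm.continuous.measurable.comp (measurable_fderiv ℝ f)

theorem norm_gradient_le_of_lipschitzWith {f : E d → ℝ} {K : ℝ≥0} (hf : LipschitzWith K f)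
    (x : E d) : ‖gradient f x‖ ≤ K := by
  rw [norm_gradient]
  exact norm_fderiv_le_of_lipschitz ℝ hf

/-- Mollification commutes with the gradient of a Lipschitz function. -/
theorem gradient_convolution_eq {f : E d → ℝ} {K : ℝ≥0} (hf : LipschitzWith K f)
    {ρ : E d → ℝ} (hρ : Continuous ρ) (hc : HasCompactSupport ρ) (x : E d) :
    gradient (ρ ⋆[ContinuousLinearMap.lsmul ℝ ℝ, volume] f) x =
      (ρ ⋆[ContinuousLinearMap.lsmul ℝ ℝ, volume] gradient f) x := by
  have hFm : ∀ y : E d, Continuous fun t => ρ t • f (y - t) := fun y =>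
    hρ.smul (hf.continuous.comp (continuous_const.sub continuous_id))
  -- The derivative falls on f, not on the mollifier. By Rademacher's theorem f is differentiable at
  -- x - t for almost every t, and the Lipschitz constant supplies the dominating function.
  have key : HasFDerivAt (fun y => ∫ t, ρ t • f (y - t)) (∫ t, ρ t • fderiv ℝ f (x - t)) x := by
    refine (hasFDerivAt_integral_of_dominated_loc_of_lip (s := univ) (bound := fun t => K * |ρ t|)
      univ_mem (Eventually.of_forall fun y => (hFm y).aestronglyMeasurable)
      ((hFm x).integrable_of_hasCompactSupport hc.smul_right) ?_ ?_ ?_ ?_).2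
    · refine hρ.aestronglyMeasurable.smul (Measurable.aestronglyMeasurable ?_)
      exact (measurable_fderiv ℝ f).comp (measurable_const.sub measurable_id)
    · refine Eventually.of_forall fun t => LipschitzWith.lipschitzOnWith ?_
      refine LipschitzWith.of_dist_le_mul fun y z => ?_
      rw [dist_eq_norm, ← smul_sub, norm_smul, ← dist_eq_norm]
      have := hf.dist_le_mul (y - t) (z - t)
      rw [dist_sub_right] at this
      simp only [Real.coe_nnabs, abs_mul, abs_abs, NNReal.abs_eq, Real.norm_eq_abs]
      calc |ρ t| * dist (f (y - t)) (f (z - t)) ≤ |ρ t| * (K * dist y z) := by gcongr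
        _ = _ := by ring
    · exact ((hρ.abs.integrable_of_hasCompactSupport hc.norm).const_mul _)
    · have h1 : ∀ᵐ t, DifferentiableAt ℝ f (x - t) :=
        (quasiMeasurePreserving_sub_left volume x).ae hf.ae_differentiableAt
      filter_upwards [h1] with t ht
      have h2 : HasFDerivAt (fun y => f (y - t)) (fderiv ℝ f (x - t)) x := by
        simpa [Function.comp_def] using ht.hasFDerivAt.comp x ((hasFDerivAt_id x).sub_const t)
      exact h2.fun_const_smul (ρ t)
  have hfd : fderiv ℝ (ρ ⋆[ContinuousLinearMap.lsmul ℝ ℝ, volume] f) x =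
      ∫ t, ρ t • fderiv ℝ f (x - t) := key.fderiv
  rw [gradient, hfd, convolution_def]
  rw [← LinearIsometryEquiv.coe_toContinuousLinearEquiv,
    ← ContinuousLinearEquiv.integral_comp_comm]
  simp [gradient]

theorem norm_convolution_le {F : Type*} [NormedAddCommGroup F] [NormedSpace ℝ F] {ρ : E d → ℝ}
    {g : E d → F} {K : ℝ} (hρ0 : ∀ x, 0 ≤ ρ x) (hρ : ∫ x, ρ x = 1) (hi : Integrable ρ)
    (hg : ∀ x, ‖g x‖ ≤ K) (x : E d) :
    ‖(ρ ⋆[ContinuousLinearMap.lsmul ℝ ℝ, volume] g) x‖ ≤ K := by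
  rw [convolution_def]
  refine (norm_integral_le_of_norm_le (hi.mul_const K) (Eventually.of_forall fun t => ?_)).trans
    (le_of_eq ?_)
  · simp only [ContinuousLinearMap.lsmul_apply, norm_smul, Real.norm_eq_abs, abs_of_nonneg (hρ0 t)]
    exact mul_le_mul_of_nonneg_left (hg _) (hρ0 t)
  · rw [integral_mul_const, hρ, one_mul]

/-- Mollification at radii δ/(n + 1), with the closed δ-neighbourhood of the support inside Ω. The
functions converge uniformly, the gradients are bounded by K and converge almost everywhere, so
dominated convergence applies in the finite weighted measure. -/
theorem AdmissibleWeight.exists_mem_H10_of_tsupport (h : AdmissibleWeight Ω Λ β) {f : E d → ℝ}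
    {K : ℝ≥0} (hf : LipschitzWith K f) (hc : HasCompactSupport f) (hs : tsupport f ⊆ Ω) :
    ∃ p ∈ H10 Ω Λ β, p.1 =ᵐ[wMeasure Ω Λ β] f ∧ p.2 =ᵐ[wMeasure Ω Λ β] gradient f := by
  have hfin := h.isFiniteMeasure
  obtain ⟨δ, hδ, hsub⟩ := hc.isCompact.exists_cthickening_subset_open h.isOpen hs
  have hpos : ∀ n : ℕ, 0 < δ / (n + 1) := fun n => by positivity
  set ρ : ℕ → ContDiffBump (0 : E d) := fun n =>
    ⟨δ / (n + 1) / 2, δ / (n + 1), half_pos (hpos n), half_lt_self (hpos n)⟩ with hρ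
  have hrOut : ∀ n, (ρ n).rOut = δ / (n + 1) := fun n => rfl
  have hlim0 : Tendsto (fun n => (ρ n).rOut) atTop (𝓝 0) := by
    simp only [hrOut]
    exact tendsto_const_div_atTop_nhds_zero_nat δ |>.comp (tendsto_add_atTop_nat 1) |>.congr
      fun n => by simp
  set φ : ℕ → E d → ℝ := fun n =>
    ((ρ n).normed volume ⋆[ContinuousLinearMap.lsmul ℝ ℝ, volume] f) with hφ
  have hsm : ∀ n, ContDiff ℝ ∞ (φ n) := fun n =>
    (ρ n).hasCompactSupport_normed.contDiff_convolution_left _ (ρ n).contDiff_normed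
      hf.continuous.locallyIntegrable
  have hgr : ∀ n x, gradient (φ n) x =
      ((ρ n).normed volume ⋆[ContinuousLinearMap.lsmul ℝ ℝ, volume] gradient f) x := fun n x =>
    gradient_convolution_eq hf (ρ n).continuous_normed (ρ n).hasCompactSupport_normed x
  have hdist : ∀ n x, dist (φ n x) (f x) ≤ K * δ / (n + 1) := fun n x => by
    refine (ρ n).dist_normed_convolution_le hf.continuous.aestronglyMeasurable fun y hy => ?_
    refine (hf.dist_le_mul y x).trans ?_
    rw [mul_div_assoc]
    exact mul_le_mul_of_nonneg_left (Metric.mem_ball.1 hy).le K.2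
  have hsupp : ∀ n, tsupport (φ n) ⊆ Metric.cthickening δ (tsupport f) := fun n => by
    refine closure_minimal ((support_convolution_subset_swap _).trans ?_) Metric.isClosed_cthickening
    rw [(ρ n).support_normed_eq]
    rintro x ⟨a, ha, b, hb, rfl⟩
    refine Metric.mem_cthickening_of_dist_le _ a _ _ (subset_tsupport f ha) ?_
    have hb' : ‖b‖ < δ / (n + 1) := by simpa using hb
    have h1 : δ / (n + 1) ≤ δ := div_le_self hδ.le (by linarith [n.cast_nonneg (α := ℝ)])
    simp only [dist_eq_norm, add_sub_cancel_left]
    linarith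
  have hcs : ∀ n, HasCompactSupport (φ n) := fun n =>
    (hc.isCompact.cthickening).of_isClosed_subset (isClosed_tsupport _) (hsupp n)
  have hgl : LocallyIntegrable (gradient f) := by
    refine (locallyIntegrable_const (K : ℝ)).mono (measurable_gradient f).aestronglyMeasurable
      (Eventually.of_forall fun x => ?_)
    simpa using norm_gradient_le_of_lipschitzWith hf x
  have hgrlim : ∀ᵐ x, Tendsto (fun n => gradient (φ n) x) atTop (𝓝 (gradient f x)) := by
    simp only [hgr]
    refine ContDiffBump.ae_convolution_tendsto_right_of_locallyIntegrable (K := 2) hlim0 ?_ hgl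
    refine Eventually.of_forall fun n => ?_
    change δ / (n + 1) ≤ 2 * (δ / (n + 1) / 2)
    linarith
  have hgrb : ∀ n x, ‖gradient (φ n) x‖ ≤ K := fun n x => by
    rw [hgr]
    exact norm_convolution_le (fun y => (ρ n).nonneg_normed y) (ρ n).integral_normed
      (ρ n).integrable_normed (norm_gradient_le_of_lipschitzWith hf) x
  have hmem1 : ∀ n, MemLp (φ n) 2 (wMeasure Ω Λ β) := fun n =>
    (hsm n).continuous.memLp_of_hasCompactSupport (hcs n)
  have hmem2 : ∀ n, MemLp (gradient (φ n)) 2 (wMeasure Ω Λ β) := fun n =>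
    MemLp.of_bound (continuous_gradient (hsm n)).aestronglyMeasurable K
      (Eventually.of_forall (hgrb n))
  have hmemf : MemLp f 2 (wMeasure Ω Λ β) := hf.continuous.memLp_of_hasCompactSupport hc
  have hmemg : MemLp (gradient f) 2 (wMeasure Ω Λ β) :=
    MemLp.of_bound (measurable_gradient f).aestronglyMeasurable K
      (Eventually.of_forall (norm_gradient_le_of_lipschitzWith hf))
  refine ⟨(hmemf.toLp, hmemg.toLp), ?_, hmemf.coeFn_toLp, hmemg.coeFn_toLp⟩
  rw [h.mem_H10_iff]
  refine mem_closure_of_tendsto (f := fun n => ((hmem1 n).toLp, (hmem2 n).toLp)) (b := atTop) ?_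
    (Eventually.of_forall fun n => ⟨φ n, hsm n, hcs n, (hsupp n).trans hsub,
      (hmem1 n).coeFn_toLp, (hmem2 n).coeFn_toLp⟩)
  refine Tendsto.prodMk_nhds (tendsto_Lp_of_bounded (C := K * δ.toNNReal) (fun n => ?_) ?_)
    (tendsto_Lp_of_bounded (C := 2 * K) (fun n => ?_) ?_)
  · filter_upwards [(hmem1 n).coeFn_toLp, hmemf.coeFn_toLp] with x h1 h2
    rw [h1, h2, ← dist_eq_norm]
    refine (hdist n x).trans ?_
    rw [mul_div_assoc, NNReal.coe_mul, Real.coe_toNNReal _ hδ.le]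
    exact mul_le_mul_of_nonneg_left (div_le_self hδ.le (by linarith [n.cast_nonneg (α := ℝ)])) K.2
  · have hall : ∀ᵐ x ∂(wMeasure Ω Λ β), ∀ n, (hmem1 n).toLp (φ n) x = φ n x :=
      ae_all_iff.2 fun n => (hmem1 n).coeFn_toLp
    filter_upwards [hall, hmemf.coeFn_toLp] with x h1 h2
    simp only [h1, h2]
    rw [tendsto_iff_dist_tendsto_zero]
    have : Tendsto (fun n : ℕ => K * δ / ((n : ℝ) + 1)) atTop (𝓝 0) :=
      tendsto_const_div_atTop_nhds_zero_nat (K * δ) |>.comp (tendsto_add_atTop_nat 1) |>.congr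
        fun n => by simp
    exact squeeze_zero (fun _ => dist_nonneg) (fun n => hdist n x) this
  · filter_upwards [(hmem2 n).coeFn_toLp, hmemg.coeFn_toLp] with x h1 h2
    rw [h1, h2]
    refine (norm_sub_le _ _).trans ?_
    push_cast
    linarith [hgrb n x, norm_gradient_le_of_lipschitzWith hf x]
  · have hall : ∀ᵐ x ∂(wMeasure Ω Λ β), ∀ n, (hmem2 n).toLp (gradient (φ n)) x = gradient (φ n) x :=
      ae_all_iff.2 fun n => (hmem2 n).coeFn_toLp
    filter_upwards [hall, hmemg.coeFn_toLp,
      wMeasure_absolutelyContinuous.ae_le (ae_restrict_of_ae hgrlim)] with x h1 h2 h3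
    simpa only [h1, h2] using h3

/-- A Lipschitz function that vanishes off `Ω` lies in `H¹₀`, with the pointwise gradient cut off to
`{f ≠ 0}` as its weak gradient. -/
theorem AdmissibleWeight.exists_mem_H10 (h : AdmissibleWeight Ω Λ β) {f : E d → ℝ}
    {K : ℝ≥0} (hf : LipschitzWith K f) (hs : ∀ x, x ∉ Ω → f x = 0) :
    ∃ p ∈ H10 Ω Λ β, p.1 =ᵐ[wMeasure Ω Λ β] f ∧
      p.2 =ᵐ[wMeasure Ω Λ β] {x | f x ≠ 0}.indicator (gradient f) := by
  have hfin := h.isFiniteMeasure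
  -- Soft thresholding: for ε > 0 the function t ε is supported in {|f| ≥ ε}, a compact part of Ω,
  -- and is within ε of f. Its gradient is that of f where |f| > ε and zero where f = 0, which
  -- explains the cutoff in the limit.
  set t : ℝ → E d → ℝ := fun ε x => f x - max (-ε) (min ε (f x)) with ht
  have htl : ∀ ε, LipschitzWith (K + K) (t ε) := fun ε =>
    hf.sub ((hf.const_min ε).const_max (-ε))
  have hbd : ∀ ε, 0 < ε → ∀ x, |t ε x - f x| ≤ ε := fun ε hε x => by
    simp only [ht, sub_sub_cancel_left, abs_neg]
    rw [abs_le]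
    exact ⟨le_max_left _ _, max_le (by linarith) (min_le_left _ _)⟩
  have hz : ∀ ε, ∀ x, |f x| ≤ ε → t ε x = 0 := fun ε x hx => by
    rw [abs_le] at hx
    simp [ht, min_eq_right hx.2, max_eq_right hx.1]
  have htsub : ∀ ε, tsupport (t ε) ⊆ {x | ε ≤ |f x|} := fun ε => by
    refine closure_minimal (fun x hx => ?_) (isClosed_le continuous_const hf.continuous.abs)
    by_contra h1
    exact hx (hz ε x (not_le.1 h1).le)
  have hsΩ : ∀ ε, 0 < ε → tsupport (t ε) ⊆ Ω := fun ε hε x hx => by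
    by_contra h1
    have := htsub ε hx
    simp only [mem_ofPred_eq, hs x h1, abs_zero] at this
    linarith
  have hcs : ∀ ε, 0 < ε → HasCompactSupport (t ε) := fun ε hε =>
    Metric.isCompact_of_isClosed_isBounded (isClosed_tsupport _) (h.isBounded.subset (hsΩ ε hε))
  have hg : ∀ x, ∀ ε, 0 < ε → ε < |f x| → gradient (t ε) x = gradient f x := fun x ε hε hx => by
    have : fderiv ℝ (t ε) x = fderiv ℝ f x := by
      rcases lt_abs.1 hx with h1 | h1
      · have : t ε =ᶠ[𝓝 x] fun y => f y - ε := by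
          filter_upwards [hf.continuous.continuousAt.eventually_const_lt h1] with y hy
          simp only [ht]
          rw [min_eq_left hy.le, max_eq_right (by linarith)]
        rw [this.fderiv_eq, fderiv_sub_const]
      · have : t ε =ᶠ[𝓝 x] fun y => f y - (-ε) := by
          have h2 : f x < -ε := by linarith
          filter_upwards [hf.continuous.continuousAt.eventually_lt_const h2] with y hy
          simp only [ht]
          rw [min_eq_right (by linarith), max_eq_left (by linarith)]
        rw [this.fderiv_eq, fderiv_sub_const]
    rw [gradient, this, gradient]
  have hg0 : ∀ x, ∀ ε, 0 < ε → f x = 0 → gradient (t ε) x = 0 := fun x ε hε hx => by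
    have : t ε =ᶠ[𝓝 x] fun _ => 0 := by
      have h2 : |f x| < ε := by simpa [hx] using hε
      filter_upwards [hf.continuous.abs.continuousAt.eventually_lt_const h2] with y hy
      exact hz ε y hy.le
    rw [gradient, this.fderiv_eq]
    simp
  set e : ℕ → ℝ := fun n => 1 / ((n : ℝ) + 1) with he
  have hepos : ∀ n, 0 < e n := fun n => by positivity
  have hele : ∀ n, e n ≤ 1 := fun n => by
    rw [he]; exact div_le_one_of_le₀ (by linarith [n.cast_nonneg (α := ℝ)]) (by positivity)
  have helim : Tendsto e atTop (𝓝 0) := tendsto_one_div_add_atTop_nhds_zero_nat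
  choose q hq hq1 hq2 using fun n =>
    h.exists_mem_H10_of_tsupport (htl (e n)) (hcs _ (hepos n)) (hsΩ _ (hepos n))
  have hcf : HasCompactSupport f := by
    refine HasCompactSupport.of_support_subset_isCompact
      (Metric.isCompact_of_isClosed_isBounded isClosed_closure h.isBounded.closure) fun x hx => ?_
    by_contra h1
    exact hx (hs x fun h2 => h1 (subset_closure h2))
  have hmemf : MemLp f 2 (wMeasure Ω Λ β) := hf.continuous.memLp_of_hasCompactSupport hcf
  have hind : ∀ x, ‖{x | f x ≠ 0}.indicator (gradient f) x‖ ≤ K := fun x =>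
    (norm_indicator_le_norm_self _ _).trans (norm_gradient_le_of_lipschitzWith hf x)
  have hmemg : MemLp ({x | f x ≠ 0}.indicator (gradient f)) 2 (wMeasure Ω Λ β) := by
    refine MemLp.of_bound (Measurable.aestronglyMeasurable ?_) K (Eventually.of_forall hind)
    exact (measurable_gradient f).indicator
      (isOpen_ne_fun hf.continuous continuous_const).measurableSet
  refine ⟨(hmemf.toLp, hmemg.toLp), ?_, hmemf.coeFn_toLp, hmemg.coeFn_toLp⟩
  rw [h.mem_H10_iff, ← closure_closure]
  refine mem_closure_of_tendsto (f := q) (b := atTop) ?_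
    (Eventually.of_forall fun n => h.mem_H10_iff.1 (hq n))
  have a1 : ∀ᵐ x ∂(wMeasure Ω Λ β), ∀ n, (q n).1 x = t (e n) x := ae_all_iff.2 hq1
  have a2 : ∀ᵐ x ∂(wMeasure Ω Λ β), ∀ n, (q n).2 x = gradient (t (e n)) x := ae_all_iff.2 hq2
  refine (Prod.tendsto_iff _ _).2 ⟨tendsto_Lp_of_bounded (C := 1) (fun n => ?_) ?_,
    tendsto_Lp_of_bounded (C := 3 * K) (fun n => ?_) ?_⟩
  · filter_upwards [a1, hmemf.coeFn_toLp] with x h1 h2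
    rw [h1, h2]
    exact (hbd _ (hepos n) x).trans (hele n)
  · filter_upwards [a1, hmemf.coeFn_toLp] with x h1 h2
    simp only [h1, h2]
    rw [tendsto_iff_dist_tendsto_zero]
    exact squeeze_zero (fun _ => dist_nonneg) (fun n => hbd _ (hepos n) x) helim
  · filter_upwards [a2, hmemg.coeFn_toLp] with x h1 h2
    rw [h1, h2]
    refine (norm_sub_le _ _).trans ?_
    have := norm_gradient_le_of_lipschitzWith (htl (e n)) x
    push_cast at this ⊢
    linarith [hind x]
  · filter_upwards [a2, hmemg.coeFn_toLp] with x h1 h2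
    simp only [h1, h2]
    by_cases hx : f x = 0
    · simp [hg0 x _ (hepos _) hx, indicator, hx]
    · have : ∀ᶠ n in atTop, e n < |f x| := helim.eventually_lt_const (abs_pos.2 hx)
      refine tendsto_const_nhds.congr' (this.mono fun n hn => ?_)
      simp [hg x _ (hepos n) hn, indicator, hx]

end WeightedSobolevLipschitz

/-! ### The weighted local projections -/

section LocalProjection

variable {d ℓ : ℕ} {c : ℝ} {Ω Λ : Set (E d)} {β : ℝ}

theorem affineMap_apply_eq (a : E d →ᵃ[ℝ] ℝ) (x : E d) : a x = a.linear x + a 0 :=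
  congrFun a.decomp x

/-- The values at q + z and q - z average to a q, and both substitutions carry the ball about 0 to
the ball about q. -/
theorem enorm_affine_mul_volume_le (a : E d →ᵃ[ℝ] ℝ) (q : E d) (r : ℝ) :
    ‖a q‖ₑ * volume (closedBall (0 : E d) r) ≤ ∫⁻ x in closedBall q r, ‖a x‖ₑ := by
  have hm : Measurable fun x => ‖a x‖ₑ := a.continuous_of_finiteDimensional.measurable.enorm
  have e1 : ∫⁻ z in closedBall 0 r, ‖a (q + z)‖ₑ = ∫⁻ x in closedBall q r, ‖a x‖ₑ := by
    rw [← (measurePreserving_add_left volume q).setLIntegral_comp_preimage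
      Metric.isClosed_closedBall.measurableSet hm]
    congr 2
    ext z
    simp [dist_eq_norm]
  have e2 : ∫⁻ z in closedBall 0 r, ‖a (q - z)‖ₑ = ∫⁻ x in closedBall q r, ‖a x‖ₑ := by
    rw [← (Measure.measurePreserving_sub_left volume q).setLIntegral_comp_preimage
      Metric.isClosed_closedBall.measurableSet hm]
    congr 2
    ext z
    simp [dist_eq_norm]
  have key : 2 * (‖a q‖ₑ * volume (closedBall (0 : E d) r)) ≤
      2 * ∫⁻ x in closedBall q r, ‖a x‖ₑ := by
    calc 2 * (‖a q‖ₑ * volume (closedBall (0 : E d) r))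
        = ∫⁻ _ in closedBall (0 : E d) r, 2 * ‖a q‖ₑ := by rw [setLIntegral_const, mul_assoc]
      _ ≤ ∫⁻ z in closedBall (0 : E d) r, (‖a (q + z)‖ₑ + ‖a (q - z)‖ₑ) := by
          refine lintegral_mono fun z => ?_
          have : a (q + z) + a (q - z) = 2 * a q := by
            rw [affineMap_apply_eq a, affineMap_apply_eq a (q - z), affineMap_apply_eq a q, map_add,
              map_sub]
            ring
          refine le_trans (le_of_eq ?_) (enorm_add_le _ _)
          rw [this, enorm_mul]
          congr 1
          rw [Real.enorm_of_nonneg (by norm_num), ENNReal.ofReal_ofNat]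
      _ = 2 * ∫⁻ x in closedBall q r, ‖a x‖ₑ := by
          rw [lintegral_add_left (f := fun z => ‖a (q + z)‖ₑ) (hm.comp (measurable_const_add q)), e1, e2,
            two_mul]
  exact (ENNReal.mul_le_mul_iff_right (by norm_num) (by norm_num)).1 key

/-- The value at v is extrapolated from p and from the point q with v - p = (4/σ)(q - p), both of
which carry balls of radius σH/4 inside the ball of radius σH about p. The factor 1 + 8/σ comes from
|a p| + (4/σ)(|a q| + |a p|). -/
theorem enorm_affine_mul_volume_le_ball (a : E d →ᵃ[ℝ] ℝ) {p v : E d} {H σ : ℝ} (hσ : 0 < σ)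
    (hH : 0 < H) (hv : dist v p ≤ H) :
    ‖a v‖ₑ * volume (closedBall (0 : E d) (σ * H / 4)) ≤
      ENNReal.ofReal (1 + 8 / σ) * ∫⁻ x in ball p (σ * H), ‖a x‖ₑ := by
  set q : E d := p + (σ / 4) • (v - p) with hq
  have hav : a v = a p + 4 / σ * (a q - a p) := by
    rw [affineMap_apply_eq a v, affineMap_apply_eq a p, affineMap_apply_eq a q, hq, map_add,
      map_smul, map_sub, smul_eq_mul]
    field_simp
    ring
  have hpos : 0 < σ * H := by positivity
  have hqp : dist q p ≤ σ * H / 4 := by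
    rw [hq, dist_eq_norm, add_sub_cancel_left, norm_smul, Real.norm_of_nonneg (by positivity),
      ← dist_eq_norm]
    nlinarith
  have h1 : ∫⁻ x in closedBall q (σ * H / 4), ‖a x‖ₑ ≤ ∫⁻ x in ball p (σ * H), ‖a x‖ₑ := by
    refine lintegral_mono_set fun x hx => ?_
    rw [Metric.mem_closedBall] at hx
    rw [Metric.mem_ball]
    linarith [dist_triangle x q p]
  have h2 : ∫⁻ x in closedBall p (σ * H / 4), ‖a x‖ₑ ≤ ∫⁻ x in ball p (σ * H), ‖a x‖ₑ :=
    lintegral_mono_set (Metric.closedBall_subset_ball (by linarith))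
  have h3 := (enorm_affine_mul_volume_le a q (σ * H / 4)).trans h1
  have h4 := (enorm_affine_mul_volume_le a p (σ * H / 4)).trans h2
  set I := ∫⁻ x in ball p (σ * H), ‖a x‖ₑ
  set V := volume (closedBall (0 : E d) (σ * H / 4))
  have h5 : ‖a v‖ₑ ≤ ‖a p‖ₑ + ENNReal.ofReal (4 / σ) * (‖a q‖ₑ + ‖a p‖ₑ) := by
    rw [hav]
    refine (enorm_add_le _ _).trans ?_
    rw [enorm_mul, Real.enorm_of_nonneg (by positivity : 0 ≤ 4 / σ)]
    gcongr
    exact enorm_sub_le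
  calc ‖a v‖ₑ * V ≤ (‖a p‖ₑ + ENNReal.ofReal (4 / σ) * (‖a q‖ₑ + ‖a p‖ₑ)) * V := by gcongr
    _ = ‖a p‖ₑ * V + ENNReal.ofReal (4 / σ) * (‖a q‖ₑ * V + ‖a p‖ₑ * V) := by ring
    _ ≤ I + ENNReal.ofReal (4 / σ) * (I + I) := by gcongr
    _ = ENNReal.ofReal (1 + 8 / σ) * I := by
      rw [ENNReal.ofReal_add (by norm_num) (by positivity), show 8 / σ = 4 / σ + 4 / σ by ring,
        ENNReal.ofReal_add (by positivity) (by positivity), ENNReal.ofReal_one]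
      ring

namespace Mesh

theorem measurableSet_patch (M : Mesh Ω) (hΩ : IsOpen Ω) (v : E d) (k : ℕ) :
    MeasurableSet (M.patch v k) := by
  cases k with
  | zero => exact (M.isClosed_biUnion fun _ hs => hs.1).measurableSet.inter hΩ.measurableSet
  | succ k => exact isOpen_interior.measurableSet.inter hΩ.measurableSet

variable {M : Mesh Ω}

theorem exists_element_of_mem_intNodes (hΩ : IsOpen Ω) {v : E d} (hv : v ∈ M.intNodes) :
    ∃ s ∈ M.elements, v ∈ s := by
  obtain ⟨h1, h2⟩ := mem_intNodes.1 hv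
  obtain ⟨s, hs, hvs⟩ := M.exists_element hΩ (subset_closure h2)
  exact ⟨s, hs, M.mem_of_hat_ne_zero hs.1 hvs (by rw [M.hat_self h1]; norm_num)⟩

/-- On an element at v the function is affine, so its value at v is controlled by its unweighted
mean on an inscribed ball. Weighted Cauchy-Schwarz brings in the integral of the dual weight, and A₂
on the ball of radius 2H about v removes it. -/
theorem exists_enorm_sq_mul_le (hc : 0 < c) (hℓ : ℓ < d)
    (hβ : β ∈ Ioo (-(((d : ℝ) - ℓ) / 2)) (((d : ℝ) - ℓ) / 2)) (hΩ : IsLipschitzDomain Ω) {σ : ℝ}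
    (hσ : 0 < σ) :
    ∃ C : ℝ≥0, ∀ Λ : Set (E d), IsRegularSet ℓ c Λ → ∀ (M : Mesh Ω) (H : ℝ), M.HasSize H σ →
      ∀ v ∈ M.intNodes, ∀ g ∈ M.VH,
      ‖g v‖ₑ ^ 2 * (∫⁻ x in closedBall v (2 * H), weight Λ β x) ≤
        C * ∫⁻ x in M.patch v 0, ‖g x‖ₑ ^ 2 ∂(wMeasure Ω Λ β) := by
  obtain ⟨C, hC⟩ := exists_lintegral_weight_mul_le (d := d) hc hℓ hβ
  set V := volume (closedBall (0 : E d) 1) with hV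
  have hVt : V ≠ ⊤ := measure_closedBall_lt_top.ne
  have hV0 : V ≠ 0 := (Metric.measure_closedBall_pos _ _ one_pos).ne'
  set D : ℝ≥0∞ := ENNReal.ofReal ((σ / 4) ^ d) * V with hD
  have hD0 : D ^ 2 ≠ 0 := by
    refine pow_ne_zero _ (mul_ne_zero ?_ hV0)
    rw [Ne, ENNReal.ofReal_eq_zero, not_le]
    positivity
  have hDt : D ^ 2 ≠ ⊤ := ENNReal.pow_ne_top (ENNReal.mul_ne_top ENNReal.ofReal_ne_top hVt)
  set B : ℝ≥0∞ := ENNReal.ofReal (1 + 8 / σ) ^ 2 * C * ENNReal.ofReal (2 ^ d) ^ 2 with hB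
  have hBt : B ≠ ⊤ := ENNReal.mul_ne_top (ENNReal.mul_ne_top (ENNReal.pow_ne_top
    ENNReal.ofReal_ne_top) ENNReal.coe_ne_top) (ENNReal.pow_ne_top ENNReal.ofReal_ne_top)
  refine ⟨(B / D ^ 2).toNNReal, fun Λ hΛ M H hs v hv g hg => ?_⟩
  rw [ENNReal.coe_toNNReal (ENNReal.div_ne_top hBt hD0)]
  have hH := hs.pos
  have hae : ∀ᵐ x, weight Λ β x * weight Λ (-β) x = 1 :=
    (ae_notMem hc hℓ hΛ).mono fun x hx => hΛ.weight_mul_weight_neg β hx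
  obtain ⟨s, hse, hvs⟩ := exists_element_of_mem_intNodes hΩ.isOpen hv
  have hvT : v ∈ convexHull ℝ (s : Set (E d)) := subset_convexHull ℝ _ hvs
  obtain ⟨a, ha⟩ := hg.2.2 s hse
  obtain ⟨p, hp⟩ := hs.exists_ball s hse
  have hbT : ball p (σ * H) ⊆ convexHull ℝ (s : Set (E d)) := Metric.ball_subset_closedBall.trans hp
  have hpT : p ∈ convexHull ℝ (s : Set (E d)) :=
    hbT (Metric.mem_ball_self (mul_pos hs.pos' hs.pos))
  have hbω : ball p (σ * H) ⊆ M.patch v 0 := fun x hx =>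
    ⟨mem_biUnion (show s ∈ {s | s ∈ M.elements ∧ v ∈ s} from ⟨hse, hvs⟩) (hbT hx),
      interior_subset_domain hΩ hse (interior_maximal hbT Metric.isOpen_ball hx)⟩
  have hbK : ball p (σ * H) ⊆ closedBall v (2 * H) := fun x hx => by
    have := hs.dist_le s hse x (hbT hx) v hvT
    rw [Metric.mem_closedBall]
    linarith
  have hma : Measurable fun x => ‖a x‖ₑ := a.continuous_of_finiteDimensional.measurable.enorm
  have h1 := enorm_affine_mul_volume_le_ball a hσ hH (hs.dist_le s hse v hvT p hpT)
  rw [← ha hvT] at h1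
  set K := ∫⁻ x in closedBall v (2 * H), weight Λ β x
  set K' := ∫⁻ x in closedBall v (2 * H), weight Λ (-β) x
  set h := ENNReal.ofReal (H ^ d) with hh
  have hh0 : h ^ 2 ≠ 0 := by
    refine pow_ne_zero _ ?_
    rw [Ne, ENNReal.ofReal_eq_zero, not_le]
    positivity
  have hht : h ^ 2 ≠ ⊤ := ENNReal.pow_ne_top ENNReal.ofReal_ne_top
  have hvol : volume (closedBall (0 : E d) (σ * H / 4)) = D * h := by
    rw [volume_closedBall_eq _ (by positivity), hD, hh, show σ * H / 4 = σ / 4 * H by ring, mul_pow,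
      ENNReal.ofReal_mul (by positivity)]
    ring
  have h2 := sq_lintegral_le_mul (volume.restrict (ball p (σ * H))) hma.aemeasurable
    (measurable_weight Λ β).aemeasurable (measurable_weight Λ (-β)).aemeasurable
    (ae_restrict_of_ae hae)
  have h3 : ∫⁻ x in ball p (σ * H), weight Λ β x * ‖a x‖ₑ ^ 2 ≤
      ∫⁻ x in M.patch v 0, ‖g x‖ₑ ^ 2 ∂(wMeasure Ω Λ β) := by
    rw [setLIntegral_wMeasure (M.measurableSet_patch hΩ.isOpen v 0),
      inter_eq_self_of_subset_left (patch_subset_domain v 0)]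
    refine le_trans (le_of_eq (setLIntegral_congr_fun Metric.isOpen_ball.measurableSet
      fun x hx => ?_)) (lintegral_mono_set hbω)
    rw [ha (hbT hx)]
  set X := ∫⁻ x in M.patch v 0, ‖g x‖ₑ ^ 2 ∂(wMeasure Ω Λ β)
  have h4 : (∫⁻ x in ball p (σ * H), ‖a x‖ₑ) ^ 2 ≤ X * K' :=
    h2.trans (mul_le_mul' h3 (lintegral_mono_set hbK))
  have h5 : ‖g v‖ₑ ^ 2 * K * D ^ 2 * h ^ 2 ≤ B * X * h ^ 2 := by
    calc ‖g v‖ₑ ^ 2 * K * D ^ 2 * h ^ 2 = (‖g v‖ₑ * (D * h)) ^ 2 * K := by ring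
      _ ≤ (ENNReal.ofReal (1 + 8 / σ) * ∫⁻ x in ball p (σ * H), ‖a x‖ₑ) ^ 2 * K := by
        rw [← hvol]; gcongr
      _ ≤ ENNReal.ofReal (1 + 8 / σ) ^ 2 * (X * K') * K := by
        rw [mul_pow]; gcongr
      _ = ENNReal.ofReal (1 + 8 / σ) ^ 2 * X * (K * K') := by ring
      _ ≤ ENNReal.ofReal (1 + 8 / σ) ^ 2 * X * (C * ENNReal.ofReal ((2 * H) ^ d) ^ 2) := by
        exact mul_le_mul' le_rfl (hC Λ hΛ v (2 * H) (by positivity))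
      _ = B * X * h ^ 2 := by
        rw [mul_pow 2 H d, ENNReal.ofReal_mul (by positivity), hB]
        ring
  rw [ENNReal.mul_le_mul_iff_left hh0 hht] at h5
  rw [← ENNReal.mul_div_right_comm, ENNReal.le_div_iff_mul_le (Or.inl hD0) (Or.inl hDt)]
  exact h5

section Projection

variable {H σ : ℝ}

theorem HasSize.memLp_VH (h : AdmissibleWeight Ω Λ β) (hs : M.HasSize H σ)
    (hΩ : IsLipschitzDomain Ω) {g : E d → ℝ} (hg : g ∈ M.VH) : MemLp g 2 (wMeasure Ω Λ β) := by
  have hfin := h.isFiniteMeasure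
  refine MemLp.of_bound hg.1.aestronglyMeasurable _
    (Eventually.of_forall (hs.abs_le_sum hΩ hg))

theorem HasSize.exists_restrict_VH (h : AdmissibleWeight Ω Λ β) (hs : M.HasSize H σ)
    (hΩ : IsLipschitzDomain Ω) (S : Set (E d)) :
    ∃ R : M.VH →ₗ[ℝ] Lp ℝ 2 ((wMeasure Ω Λ β).restrict S),
      ∀ g : M.VH, R g =ᵐ[(wMeasure Ω Λ β).restrict S] (g : E d → ℝ) :=
  ⟨{ toFun := fun g => ((HasSize.memLp_VH h hs hΩ g.2).restrict S).toLp
     map_add' := fun _ _ => rfl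
     map_smul' := fun _ _ => rfl }, fun g => ((HasSize.memLp_VH h hs hΩ g.2).restrict S).coeFn_toLp⟩

theorem inner_eq_setIntegral {S : Set (E d)} {f g : Lp ℝ 2 ((wMeasure Ω Λ β).restrict S)}
    {f' g' : E d → ℝ} (hf : f =ᵐ[(wMeasure Ω Λ β).restrict S] f')
    (hg : g =ᵐ[(wMeasure Ω Λ β).restrict S] g') :
    inner ℝ f g = ∫ x in S, f' x * g' x ∂(wMeasure Ω Λ β) := by
  rw [L2.inner_def]
  refine integral_congr_ae ?_
  filter_upwards [hf, hg] with x h1 h2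
  simp [h1, h2, mul_comm]

/-- Orthogonal projection onto the finite-dimensional range of the restriction to the patch,
followed by a linear right inverse of the restriction. The default value 0 in `localProj` is thus
not taken here. -/
theorem HasSize.isLocalProj_localProj (h : AdmissibleWeight Ω Λ β) (hs : M.HasSize H σ)
    (hΩ : IsLipschitzDomain Ω) (v : E d) :
    M.IsLocalProj Λ β v (M.localProj Λ β v) := by
  suffices hex : ∃ P, M.IsLocalProj Λ β v P by
    rw [localProj, dif_pos hex]
    exact hex.choose_spec
  obtain ⟨R, hR⟩ := HasSize.exists_restrict_VH h hs hΩ (Λ := Λ) (β := β) (M.patch v 0)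
  have hfd := hs.finiteDimensional_VH hΩ
  obtain ⟨S, hS⟩ := R.rangeRestrict.exists_rightInverse_of_surjective R.range_rangeRestrict
  set Q := LpToLpRestrictCLM (E d) ℝ ℝ (wMeasure Ω Λ β) 2 (M.patch v 0)
  refine ⟨S ∘ₗ (LinearMap.range R).orthogonalProjectionOnto.toLinearMap ∘ₗ Q.toLinearMap,
    fun u g => ?_⟩
  have hRS : ∀ y : LinearMap.range R, R (S y) = y := fun y =>
    congrArg Subtype.val (LinearMap.congr_fun hS y)
  rw [← inner_eq_setIntegral (hR _) (hR g), ← inner_eq_setIntegral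
    (LpToLpRestrictCLM_coeFn ℝ (M.patch v 0) u) (hR g)]
  simp only [LinearMap.comp_apply, hRS]
  exact Submodule.inner_orthogonalProjectionOnto_eq_of_mem_right (K := LinearMap.range R)
    ⟨R g, LinearMap.mem_range_self R g⟩ (Q u)

/-- The local projection is the best approximation. -/
theorem HasSize.lintegral_localProj_sub_le (h : AdmissibleWeight Ω Λ β) (hs : M.HasSize H σ)
    (hΩ : IsLipschitzDomain Ω) (v : E d) (u : L2 Ω Λ β) (g : M.VH) :
    ∫⁻ x in M.patch v 0, ‖(M.localProj Λ β v u : E d → ℝ) x - (g : E d → ℝ) x‖ₑ ^ 2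
        ∂(wMeasure Ω Λ β) ≤
      ∫⁻ x in M.patch v 0, ‖u x - (g : E d → ℝ) x‖ₑ ^ 2 ∂(wMeasure Ω Λ β) := by
  obtain ⟨R, hR⟩ := HasSize.exists_restrict_VH h hs hΩ (Λ := Λ) (β := β) (M.patch v 0)
  set Q := LpToLpRestrictCLM (E d) ℝ ℝ (wMeasure Ω Λ β) 2 (M.patch v 0)
  have hQ : Q u =ᵐ[(wMeasure Ω Λ β).restrict (M.patch v 0)] u := LpToLpRestrictCLM_coeFn ℝ _ u
  set P := M.localProj Λ β v u
  have horth : ∀ g' : M.VH, inner ℝ (Q u - R P) (R g') = 0 := fun g' => by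
    rw [inner_sub_left, inner_eq_setIntegral hQ (hR g'),
      inner_eq_setIntegral (hR P) (hR g'), HasSize.isLocalProj_localProj h hs hΩ v u g', sub_self]
  have h1 : ‖R P - R g‖ ≤ ‖Q u - R g‖ := by
    have h2 : inner ℝ (Q u - R P) (R P - R g) = 0 := by
      rw [← map_sub]; exact horth _
    have h3 := norm_add_sq_eq_norm_sq_add_norm_sq_of_inner_eq_zero _ _ h2
    rw [sub_add_sub_cancel] at h3
    nlinarith [norm_nonneg (Q u - R g), norm_nonneg (R P - R g), norm_nonneg (Q u - R P)]
  have h4 : ‖R P - R g‖ₑ ^ 2 ≤ ‖Q u - R g‖ₑ ^ 2 := by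
    gcongr
    rw [← ofReal_norm, ← ofReal_norm]
    exact ENNReal.ofReal_le_ofReal h1
  rw [enorm_sq_eq_lintegral, enorm_sq_eq_lintegral] at h4
  convert h4 using 1
  · refine lintegral_congr_ae ?_
    filter_upwards [Lp.coeFn_sub (R P) (R g), hR P, hR g] with x e1 e2 e3
    rw [e1, Pi.sub_apply, e2, e3]
  · refine lintegral_congr_ae ?_
    filter_upwards [Lp.coeFn_sub (Q u) (R g), hQ, hR g] with x e1 e2 e3
    rw [e1, Pi.sub_apply, e2, e3]

end Projection

/-- P_v u - g lies in V_H, so its nodal value is bounded by its norm on the patch, where best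
approximation replaces P_v u by u. The case g = 0 is stability; the case u = g on the patch is
reproduction. -/
theorem exists_enorm_localProj_sub_le (hc : 0 < c) (hℓ : ℓ < d)
    (hβ : β ∈ Ioo (-(((d : ℝ) - ℓ) / 2)) (((d : ℝ) - ℓ) / 2)) (hΩ : IsLipschitzDomain Ω) {σ : ℝ}
    (hσ : 0 < σ) :
    ∃ C : ℝ≥0, ∀ Λ : Set (E d), IsRegularSet ℓ c Λ → ∀ (M : Mesh Ω) (H : ℝ), M.HasSize H σ →
      ∀ v ∈ M.intNodes, ∀ u : L2 Ω Λ β, ∀ g ∈ M.VH,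
      ‖(M.localProj Λ β v u : E d → ℝ) v - g v‖ₑ ^ 2 *
          (∫⁻ x in closedBall v (2 * H), weight Λ β x) ≤
        C * ∫⁻ x in M.patch v 0, ‖u x - g x‖ₑ ^ 2 ∂(wMeasure Ω Λ β) := by
  obtain ⟨C, hC⟩ := exists_enorm_sq_mul_le hc hℓ hβ hΩ hσ
  refine ⟨C, fun Λ hΛ M H hs v hv u g hg => ?_⟩
  have h := hΩ.admissibleWeight hc hℓ hβ hΛ
  refine (hC Λ hΛ M H hs v hv _ (M.VH.sub_mem (M.localProj Λ β v u).2 hg)).trans ?_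
  exact mul_le_mul' le_rfl (HasSize.lintegral_localProj_sub_le h hs hΩ v u ⟨g, hg⟩)

theorem quasiInterp_apply (u : L2 Ω Λ β) (x : E d) : M.quasiInterp Λ β u x =
    ∑ v ∈ M.intNodes, (M.localProj Λ β v u : E d → ℝ) v * M.hat v x := rfl

theorem quasiInterp_apply_node (u : L2 Ω Λ β) {v : E d} (hv : v ∈ M.intNodes) :
    M.quasiInterp Λ β u v = (M.localProj Λ β v u : E d → ℝ) v := by
  rw [quasiInterp_apply, Finset.sum_eq_single_of_mem v hv, M.hat_self (mem_intNodes.1 hv).1, mul_one]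
  intro w _ hwv
  rw [M.hat_of_ne (mem_intNodes.1 hv).1 hwv, mul_zero]

theorem HasSize.quasiInterp_mem_VH {H σ : ℝ} (hs : M.HasSize H σ) (hΩ : IsLipschitzDomain Ω)
    (u : L2 Ω Λ β) : M.quasiInterp Λ β u ∈ M.VH := by
  have : M.quasiInterp Λ β u =
      ∑ v ∈ M.intNodes, (M.localProj Λ β v u : E d → ℝ) v • M.hat v := by
    funext x
    simp [quasiInterp_apply]
  rw [this]
  exact M.VH.sum_mem fun v hv => M.VH.smul_mem _ (hs.hat_mem_VH hΩ hv)

end Mesh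

end LocalProjection

/-! ### The local estimate for fine-scale functions -/

section LocalEstimate

variable {d ℓ : ℕ} {c : ℝ} {Ω Λ : Set (E d)} {β : ℝ}

theorem enorm_add_sq_le {F : Type*} [SeminormedAddCommGroup F] (x y : F) :
    ‖x + y‖ₑ ^ 2 ≤ 2 * (‖x‖ₑ ^ 2 + ‖y‖ₑ ^ 2) := by
  have h : ‖x + y‖₊ ^ 2 ≤ 2 * (‖x‖₊ ^ 2 + ‖y‖₊ ^ 2) := by
    rw [← NNReal.coe_le_coe]
    push_cast
    nlinarith [norm_add_le x y, norm_nonneg (x + y), sq_nonneg (‖x‖ - ‖y‖), norm_nonneg x,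
      norm_nonneg y]
  simp only [enorm]
  exact_mod_cast h

/-- Local estimates become closed conditions, so that they extend from test functions to H¹_{0,β}.
-/
theorem continuous_setLIntegral_enorm_sq {X F : Type*} [TopologicalSpace X] [MeasurableSpace X]
    [NormedAddCommGroup F] [NormedSpace ℝ F] (μ : Measure X) (S : Set X) :
    Continuous fun f : Lp F 2 μ => ∫⁻ x in S, ‖f x‖ₑ ^ 2 ∂μ := by
  have h : ∀ f : Lp F 2 μ, ∫⁻ x in S, ‖f x‖ₑ ^ 2 ∂μ = ‖LpToLpRestrictCLM X F ℝ μ 2 S f‖ₑ ^ 2 :=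
    fun f => by
      rw [enorm_sq_eq_lintegral]
      refine lintegral_congr_ae ?_
      filter_upwards [LpToLpRestrictCLM_coeFn ℝ S f] with x hx
      rw [hx]
  simp only [h]
  exact (ENNReal.continuous_pow 2).comp
    (continuous_enorm.comp (LpToLpRestrictCLM X F ℝ μ 2 S).continuous)

theorem setLIntegral_wMeasure_of_support {S : Set (E d)} (hS : MeasurableSet S)
    (hΩ : MeasurableSet Ω) {f : E d → ℝ≥0∞} (hf : ∀ x, x ∉ Ω → f x = 0) :
    ∫⁻ x in S, f x ∂(wMeasure Ω Λ β) = ∫⁻ x in S, weight Λ β x * f x := by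
  rw [setLIntegral_wMeasure hS, inter_comm, ← setLIntegral_indicator hΩ]
  congr 1
  funext x
  by_cases hx : x ∈ Ω
  · rw [indicator_of_mem hx]
  · rw [indicator_of_notMem hx, hf x hx, mul_zero]

theorem setLIntegral_enorm_sq_of_testPair {F : Type*} [NormedAddCommGroup F] {S : Set (E d)}
    (hS : MeasurableSet S) (hΩ : MeasurableSet Ω) {f : Lp F 2 (wMeasure Ω Λ β)} {φ : E d → F}
    (hf : f =ᵐ[wMeasure Ω Λ β] φ) (hφ : ∀ x, x ∉ Ω → φ x = 0) :
    ∫⁻ x in S, ‖f x‖ₑ ^ 2 ∂(wMeasure Ω Λ β) = ∫⁻ x in S, weight Λ β x * ‖φ x‖ₑ ^ 2 := by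
  rw [← setLIntegral_wMeasure_of_support hS hΩ fun x hx => by simp [hφ x hx]]
  refine lintegral_congr_ae (ae_restrict_of_ae ?_)
  filter_upwards [hf] with x hx
  rw [hx]

/-- The ball of radius 5H about y contains the ball of radius H about the boundary point z. A fixed
share of the latter, uniform for H ≤ R₀, lies off Ω, where test functions vanish. -/
theorem exists_friedrichs_boundary (hc : 0 < c) (hℓ : ℓ < d)
    (hβ : β ∈ Ioo (-(((d : ℝ) - ℓ) / 2)) (((d : ℝ) - ℓ) / 2)) (hΩ : IsLipschitzDomain Ω) {R₀ : ℝ}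
    (hR : 0 < R₀) :
    ∃ D : ℝ≥0, ∀ Λ : Set (E d), IsRegularSet ℓ c Λ → ∀ H, 0 < H → H ≤ R₀ →
      ∀ y, ∀ z ∈ frontier Ω, dist y z ≤ 4 * H → ∀ p ∈ H10 Ω Λ β,
      ∫⁻ x in closedBall y H, ‖p.1 x‖ₑ ^ 2 ∂(wMeasure Ω Λ β) ≤
        D * (ENNReal.ofReal H ^ 2 *
          ∫⁻ x in closedBall y (5 * H), ‖p.2 x‖ₑ ^ 2 ∂(wMeasure Ω Λ β)) := by
  obtain ⟨δ, hδ, hvol⟩ := hΩ.exists_volume_diff_ge hR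
  obtain ⟨C, hC⟩ := exists_friedrichs_ball (d := d) hc hℓ hβ (δ := δ / 5 ^ d) (by positivity)
  refine ⟨C * 25, fun Λ hΛ H hH hHR y z hz hyz p hp => ?_⟩
  have h := hΩ.admissibleWeight hc hℓ hβ hΛ
  rw [h.mem_H10_iff] at hp
  refine closure_minimal (t := {p : L2 Ω Λ β × L2Vec Ω Λ β |
    ∫⁻ x in closedBall y H, ‖p.1 x‖ₑ ^ 2 ∂(wMeasure Ω Λ β) ≤ (C * 25 : ℝ≥0) *
      (ENNReal.ofReal H ^ 2 * ∫⁻ x in closedBall y (5 * H), ‖p.2 x‖ₑ ^ 2 ∂(wMeasure Ω Λ β))})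
    ?_ ?_ hp
  · rintro q ⟨φ, hφ, hφc, hφs, e1, e2⟩
    have hφ0 : ∀ x, x ∉ Ω → φ x = 0 := fun x hx =>
      image_eq_zero_of_notMem_tsupport fun h1 => hx (hφs h1)
    have hg0 : ∀ x, x ∉ Ω → gradient φ x = 0 := fun x hx =>
      image_eq_zero_of_notMem_tsupport fun h1 => hx (hφs (tsupport_gradient_subset φ h1))
    rw [mem_ofPred_eq]
    rw [setLIntegral_enorm_sq_of_testPair Metric.isClosed_closedBall.measurableSet
        hΩ.isOpen.measurableSet e1 hφ0,
      setLIntegral_enorm_sq_of_testPair Metric.isClosed_closedBall.measurableSet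
        hΩ.isOpen.measurableSet e2 hg0]
    refine (lintegral_mono_set (Metric.closedBall_subset_closedBall (by linarith : H ≤ 5 * H))).trans
      ((hC Λ hΛ y (5 * H) (by positivity) (closedBall z H \ Ω) ?_ ?_ φ hφ
        fun x hx => hφ0 x hx.2).trans (le_of_eq ?_))
    · intro x hx
      have := Metric.mem_closedBall.1 hx.1
      rw [Metric.mem_closedBall]
      linarith [dist_triangle x z y, dist_comm y z]
    · refine le_trans (le_of_eq ?_) (hvol z hz H hH hHR)
      congr 1
      rw [mul_pow]
      field_simp
    · rw [ENNReal.ofReal_mul (by norm_num), ENNReal.ofReal_ofNat]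
      push_cast
      ring
  · refine isClosed_le ((continuous_setLIntegral_enorm_sq _ _).comp continuous_fst) ?_
    refine ENNReal.continuous_const_mul ENNReal.coe_ne_top |>.comp
      (ENNReal.continuous_const_mul (ENNReal.pow_ne_top ENNReal.ofReal_ne_top) |>.comp
        ((continuous_setLIntegral_enorm_sq _ _).comp continuous_snd))

theorem AdmissibleWeight.lintegral_closedBall_ne_zero (h : AdmissibleWeight Ω Λ β) (x : E d)
    {r : ℝ} (hr : 0 < r) : ∫⁻ y in closedBall x r, weight Λ β y ≠ 0 := by
  rw [Ne, lintegral_eq_zero_iff (measurable_weight Λ β)]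
  intro h3
  have : ∀ᵐ y ∂(volume.restrict (closedBall x r)), False := by
    filter_upwards [ae_restrict_of_ae h.ae_mul_eq_one, h3] with y h4 h5
    simp [h5] at h4
  rw [eventually_false_iff_eq_bot, ae_eq_bot, Measure.restrict_eq_zero] at this
  exact (Metric.measure_closedBall_pos volume _ hr).ne' this

namespace Mesh

variable {M : Mesh Ω}

/-- When all vertices of the elements at v are interior, the interior nodal functions form a full
partition of unity on the patch. -/
theorem HasSize.exists_mem_VH_eq_one {H σ : ℝ} (hs : M.HasSize H σ) (hΩ : IsLipschitzDomain Ω)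
    {v : E d} (hsub : ∀ s ∈ M.elements, v ∈ s → ∀ w ∈ s, w ∈ Ω) :
    ∃ g ∈ M.VH, ∀ x ∈ M.patch v 0, g x = 1 := by
  refine ⟨∑ w ∈ M.intNodes, M.hat w, M.VH.sum_mem fun w hw => hs.hat_mem_VH hΩ hw, ?_⟩
  rintro x ⟨hx, -⟩
  simp only [mem_iUnion, mem_ofPred_eq, exists_prop] at hx
  obtain ⟨s, ⟨hse, hvs⟩, hxs⟩ := hx
  have hw := M.isWeight_hat hse.1 hxs
  rw [Finset.sum_apply, ← hw.sum_eq]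
  refine (Finset.sum_subset (fun w hws => ?_) fun w _ hws => hw.eq_zero w hws).symm
  exact mem_intNodes.2 ⟨mem_vertices_of_mem hse.1 hws, hsub s hse hvs w hws⟩

/-- Let m be the constant in Poincaré's inequality on the ball of radius 4H and t the value of the
projection at v. The constant m is a coarse function on the patch, so t - m is controlled by the
norm of φ - m, and m by this and t. For fine-scale functions the term with t disappears. -/
theorem exists_local_poincare (hc : 0 < c) (hℓ : ℓ < d)
    (hβ : β ∈ Ioo (-(((d : ℝ) - ℓ) / 2)) (((d : ℝ) - ℓ) / 2)) (hΩ : IsLipschitzDomain Ω) {σ : ℝ}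
    (hσ : 0 < σ) :
    ∃ D : ℝ≥0, ∀ Λ : Set (E d), IsRegularSet ℓ c Λ → ∀ (M : Mesh Ω) (H : ℝ), M.HasSize H σ →
      ∀ y, closedBall y (4 * H) ⊆ Ω → ∀ v ∈ M.intNodes, dist v y ≤ H → ∀ p ∈ H10 Ω Λ β,
      ∫⁻ x in closedBall y H, ‖p.1 x‖ₑ ^ 2 ∂(wMeasure Ω Λ β) ≤
        D * (ENNReal.ofReal H ^ 2 *
          (∫⁻ x in closedBall y (4 * H), ‖p.2 x‖ₑ ^ 2 ∂(wMeasure Ω Λ β)) +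
          ‖(M.localProj Λ β v p.1 : E d → ℝ) v‖ₑ ^ 2 *
            ∫⁻ x in closedBall v (2 * H), weight Λ β x) := by
  obtain ⟨C₁, hC₁⟩ := exists_poincare_ball (d := d) hc hℓ hβ
  obtain ⟨C₂, hC₂⟩ := exists_enorm_localProj_sub_le (d := d) hc hℓ hβ hΩ hσ
  refine ⟨64 * (1 + C₂) * C₁ + 4, fun Λ hΛ M H hs y hy v hv hvy p hp => ?_⟩
  have h := hΩ.admissibleWeight hc hℓ hβ hΛ
  have hH := hs.pos
  rw [h.mem_H10_iff] at hp
  set K := ∫⁻ x in closedBall v (2 * H), weight Λ β x with hK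
  have hK0 : K ≠ 0 := h.lintegral_closedBall_ne_zero v (by positivity)
  have hBK : closedBall y H ⊆ closedBall v (2 * H) := fun x hx => by
    rw [Metric.mem_closedBall] at hx ⊢
    linarith [dist_triangle x y v, dist_comm y v]
  have hvK : closedBall v (2 * H) ⊆ closedBall y (4 * H) := fun x hx => by
    rw [Metric.mem_closedBall] at hx ⊢
    linarith [dist_triangle x v y]
  have hKt : K ≠ ⊤ := ne_top_of_le_ne_top h.lintegral_ne_top
    (lintegral_mono_set (hvK.trans hy))
  obtain ⟨g, hg, hg1⟩ := hs.exists_mem_VH_eq_one hΩ (v := v) fun s hse hvs w hws => hy (by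
    have := hs.dist_le s hse w (subset_convexHull ℝ _ hws) v (subset_convexHull ℝ _ hvs)
    rw [Metric.mem_closedBall]
    linarith [dist_triangle w v y])
  have hgv : g v = 1 := hg1 v (mem_patch_zero hΩ hv)
  have hω : M.patch v 0 ⊆ closedBall y (4 * H) := fun x hx => by
    have := hs.patch_subset_closedBall v 0 hx
    rw [Metric.mem_closedBall] at this ⊢
    push_cast at this
    linarith [dist_triangle x v y]
  refine closure_minimal (t := {p : L2 Ω Λ β × L2Vec Ω Λ β |
    ∫⁻ x in closedBall y H, ‖p.1 x‖ₑ ^ 2 ∂(wMeasure Ω Λ β) ≤ (64 * (1 + C₂) * C₁ + 4 : ℝ≥0) *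
      (ENNReal.ofReal H ^ 2 * (∫⁻ x in closedBall y (4 * H), ‖p.2 x‖ₑ ^ 2 ∂(wMeasure Ω Λ β)) +
        ‖(M.localProj Λ β v p.1 : E d → ℝ) v‖ₑ ^ 2 * K)})
    ?_ ?_ hp
  · rintro q ⟨φ, hφ, hφc, hφs, e1, e2⟩
    have hφ0 : ∀ x, x ∉ Ω → φ x = 0 := fun x hx =>
      image_eq_zero_of_notMem_tsupport fun h1 => hx (hφs h1)
    have hg0 : ∀ x, x ∉ Ω → gradient φ x = 0 := fun x hx =>
      image_eq_zero_of_notMem_tsupport fun h1 => hx (hφs (tsupport_gradient_subset φ h1))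
    rw [mem_ofPred_eq]
    obtain ⟨m, hm⟩ := hC₁ Λ hΛ y (4 * H) (by positivity) φ hφ
    have h1 := hC₂ Λ hΛ M H hs v hv q.1 (m • g) (M.VH.smul_mem m hg)
    rw [Pi.smul_apply, hgv, smul_eq_mul, mul_one] at h1
    set t := (M.localProj Λ β v q.1 : E d → ℝ) v
    set I := ∫⁻ x in closedBall y (4 * H), weight Λ β x * ‖φ x - m‖ₑ ^ 2
    set G := ∫⁻ x in closedBall y (4 * H), weight Λ β x * ‖gradient φ x‖ₑ ^ 2 with hG
    have h2 : ∫⁻ x in M.patch v 0, ‖q.1 x - (m • g) x‖ₑ ^ 2 ∂(wMeasure Ω Λ β) ≤ I := by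
      have hmeas := M.measurableSet_patch hΩ.isOpen v 0
      have : ∫⁻ x in M.patch v 0, ‖q.1 x - (m • g) x‖ₑ ^ 2 ∂(wMeasure Ω Λ β) =
          ∫⁻ x in M.patch v 0, ‖φ x - m‖ₑ ^ 2 ∂(wMeasure Ω Λ β) := by
        refine lintegral_congr_ae ?_
        filter_upwards [ae_restrict_of_ae e1, ae_restrict_mem hmeas] with x hx hxω
        rw [hx, Pi.smul_apply, hg1 x hxω, smul_eq_mul, mul_one]
      rw [this, setLIntegral_wMeasure hmeas, inter_eq_self_of_subset_left (patch_subset_domain v 0)]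
      exact lintegral_mono_set hω
    rw [setLIntegral_enorm_sq_of_testPair Metric.isClosed_closedBall.measurableSet
        hΩ.isOpen.measurableSet e1 hφ0,
      setLIntegral_enorm_sq_of_testPair Metric.isClosed_closedBall.measurableSet
        hΩ.isOpen.measurableSet e2 hg0, ← hG]
    have h3 : ∀ x, ‖φ x‖ₑ ^ 2 ≤ 2 * ‖φ x - m‖ₑ ^ 2 + 4 * (‖t - m‖ₑ ^ 2 + ‖t‖ₑ ^ 2) := fun x => by
      have a1 := enorm_add_sq_le (φ x - m) m
      have a2 := enorm_add_sq_le (m - t) t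
      rw [sub_add_cancel] at a1 a2
      rw [enorm_sub_rev] at a2
      calc ‖φ x‖ₑ ^ 2 ≤ 2 * (‖φ x - m‖ₑ ^ 2 + ‖m‖ₑ ^ 2) := a1
        _ ≤ 2 * (‖φ x - m‖ₑ ^ 2 + 2 * (‖t - m‖ₑ ^ 2 + ‖t‖ₑ ^ 2)) := by gcongr
        _ = _ := by ring
    have hmφ : Measurable fun x => weight Λ β x * ‖φ x - m‖ₑ ^ 2 :=
      (measurable_weight Λ β).mul ((hφ.continuous.measurable.sub_const m).enorm.pow_const 2)
    calc ∫⁻ x in closedBall y H, weight Λ β x * ‖φ x‖ₑ ^ 2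
        ≤ ∫⁻ x in closedBall y H, (2 * (weight Λ β x * ‖φ x - m‖ₑ ^ 2) +
            4 * (‖t - m‖ₑ ^ 2 + ‖t‖ₑ ^ 2) * weight Λ β x) := by
          refine lintegral_mono fun x => ?_
          refine (mul_le_mul' le_rfl (h3 x)).trans (le_of_eq (by ring))
      _ = 2 * (∫⁻ x in closedBall y H, weight Λ β x * ‖φ x - m‖ₑ ^ 2) +
            4 * (‖t - m‖ₑ ^ 2 + ‖t‖ₑ ^ 2) * ∫⁻ x in closedBall y H, weight Λ β x := by
          rw [lintegral_add_left (hmφ.const_mul 2), lintegral_const_mul _ hmφ,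
            lintegral_const_mul _ (measurable_weight Λ β)]
      _ ≤ 2 * I + 4 * (‖t - m‖ₑ ^ 2 + ‖t‖ₑ ^ 2) * K := by
          refine add_le_add (mul_le_mul' le_rfl (lintegral_mono_set
            (Metric.closedBall_subset_closedBall (by linarith)))) (mul_le_mul' le_rfl
              (lintegral_mono_set hBK))
      _ = 2 * I + 4 * (‖t - m‖ₑ ^ 2 * K) + 4 * (‖t‖ₑ ^ 2 * K) := by ring
      _ ≤ 2 * I + 4 * (C₂ * I) + 4 * (‖t‖ₑ ^ 2 * K) := by
          refine add_le_add_left (add_le_add_right (mul_le_mul' le_rfl (h1.trans ?_)) _) _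
          exact mul_le_mul' le_rfl h2
      _ ≤ 4 * (1 + C₂) * I + 4 * (‖t‖ₑ ^ 2 * K) := by
          refine add_le_add_left ?_ _
          calc 2 * I + 4 * (C₂ * I) ≤ 4 * I + 4 * (C₂ * I) := by gcongr; norm_num
            _ = _ := by ring
      _ ≤ 4 * (1 + C₂) * (C₁ * ENNReal.ofReal (4 * H) ^ 2 * G) + 4 * (‖t‖ₑ ^ 2 * K) := by
          refine add_le_add_left (mul_le_mul' le_rfl hm) _
      _ = (64 * (1 + C₂) * C₁) * (ENNReal.ofReal H ^ 2 * G) + 4 * (‖t‖ₑ ^ 2 * K) := by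
          rw [ENNReal.ofReal_mul (by norm_num), ENNReal.ofReal_ofNat]
          ring
      _ ≤ (64 * (1 + C₂) * C₁ + 4) * (ENNReal.ofReal H ^ 2 * G) +
            (64 * (1 + C₂) * C₁ + 4) * (‖t‖ₑ ^ 2 * K) :=
          add_le_add (mul_le_mul' le_self_add le_rfl) (mul_le_mul' le_add_self le_rfl)
      _ = _ := by
          push_cast
          ring
  -- The closure argument needs the nodal value of the projection to be continuous, which is
  -- stability, the case g = 0 of the projection estimate.
  · have hcont : Continuous fun u : L2 Ω Λ β => (M.localProj Λ β v u : E d → ℝ) v := by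
      let f : L2 Ω Λ β →ₗ[ℝ] ℝ :=
        { toFun := fun u => (M.localProj Λ β v u : E d → ℝ) v
          map_add' := fun a b => by simp
          map_smul' := fun a b => by simp }
      refine AddMonoidHomClass.continuous_of_bound f (((C₂ : ℝ≥0∞) / K) ^ (1 / 2 : ℝ)).toReal
        fun u => ?_
      have h1 := hC₂ Λ hΛ M H hs v hv u 0 M.VH.zero_mem
      simp only [Pi.zero_apply, sub_zero] at h1
      have h2 : ‖f u‖ₑ ^ 2 ≤ (C₂ : ℝ≥0∞) / K * ‖u‖ₑ ^ 2 := by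
        rw [← ENNReal.mul_div_right_comm, ENNReal.le_div_iff_mul_le (Or.inl hK0) (Or.inl hKt)]
        refine h1.trans (mul_le_mul' le_rfl ?_)
        rw [enorm_sq_eq_lintegral]
        exact setLIntegral_le_lintegral _ _
      have hCK : (C₂ : ℝ≥0∞) / K ≠ ⊤ := ENNReal.div_ne_top ENNReal.coe_ne_top hK0
      have h3 : ‖f u‖ₑ ≤ ((C₂ : ℝ≥0∞) / K) ^ (1 / 2 : ℝ) * ‖u‖ₑ := by
        rw [← ENNReal.pow_le_pow_left_iff (n := 2) (by norm_num), mul_pow]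
        refine h2.trans (le_of_eq ?_)
        rw [← ENNReal.rpow_natCast, ← ENNReal.rpow_natCast (_ ^ _), ← ENNReal.rpow_mul]
        norm_num
      have h4 := ENNReal.toReal_mono (ENNReal.mul_ne_top
        (ENNReal.rpow_ne_top_of_nonneg (by norm_num) hCK) (by simp [enorm])) h3
      rw [ENNReal.toReal_mul] at h4
      simpa using h4
    refine isClosed_le ((continuous_setLIntegral_enorm_sq _ _).comp continuous_fst) ?_
    refine (ENNReal.continuous_const_mul ENNReal.coe_ne_top).comp (Continuous.add ?_ ?_)
    · exact (ENNReal.continuous_const_mul (ENNReal.pow_ne_top ENNReal.ofReal_ne_top)).comp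
        ((continuous_setLIntegral_enorm_sq _ _).comp continuous_snd)
    · exact (ENNReal.continuous_mul_const hKt).comp ((ENNReal.continuous_pow 2).comp
        (continuous_enorm.comp (hcont.comp continuous_fst)))

/-- If ∂Ω comes within 4H of y, Friedrichs' inequality applies. Otherwise, by connectedness, the
ball of radius H misses Ω or the ball of radius 4H lies in Ω. In the latter case a vertex v of an
element containing y is an interior node, and P_v p vanishes at v, being a nodal value of the
quasi-interpolation of p. -/
theorem exists_local_estimate (hc : 0 < c) (hℓ : ℓ < d)
    (hβ : β ∈ Ioo (-(((d : ℝ) - ℓ) / 2)) (((d : ℝ) - ℓ) / 2)) (hΩ : IsLipschitzDomain Ω) {σ R₀ : ℝ}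
    (hσ : 0 < σ) (hR : 0 < R₀) :
    ∃ D : ℝ≥0, ∀ Λ : Set (E d), IsRegularSet ℓ c Λ → ∀ (M : Mesh Ω) (H : ℝ), M.HasSize H σ →
      H ≤ R₀ → ∀ p ∈ M.fineSpace Λ β, ∀ y,
      ∫⁻ x in closedBall y H, ‖p.1 x‖ₑ ^ 2 ∂(wMeasure Ω Λ β) ≤
        D * (ENNReal.ofReal H ^ 2 *
          ∫⁻ x in closedBall y (5 * H), ‖p.2 x‖ₑ ^ 2 ∂(wMeasure Ω Λ β)) := by
  obtain ⟨D₁, hD₁⟩ := exists_friedrichs_boundary (d := d) hc hℓ hβ hΩ hR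
  obtain ⟨D₂, hD₂⟩ := exists_local_poincare (d := d) hc hℓ hβ hΩ hσ
  refine ⟨max D₁ D₂, fun Λ hΛ M H hs hHR p hp y => ?_⟩
  have hH := hs.pos
  obtain ⟨hp1, hp2⟩ := Submodule.mem_inf.1 hp
  by_cases hfr : ∃ z ∈ frontier Ω, dist y z ≤ 4 * H
  · obtain ⟨z, hz, hyz⟩ := hfr
    refine (hD₁ Λ hΛ H hH hHR y z hz hyz p hp1).trans (mul_le_mul' ?_ le_rfl)
    exact_mod_cast le_max_left _ _
  push Not at hfr
  by_cases hemp : closedBall y H ∩ Ω = ∅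
  · rw [setLIntegral_wMeasure Metric.isClosed_closedBall.measurableSet, hemp]
    simp
  have hball : closedBall y (4 * H) ⊆ Ω := by
    obtain ⟨x, hx, hxΩ⟩ := nonempty_iff_ne_empty.2 hemp
    refine (convex_closedBall y _).isPreconnected.subset_of_closure_inter_subset hΩ.isOpen
      ⟨x, Metric.closedBall_subset_closedBall (by linarith) hx, hxΩ⟩ ?_
    rintro z ⟨hz1, hz2⟩
    by_contra hz3
    refine (hfr z (by rw [hΩ.isOpen.frontier_eq]; exact ⟨hz1, hz3⟩)).not_ge ?_
    rw [dist_comm]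
    exact hz2
  have hyΩ : y ∈ Ω := hball (Metric.mem_closedBall_self (by positivity))
  obtain ⟨s, hse, hys⟩ := M.exists_element hΩ.isOpen (subset_closure hyΩ)
  obtain ⟨v, hvs⟩ : s.Nonempty := Finset.card_pos.1 (by rw [hse.2]; omega)
  have hvy := hs.dist_le s hse v (subset_convexHull ℝ _ hvs) y hys
  have hv : v ∈ M.intNodes := mem_intNodes.2 ⟨mem_vertices_of_mem hse.1 hvs,
    hball (Metric.mem_closedBall.2 (by linarith))⟩
  have hzero : (M.localProj Λ β v p.1 : E d → ℝ) v = 0 := by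
    rw [← quasiInterp_apply_node _ hv]
    exact congrFun (LinearMap.mem_ker.1 hp2) v
  have := hD₂ Λ hΛ M H hs y hball v hv hvy p hp1
  rw [hzero, enorm_zero, zero_pow two_ne_zero, zero_mul, add_zero] at this
  refine this.trans (mul_le_mul' (by exact_mod_cast le_max_right _ _) (mul_le_mul' le_rfl ?_))
  exact lintegral_mono_set (Metric.closedBall_subset_closedBall (by linarith))

end Mesh

end LocalEstimate

/-! ### Cutoff functions and the coefficient -/

section Cutoff

variable {d : ℕ}

theorem exists_lipschitzWith_smoothTransition : ∃ B : ℝ≥0, LipschitzWith B Real.smoothTransition := by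
  have hsm : ContDiff ℝ 1 Real.smoothTransition := Real.smoothTransition.contDiff
  have hcont : Continuous (deriv Real.smoothTransition) := hsm.continuous_deriv le_rfl
  obtain ⟨B, hB⟩ := (isCompact_Icc (a := (0 : ℝ)) (b := 1)).exists_bound_of_continuousOn
    hcont.continuousOn
  refine ⟨B.toNNReal, lipschitzWith_of_nnnorm_deriv_le (hsm.differentiable (by simp)) fun x => ?_⟩
  rw [← NNReal.coe_le_coe, coe_nnnorm]
  rcases lt_or_ge x 0 with h | h
  · have : Real.smoothTransition =ᶠ[𝓝 x] fun _ => 0 := by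
      filter_upwards [gt_mem_nhds h] with y hy using Real.smoothTransition.zero_of_nonpos hy.le
    rw [this.deriv_eq]
    simp
  rcases lt_or_ge 1 x with h1 | h1
  · have : Real.smoothTransition =ᶠ[𝓝 x] fun _ => 1 := by
      filter_upwards [lt_mem_nhds h1] with y hy using Real.smoothTransition.one_of_one_le hy.le
    rw [this.deriv_eq]
    simp
  · exact (hB x ⟨h, h1⟩).trans (Real.le_coe_toNNReal B)

/-- `η` is a smooth cutoff function that vanishes on the ball of radius `R` about `v` and equals `1`
off the ball of radius `R + H`, with gradient bounded by `B / H`. -/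
structure IsCutoff (η : E d → ℝ) (v : E d) (R H B : ℝ) : Prop where
  contDiff : ContDiff ℝ ∞ η
  nonneg : ∀ x, 0 ≤ η x
  le_one : ∀ x, η x ≤ 1
  eq_zero : ∀ x, dist x v ≤ R → η x = 0
  eq_one : ∀ x, R + H ≤ dist x v → η x = 1
  norm_gradient_le : ∀ x, ‖gradient η x‖ ≤ B / H
  gradient_eq_zero : ∀ x, dist x v < R ∨ R + H < dist x v → gradient η x = 0

/-- The cutoff depends on the Euclidean distance to v and not on mesh layers. At v, where the
distance is not smooth, the function is locally constant because R > 0. -/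
theorem exists_isCutoff : ∃ B : ℝ≥0, ∀ (v : E d) (R H : ℝ), 0 < R → 0 < H →
    ∃ η, IsCutoff η v R H B := by
  obtain ⟨B, hB⟩ := exists_lipschitzWith_smoothTransition
  refine ⟨B, fun v R H hR hH => ⟨fun x => Real.smoothTransition ((dist x v - R) / H), ?_,
    fun x => Real.smoothTransition.nonneg _, fun x => Real.smoothTransition.le_one _, ?_, ?_, ?_, ?_⟩⟩
  · rw [contDiff_iff_contDiffAt]
    intro x
    by_cases hx : x = v
    · have : (fun x => Real.smoothTransition ((dist x v - R) / H)) =ᶠ[𝓝 x] fun _ => 0 := by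
        subst hx
        filter_upwards [Metric.ball_mem_nhds x hR] with y hy
        refine Real.smoothTransition.zero_of_nonpos (div_nonpos_of_nonpos_of_nonneg ?_ hH.le)
        linarith [Metric.mem_ball.1 hy]
      exact contDiffAt_const.congr_of_eventuallyEq this
    · refine Real.smoothTransition.contDiffAt.comp x (ContDiffAt.div_const ?_ H)
      exact (contDiffAt_id.dist ℝ contDiffAt_const hx).sub contDiffAt_const
  · intro x hx
    exact Real.smoothTransition.zero_of_nonpos (div_nonpos_of_nonpos_of_nonneg (by linarith) hH.le)
  · intro x hx
    refine Real.smoothTransition.one_of_one_le ?_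
    rw [one_le_div hH]
    linarith
  · intro x
    have hl : LipschitzWith (B * (1 / H).toNNReal)
        fun x => Real.smoothTransition ((dist x v - R) / H) := by
      refine hB.comp (LipschitzWith.of_dist_le_mul fun y z => ?_)
      rw [Real.dist_eq, ← sub_div, sub_sub_sub_cancel_right, abs_div, abs_of_pos hH,
        Real.coe_toNNReal _ (by positivity), div_eq_inv_mul, one_div]
      gcongr
      exact abs_dist_sub_le y z v
    refine (norm_gradient_le_of_lipschitzWith hl x).trans (le_of_eq ?_)
    rw [NNReal.coe_mul, Real.coe_toNNReal _ (by positivity), mul_one_div]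
  · intro x hx
    have hd : Continuous fun y : E d => dist y v := continuous_id.dist continuous_const
    have : ∃ c : ℝ, (fun x => Real.smoothTransition ((dist x v - R) / H)) =ᶠ[𝓝 x] fun _ => c := by
      rcases hx with hx | hx
      · refine ⟨0, ?_⟩
        filter_upwards [hd.continuousAt.eventually_lt_const hx] with y hy
        exact Real.smoothTransition.zero_of_nonpos
          (div_nonpos_of_nonpos_of_nonneg (by linarith) hH.le)
      · refine ⟨1, ?_⟩
        filter_upwards [hd.continuousAt.eventually_const_lt hx] with y hy
        refine Real.smoothTransition.one_of_one_le ?_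
        rw [one_le_div hH]
        linarith
    obtain ⟨c, hc⟩ := this
    rw [gradient, hc.fderiv_eq]
    simp

end Cutoff

/-! ### The energy form of the coefficient. -/

section Coefficient

variable {d : ℕ} {Ω Λ : Set (E d)} {β : ℝ}

theorem inner_toEuclideanCLM (A : Matrix (Fin d) (Fin d) ℝ) (ξ ζ : E d) :
    inner ℝ (Matrix.toEuclideanCLM (n := Fin d) (𝕜 := ℝ) A ξ) ζ =
      ∑ i, ∑ j, A i j * ξ j * ζ i := by
  rw [PiLp.inner_apply]
  refine Finset.sum_congr rfl fun i _ => ?_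
  simp [Matrix.mulVec, dotProduct, Finset.mul_sum, mul_comm]

/-- Polarisation: nonnegativity of the form at ξ + ζ and at ξ - ζ bounds the mixed term from both
sides. -/
theorem abs_inner_toEuclideanCLM_le {A : Matrix (Fin d) (Fin d) ℝ} (hA : A.IsSymm) {γ : ℝ}
    (h0 : ∀ ξ : E d, 0 ≤ inner ℝ (Matrix.toEuclideanCLM (n := Fin d) (𝕜 := ℝ) A ξ) ξ)
    (h1 : ∀ ξ : E d, inner ℝ (Matrix.toEuclideanCLM (n := Fin d) (𝕜 := ℝ) A ξ) ξ ≤ γ * ‖ξ‖ ^ 2)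
    (ξ ζ : E d) : |inner ℝ (Matrix.toEuclideanCLM (n := Fin d) (𝕜 := ℝ) A ξ) ζ| ≤
      γ / 2 * (‖ξ‖ ^ 2 + ‖ζ‖ ^ 2) := by
  have hsymm : inner ℝ (Matrix.toEuclideanCLM (n := Fin d) (𝕜 := ℝ) A ζ) ξ =
      inner ℝ (Matrix.toEuclideanCLM (n := Fin d) (𝕜 := ℝ) A ξ) ζ := by
    rw [inner_toEuclideanCLM, inner_toEuclideanCLM, Finset.sum_comm]
    refine Finset.sum_congr rfl fun i _ => Finset.sum_congr rfl fun j _ => ?_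
    rw [hA.apply i j]
    ring
  have a1 := h0 (ξ + ζ)
  have a2 := h0 (ξ - ζ)
  simp only [map_add, map_sub, inner_add_left, inner_add_right, inner_sub_left, inner_sub_right,
    hsymm] at a1 a2
  rw [abs_le]
  constructor <;> nlinarith [h1 ξ, h1 ζ]

theorem IsCoefficient.aestronglyMeasurable_inner {γ₁ γ₂ : ℝ} {A : E d → Matrix (Fin d) (Fin d) ℝ}
    (hA : IsCoefficient Ω γ₁ γ₂ A) (G K : L2Vec Ω Λ β) :
    AEStronglyMeasurable (fun x =>
      inner ℝ (Matrix.toEuclideanCLM (n := Fin d) (𝕜 := ℝ) (A x) (G x)) (K x))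
      (wMeasure Ω Λ β) := by
  simp only [inner_toEuclideanCLM]
  have hcoord : ∀ (G : L2Vec Ω Λ β) i, AEMeasurable (fun x => G x i) (wMeasure Ω Λ β) :=
    fun G i => (EuclideanSpace.proj (𝕜 := ℝ) i).continuous.measurable.comp_aemeasurable
      (Lp.aestronglyMeasurable G).aemeasurable
  refine AEMeasurable.aestronglyMeasurable (Finset.aemeasurable_fun_sum _ fun i _ =>
    Finset.aemeasurable_fun_sum _ fun j _ => ?_)
  exact (((hA.aemeasurable i j).mono_ac wMeasure_absolutelyContinuous).mul (hcoord G j)).mul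
    (hcoord K i)

theorem integrable_norm_sq {X F : Type*} [MeasurableSpace X] [NormedAddCommGroup F] {μ : Measure X}
    (f : Lp F 2 μ) : Integrable (fun x => ‖f x‖ ^ 2) μ :=
  (Lp.memLp f).integrable_norm_pow two_ne_zero

/-- The Caccioppoli step: testing with a truncation `W` of `G` bounds `G` far away by its values in
the region `N` in which `W` differs from `η G`. -/
theorem IsCoefficient.energy_estimate {γ₁ γ₂ : ℝ} (hγ₁ : 0 < γ₁) (hγ₂ : 0 < γ₂)
    {A : E d → Matrix (Fin d) (Fin d) ℝ} (hA : IsCoefficient Ω γ₁ γ₂ A) {G W : L2Vec Ω Λ β}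
    (h0 : energy A G W = 0) {η : E d → ℝ} (hηc : Continuous η) (hη0 : ∀ x, 0 ≤ η x)
    (hη1 : ∀ x, η x ≤ 1) {S N : Set (E d)} (hS : MeasurableSet S) (hN : MeasurableSet N)
    (hηS : ∀ x ∈ S, η x = 1)
    (hW : ∀ᵐ x ∂(wMeasure Ω Λ β), x ∉ N → W x = η x • G x) :
    ENNReal.ofReal γ₁ * ∫⁻ x in S, ‖G x‖ₑ ^ 2 ∂(wMeasure Ω Λ β) ≤
      ENNReal.ofReal (γ₂ / 2) * (∫⁻ x in N, ‖G x‖ₑ ^ 2 ∂(wMeasure Ω Λ β) +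
        ∫⁻ x in N, ‖W x - η x • G x‖ₑ ^ 2 ∂(wMeasure Ω Λ β)) := by
  set μ := wMeasure Ω Λ β
  obtain ⟨L, hL⟩ := exists_pointwise_clm μ (F := E d) (C := 1)
    (T := fun x => η x • ContinuousLinearMap.id ℝ (E d))
    (hηc.smul (continuous_const (y := ContinuousLinearMap.id ℝ (E d)))) fun x => by
      rw [norm_smul, Real.norm_of_nonneg (hη0 x)]
      exact mul_le_one₀ (hη1 x) (norm_nonneg _) ContinuousLinearMap.norm_id_le
  set D : L2Vec Ω Λ β := W - L G
  have hD : D =ᵐ[μ] fun x => W x - η x • G x := by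
    filter_upwards [Lp.coeFn_sub W (L G), hL G] with x h1 h2
    rw [h1, Pi.sub_apply, h2]
    simp
  have hb : ∀ᵐ x ∂μ, (∀ ξ ζ : E d,
      |inner ℝ (Matrix.toEuclideanCLM (n := Fin d) (𝕜 := ℝ) (A x) ξ) ζ| ≤
        γ₂ / 2 * (‖ξ‖ ^ 2 + ‖ζ‖ ^ 2)) ∧ ∀ ξ : E d,
      γ₁ * ‖ξ‖ ^ 2 ≤ inner ℝ (Matrix.toEuclideanCLM (n := Fin d) (𝕜 := ℝ) (A x) ξ) ξ := by
    filter_upwards [wMeasure_absolutelyContinuous.ae_le hA.symm,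
      wMeasure_absolutelyContinuous.ae_le hA.bounds] with x h1 h2
    exact ⟨abs_inner_toEuclideanCLM_le h1 (fun ξ => le_trans (by positivity) (h2 ξ).1)
      fun ξ => (h2 ξ).2, fun ξ => (h2 ξ).1⟩
  have hi : Integrable (fun x =>
      inner ℝ (Matrix.toEuclideanCLM (n := Fin d) (𝕜 := ℝ) (A x) (G x)) (W x)) μ := by
    refine (((integrable_norm_sq G).add (integrable_norm_sq W)).const_mul (γ₂ / 2)).mono'
      (hA.aestronglyMeasurable_inner G W) ?_
    filter_upwards [hb] with x hx using hx.1 _ _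
  have hGD : Integrable (fun x => γ₂ / 2 * (‖G x‖ ^ 2 + ‖D x‖ ^ 2)) μ :=
    ((integrable_norm_sq G).add (integrable_norm_sq D)).const_mul (γ₂ / 2)
  have hc : Integrable (N.indicator fun x => γ₂ / 2 * (‖G x‖ ^ 2 + ‖D x‖ ^ 2)) μ :=
    hGD.indicator hN
  have ha : Integrable (S.indicator fun x => γ₁ * ‖G x‖ ^ 2) μ :=
    ((integrable_norm_sq G).const_mul γ₁).indicator hS
  -- On S the left side is at most η AG·G = AG·W - AG·D. The first term integrates to zero and the
  -- second lives on N.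
  have hpt : ∀ᵐ x ∂μ, S.indicator (fun x => γ₁ * ‖G x‖ ^ 2) x ≤
      inner ℝ (Matrix.toEuclideanCLM (n := Fin d) (𝕜 := ℝ) (A x) (G x)) (W x) +
        N.indicator (fun x => γ₂ / 2 * (‖G x‖ ^ 2 + ‖D x‖ ^ 2)) x := by
    filter_upwards [hb, hD, hW] with x hx hDx hWx
    have e1 : S.indicator (fun x => γ₁ * ‖G x‖ ^ 2) x ≤ η x * (γ₁ * ‖G x‖ ^ 2) := by
      by_cases hxS : x ∈ S
      · rw [indicator_of_mem hxS, hηS x hxS, one_mul]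
      · rw [indicator_of_notMem hxS]
        exact mul_nonneg (hη0 x) (by positivity)
    have e2 : W x = η x • G x + D x := by rw [hDx]; abel
    have e3 : -(inner ℝ (Matrix.toEuclideanCLM (n := Fin d) (𝕜 := ℝ) (A x) (G x)) (D x)) ≤
        N.indicator (fun x => γ₂ / 2 * (‖G x‖ ^ 2 + ‖D x‖ ^ 2)) x := by
      by_cases hxN : x ∈ N
      · rw [indicator_of_mem hxN]
        exact (neg_le_abs _).trans (hx.1 _ _)
      · rw [indicator_of_notMem hxN, hDx, hWx hxN, sub_self, inner_zero_right, neg_zero]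
    have e4 := mul_le_mul_of_nonneg_left (hx.2 (G x)) (hη0 x)
    rw [e2, inner_add_right, inner_smul_right]
    linarith
  have hint := integral_mono_ae ha (hi.add hc) hpt
  rw [integral_add' hi hc] at hint
  rw [energy] at h0
  rw [h0, zero_add, integral_indicator hS, integral_indicator hN] at hint
  have h2 := ENNReal.ofReal_le_ofReal hint
  rw [ofReal_integral_eq_lintegral_ofReal (((integrable_norm_sq G).const_mul γ₁).restrict)
      (Eventually.of_forall fun x => by positivity),
    ofReal_integral_eq_lintegral_ofReal hGD.restrict
      (Eventually.of_forall fun x => by positivity)] at h2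
  have hsq : ∀ y : E d, ENNReal.ofReal (‖y‖ ^ 2) = ‖y‖ₑ ^ 2 := fun y => by
    rw [ENNReal.ofReal_pow (norm_nonneg _), ofReal_norm]
  simp only [ENNReal.ofReal_mul hγ₁.le, ENNReal.ofReal_mul (half_pos hγ₂).le,
    ENNReal.ofReal_add (sq_nonneg _) (sq_nonneg _), hsq] at h2
  rw [lintegral_const_mul' _ _ ENNReal.ofReal_ne_top, lintegral_const_mul' _ _ ENNReal.ofReal_ne_top,
    lintegral_add_left' ((Lp.aestronglyMeasurable G).enorm.pow_const 2).restrict] at h2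
  refine h2.trans (le_of_eq ?_)
  congr 2
  refine lintegral_congr_ae (ae_restrict_of_ae ?_)
  filter_upwards [hD] with x hx
  rw [hx]

end Coefficient

/-- Bounded overlap: at each point at most m of the indicators are nonzero. -/
theorem sum_setLIntegral_le {X ι : Type*} [MeasurableSpace X] {μ : Measure X} {F : Finset ι}
    {B : ι → Set X} (hB : ∀ i ∈ F, MeasurableSet (B i)) {N : Set X} (hN : ∀ i ∈ F, B i ⊆ N)
    (hNm : MeasurableSet N)
    {m : ℝ≥0∞} (hm : ∀ x, ∀ F' ⊆ F, (∀ i ∈ F', x ∈ B i) → (F'.card : ℝ≥0∞) ≤ m) {f : X → ℝ≥0∞}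
    (hf : AEMeasurable f μ) : ∑ i ∈ F, ∫⁻ x in B i, f x ∂μ ≤ m * ∫⁻ x in N, f x ∂μ := by
  classical
  have h1 : ∑ i ∈ F, ∫⁻ x in B i, f x ∂μ = ∫⁻ x, ∑ i ∈ F, (B i).indicator f x ∂μ := by
    rw [lintegral_finsetSum' _ fun i hi => hf.indicator (hB i hi)]
    exact Finset.sum_congr rfl fun i hi => (lintegral_indicator (hB i hi) f).symm
  rw [h1, ← lintegral_indicator hNm]
  refine le_trans (lintegral_mono fun x => ?_)
    (lintegral_const_mul'' _ (hf.indicator hNm)).le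
  rw [← Finset.sum_filter_add_sum_filter_not F fun i => x ∈ B i,
    Finset.sum_eq_zero (s := F.filter fun i => x ∉ B i) fun i hi =>
      indicator_of_notMem (Finset.mem_filter.1 hi).2 f, add_zero]
  rcases (F.filter fun i => x ∈ B i).eq_empty_or_nonempty with he | ⟨i, hi⟩
  · rw [he]
    simp
  · obtain ⟨hi1, hi2⟩ := Finset.mem_filter.1 hi
    simp only
    rw [indicator_of_mem (hN i hi1 hi2)]
    refine (Finset.sum_le_card_nsmul _ _ (f x) fun j _ => indicator_le_self' (by simp) x).trans ?_
    rw [nsmul_eq_mul]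
    exact mul_le_mul' (hm x _ (Finset.filter_subset _ _) fun j hj => (Finset.mem_filter.1 hj).2) le_rfl

/-! ### Inverse estimate, and reproduction of coarse functions. -/

namespace Mesh

variable {d ℓ : ℕ} {c : ℝ} {Ω Λ : Set (E d)} {β : ℝ} {M : Mesh Ω} {H σ : ℝ}

/-- Inverse estimate: the nodal values bound the function on the simplex, and the inscribed ball of
radius σH turns this into a bound on the slope. The boundary of the simplex, where the gradient may
jump, is null. -/
theorem HasSize.gradient_le (hs : M.HasSize H σ) {g : E d → ℝ} (hg : M.IsPiecewiseAffine g)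
    {s : Finset (E d)} (hse : s ∈ M.elements) :
    ∀ᵐ x, x ∈ convexHull ℝ (s : Set (E d)) →
      ‖gradient g x‖ₑ ^ 2 ≤ ENNReal.ofReal (1 / (σ * H)) ^ 2 * ∑ v ∈ s, ‖g v‖ₑ ^ 2 := by
  set m := √(∑ v ∈ s, g v ^ 2) with hm
  have hσ := hs.pos'
  have hH := hs.pos
  have hgm : ∀ x ∈ convexHull ℝ (s : Set (E d)), |g x| ≤ m := fun x hx => by
    have hw := M.isWeight_hat hse.1 hx
    rw [eq_sum_of_affine hg hse hx]
    refine (Finset.abs_sum_le_sum_abs _ _).trans ?_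
    calc ∑ v ∈ s, |M.hat v x * g v| ≤ ∑ v ∈ s, M.hat v x * m := by
          refine Finset.sum_le_sum fun v hv => ?_
          rw [abs_mul, abs_of_nonneg (hw.nonneg v)]
          refine mul_le_mul_of_nonneg_left (Real.abs_le_sqrt ?_) (hw.nonneg v)
          exact Finset.single_le_sum (f := fun v => g v ^ 2) (fun v _ => sq_nonneg _) hv
      _ = m := by rw [← Finset.sum_mul, hw.sum_eq, one_mul]
  have hl := hs.lipschitzOnWith hg hse hgm
  have hnull : ∀ᵐ x, x ∉ frontier (convexHull ℝ (s : Set (E d))) := by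
    rw [ae_iff]
    simpa using (convex_convexHull ℝ (s : Set (E d))).addHaar_frontier volume
  filter_upwards [hnull] with x hx hxs
  have hxi : x ∈ interior (convexHull ℝ (s : Set (E d))) := by
    by_contra h
    exact hx ⟨subset_closure hxs, h⟩
  have h1 : ‖gradient g x‖ ≤ 1 / (σ * H) * m := by
    rw [norm_gradient]
    refine (norm_fderiv_le_of_lipschitzOn ℝ (mem_interior_iff_mem_nhds.1 hxi) hl).trans ?_
    rw [Real.coe_toNNReal _ (by positivity), div_eq_mul_one_div, mul_comm]
  have h2 : (∑ v ∈ s, ‖g v‖ₑ ^ 2) = ENNReal.ofReal m ^ 2 := by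
    rw [← ENNReal.ofReal_pow (Real.sqrt_nonneg _), Real.sq_sqrt
      (Finset.sum_nonneg fun v _ => sq_nonneg _), ENNReal.ofReal_sum_of_nonneg fun v _ => sq_nonneg _]
    refine Finset.sum_congr rfl fun v _ => ?_
    rw [← sq_abs, ENNReal.ofReal_pow (abs_nonneg _), ← Real.norm_eq_abs, ofReal_norm]
  rw [h2, ← mul_pow, ← ENNReal.ofReal_mul (by positivity), ← ofReal_norm]
  gcongr

/-- The local projection reproduces the discrete functions at the node. -/
theorem localProj_apply_eq (hc : 0 < c) (hℓ : ℓ < d)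
    (hβ : β ∈ Ioo (-(((d : ℝ) - ℓ) / 2)) (((d : ℝ) - ℓ) / 2)) (hΩ : IsLipschitzDomain Ω)
    (hΛ : IsRegularSet ℓ c Λ) (hs : M.HasSize H σ) {v : E d} (hv : v ∈ M.intNodes) {u : L2 Ω Λ β}
    {g : E d → ℝ} (hg : g ∈ M.VH)
    (hu : ∀ᵐ x ∂(wMeasure Ω Λ β), x ∈ M.patch v 0 → u x = g x) :
    (M.localProj Λ β v u : E d → ℝ) v = g v := by
  obtain ⟨C, hC⟩ := exists_enorm_localProj_sub_le (d := d) hc hℓ hβ hΩ hs.pos'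
  have h1 := hC Λ hΛ M H hs v hv u g hg
  have h2 : ∫⁻ x in M.patch v 0, ‖u x - g x‖ₑ ^ 2 ∂(wMeasure Ω Λ β) = 0 := by
    rw [← lintegral_zero (μ := (wMeasure Ω Λ β).restrict (M.patch v 0))]
    refine lintegral_congr_ae ?_
    filter_upwards [ae_restrict_of_ae hu, ae_restrict_mem (M.measurableSet_patch hΩ.isOpen v 0)]
      with x hx hxω
    rw [hx hxω, sub_self, enorm_zero, zero_pow two_ne_zero]
  rw [h2, mul_zero, nonpos_iff_eq_zero, mul_eq_zero] at h1
  have h3 := h1.resolve_right ((hΩ.admissibleWeight hc hℓ hβ hΛ).lintegral_closedBall_ne_zero v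
    (by linarith [hs.pos]))
  rw [pow_eq_zero_iff two_ne_zero, enorm_eq_zero, sub_eq_zero] at h3
  exact h3

/-- The quasi-interpolation reproduces the discrete functions. -/
theorem quasiInterp_eq_self (hc : 0 < c) (hℓ : ℓ < d)
    (hβ : β ∈ Ioo (-(((d : ℝ) - ℓ) / 2)) (((d : ℝ) - ℓ) / 2)) (hΩ : IsLipschitzDomain Ω)
    (hΛ : IsRegularSet ℓ c Λ) (hs : M.HasSize H σ) {u : L2 Ω Λ β}
    {g : E d → ℝ} (hg : g ∈ M.VH) (hu : u =ᵐ[wMeasure Ω Λ β] g) :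
    M.quasiInterp Λ β u = g := by
  funext x
  rw [hs.eq_sum_intNodes hΩ hg x, quasiInterp_apply]
  refine Finset.sum_congr rfl fun v hv => ?_
  rw [localProj_apply_eq hc hℓ hβ hΩ hΛ hs hv hg (hu.mono fun x hx _ => hx)]

end Mesh

/-! ### Exponential decay -/

section Decay

variable {d ℓ : ℕ} {c : ℝ} {Ω Λ : Set (E d)} {β : ℝ}

namespace Mesh

/-- The values at the nodes of the quasi-interpolation of a truncation `η u` of a fine-scale
function `u`. -/
theorem quasiInterp_mul_apply_eq_zero (hc : 0 < c) (hℓ : ℓ < d)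
    (hβ : β ∈ Ioo (-(((d : ℝ) - ℓ) / 2)) (((d : ℝ) - ℓ) / 2)) (hΩ : IsLipschitzDomain Ω)
    (hΛ : IsRegularSet ℓ c Λ) {M : Mesh Ω} {H σ : ℝ} (hs : M.HasSize H σ) {v w : E d} {R B : ℝ}
    {η : E d → ℝ} (hη : IsCutoff η v R H B) (hw : w ∈ M.intNodes)
    {p : L2 Ω Λ β × L2Vec Ω Λ β} (hp : p ∈ M.fineSpace Λ β) {q : L2 Ω Λ β}
    (hq : q =ᵐ[wMeasure Ω Λ β] fun x => η x * p.1 x)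
    (hwv : dist w v ≤ R - H ∨ R + 2 * H ≤ dist w v) : M.quasiInterp Λ β q w = 0 := by
  have hω : ∀ x ∈ M.patch w 0, dist x w ≤ H := fun x hx => by
    simpa using hs.patch_subset_closedBall w 0 hx
  rcases hwv with hwv | hwv
  · rw [quasiInterp_apply_node q hw, localProj_apply_eq hc hℓ hβ hΩ hΛ hs hw M.VH.zero_mem]
    · rfl
    · filter_upwards [hq] with x hx hxω
      rw [hx, hη.eq_zero x (by linarith [dist_triangle x w v, hω x hxω]), zero_mul, Pi.zero_apply]
  · have h1 : M.quasiInterp Λ β p.1 = 0 := LinearMap.mem_ker.1 (Submodule.mem_inf.1 hp).2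
    -- Far out η = 1, so q - p vanishes on the patch of w, while p itself contributes nothing
    -- because its quasi-interpolation is zero.
    rw [← sub_add_cancel q p.1, map_add, h1, add_zero, quasiInterp_apply_node _ hw,
      localProj_apply_eq hc hℓ hβ hΩ hΛ hs hw M.VH.zero_mem]
    · rfl
    · filter_upwards [hq, Lp.coeFn_sub q p.1] with x hx hx' hxω
      rw [hx', Pi.sub_apply, hx, hη.eq_one x (by
        linarith [dist_triangle w x v, hω x hxω, dist_comm x w]), one_mul, sub_self, Pi.zero_apply]

theorem setLIntegral_enorm_mul_sq_le {μ : Measure (E d)} {η : E d → ℝ} (h0 : ∀ x, 0 ≤ η x)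
    (h1 : ∀ x, η x ≤ 1) {f g : E d → ℝ} (hf : f =ᵐ[μ] fun x => η x * g x) {S T : Set (E d)}
    (hST : S ⊆ T) : ∫⁻ x in S, ‖f x‖ₑ ^ 2 ∂μ ≤ ∫⁻ x in T, ‖g x‖ₑ ^ 2 ∂μ := by
  refine (lintegral_mono_ae (ae_restrict_of_ae ?_)).trans (lintegral_mono_set hST)
  filter_upwards [hf] with x hx
  gcongr
  rw [hx, ← ofReal_norm, ← ofReal_norm]
  refine ENNReal.ofReal_le_ofReal ?_
  rw [norm_mul, Real.norm_of_nonneg (h0 x)]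
  exact mul_le_of_le_one_left (norm_nonneg _) (h1 x)

/-- A bound, on one element, for the commutator of a cutoff and the weak gradient, corrected by the
quasi-interpolation. -/
theorem exists_element_estimate (hc : 0 < c) (hℓ : ℓ < d)
    (hβ : β ∈ Ioo (-(((d : ℝ) - ℓ) / 2)) (((d : ℝ) - ℓ) / 2)) (hΩ : IsLipschitzDomain Ω) {σ R₀ : ℝ}
    (hσ : 0 < σ) (hR₀ : 0 < R₀) (B : ℝ≥0) :
    ∃ C : ℝ≥0, ∀ Λ : Set (E d), IsRegularSet ℓ c Λ → ∀ (M : Mesh Ω) (H : ℝ), M.HasSize H σ →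
      H ≤ R₀ → ∀ (v : E d) (R : ℝ) (η : E d → ℝ), IsCutoff η v R H B →
      ∀ p ∈ M.fineSpace Λ β, ∀ q : L2 Ω Λ β, (q =ᵐ[wMeasure Ω Λ β] fun x => η x * p.1 x) →
      ∀ D : L2Vec Ω Λ β, (∀ᵐ x ∂(wMeasure Ω Λ β),
        ‖D x‖ₑ ^ 2 ≤ 2 * (‖p.1 x • gradient η x‖ₑ ^ 2 +
          ‖gradient (M.quasiInterp Λ β q) x‖ₑ ^ 2)) →
      ∀ s ∈ M.elements, ∀ y ∈ convexHull ℝ (s : Set (E d)),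
      ∫⁻ x in convexHull ℝ (s : Set (E d)), ‖D x‖ₑ ^ 2 ∂(wMeasure Ω Λ β) ≤
        C * ∫⁻ x in closedBall y (6 * H), ‖p.2 x‖ₑ ^ 2 ∂(wMeasure Ω Λ β) := by
  obtain ⟨C₁, hC₁⟩ := exists_enorm_localProj_sub_le (d := d) hc hℓ hβ hΩ hσ
  obtain ⟨C₂, hC₂⟩ := exists_local_estimate (d := d) hc hℓ hβ hΩ hσ hR₀
  refine ⟨2 * (B ^ 2 * C₂ + (1 / σ).toNNReal ^ 2 * ((d + 1) * (C₁ * C₂))),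
    fun Λ hΛ M H hs hHR v R η hη p hp q hq D hD s hse y hy => ?_⟩
  set μ := wMeasure Ω Λ β
  have hH := hs.pos
  set T := convexHull ℝ (s : Set (E d)) with hT
  have hTm : MeasurableSet T := (isCompact_convexHull s).isClosed.measurableSet
  set J := M.quasiInterp Λ β q
  have hJ : J ∈ M.VH := hs.quasiInterp_mem_VH hΩ q
  set G := ∫⁻ x in closedBall y (6 * H), ‖p.2 x‖ₑ ^ 2 ∂μ
  set h := ENNReal.ofReal H ^ 2
  have hTy : T ⊆ closedBall y H := fun x hx => hs.dist_le s hse x hx y hy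
  -- The factor B/H from ∇η is compensated by the factor H in the local estimate for fine-scale
  -- functions.
  have b1 : ∫⁻ x in T, ‖p.1 x • gradient η x‖ₑ ^ 2 ∂μ ≤ B ^ 2 * C₂ * G := by
    calc ∫⁻ x in T, ‖p.1 x • gradient η x‖ₑ ^ 2 ∂μ
        ≤ ∫⁻ x in T, ENNReal.ofReal (B / H) ^ 2 * ‖p.1 x‖ₑ ^ 2 ∂μ := by
          refine lintegral_mono fun x => ?_
          rw [enorm_smul, mul_pow, mul_comm]
          gcongr
          rw [← ofReal_norm]
          exact ENNReal.ofReal_le_ofReal (hη.norm_gradient_le x)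
      _ = ENNReal.ofReal (B / H) ^ 2 * ∫⁻ x in T, ‖p.1 x‖ₑ ^ 2 ∂μ :=
          lintegral_const_mul' _ _ (ENNReal.pow_ne_top ENNReal.ofReal_ne_top)
      _ ≤ ENNReal.ofReal (B / H) ^ 2 * (C₂ * (h * G)) := by
          refine mul_le_mul' le_rfl ((lintegral_mono_set hTy).trans
            ((hC₂ Λ hΛ M H hs hHR p hp y).trans (mul_le_mul' le_rfl (mul_le_mul' le_rfl
              (lintegral_mono_set (Metric.closedBall_subset_closedBall (by linarith)))))))
      _ = (ENNReal.ofReal (B / H) * ENNReal.ofReal H) ^ 2 * C₂ * G := by ring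
      _ = B ^ 2 * C₂ * G := by
          rw [← ENNReal.ofReal_mul (by positivity), div_mul_cancel₀ _ hH.ne',
            ENNReal.ofReal_coe_nnreal]
  -- Stability of the projection at w and the local estimate about w. Vertices off Ω carry the value
  -- 0.
  have hnode : ∀ w ∈ s, ‖J w‖ₑ ^ 2 * μ T ≤ C₁ * C₂ * (h * G) := fun w hws => by
    by_cases hwΩ : w ∈ Ω
    swap
    · rw [hJ.2.1 w hwΩ, enorm_zero, zero_pow two_ne_zero, zero_mul]
      exact zero_le
    have hw : w ∈ M.intNodes := mem_intNodes.2 ⟨mem_vertices_of_mem hse.1 hws, hwΩ⟩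
    have hwT : w ∈ T := subset_convexHull ℝ _ hws
    have e1 : μ T ≤ ∫⁻ x in closedBall w (2 * H), weight Λ β x := by
      have := setLIntegral_wMeasure (Ω := Ω) (Λ := Λ) (β := β) hTm fun _ => 1
      simp only [lintegral_const, one_mul, mul_one, Measure.restrict_apply MeasurableSet.univ,
        univ_inter] at this
      rw [this]
      refine lintegral_mono_set fun x hx => ?_
      have := hs.dist_le s hse x hx.1 w hwT
      rw [Metric.mem_closedBall]
      linarith
    have e2 := hC₁ Λ hΛ M H hs w hw q 0 M.VH.zero_mem
    simp only [Pi.zero_apply, sub_zero] at e2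
    rw [← quasiInterp_apply_node q hw] at e2
    have e3 : ∫⁻ x in M.patch w 0, ‖q x‖ₑ ^ 2 ∂μ ≤ ∫⁻ x in closedBall w H, ‖p.1 x‖ₑ ^ 2 ∂μ :=
      setLIntegral_enorm_mul_sq_le hη.nonneg hη.le_one hq fun x hx => by
        simpa using hs.patch_subset_closedBall w 0 hx
    have e4 : ∫⁻ x in closedBall w (5 * H), ‖p.2 x‖ₑ ^ 2 ∂μ ≤ G := by
      refine lintegral_mono_set fun x hx => ?_
      have := hs.dist_le s hse w hwT y hy
      rw [Metric.mem_closedBall] at hx ⊢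
      linarith [dist_triangle x w y]
    calc ‖J w‖ₑ ^ 2 * μ T ≤ C₁ * ∫⁻ x in M.patch w 0, ‖q x‖ₑ ^ 2 ∂μ :=
          (mul_le_mul' le_rfl e1).trans e2
      _ ≤ C₁ * (C₂ * (h * G)) := by
          refine mul_le_mul' le_rfl (e3.trans ((hC₂ Λ hΛ M H hs hHR p hp w).trans ?_))
          exact mul_le_mul' le_rfl (mul_le_mul' le_rfl e4)
      _ = _ := by ring
  -- The inverse estimate costs 1/(σH), which the local estimate again compensates; the d + 1
  -- vertices are summed.
  have b2 : ∫⁻ x in T, ‖gradient J x‖ₑ ^ 2 ∂μ ≤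
      (1 / σ).toNNReal ^ 2 * ((d + 1) * (C₁ * C₂)) * G := by
    have hae : ∀ᵐ x ∂μ.restrict T, ‖gradient J x‖ₑ ^ 2 ≤
        ENNReal.ofReal (1 / (σ * H)) ^ 2 * ∑ w ∈ s, ‖J w‖ₑ ^ 2 := by
      filter_upwards [ae_restrict_of_ae (wMeasure_absolutelyContinuous.ae_le
        (ae_restrict_of_ae (hs.gradient_le hJ.2.2 hse))), ae_restrict_mem hTm] with x h1 h2
      exact h1 h2
    calc ∫⁻ x in T, ‖gradient J x‖ₑ ^ 2 ∂μ
        ≤ ∫⁻ _ in T, ENNReal.ofReal (1 / (σ * H)) ^ 2 * ∑ w ∈ s, ‖J w‖ₑ ^ 2 ∂μ :=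
          lintegral_mono_ae hae
      _ = ENNReal.ofReal (1 / (σ * H)) ^ 2 * ∑ w ∈ s, ‖J w‖ₑ ^ 2 * μ T := by
          rw [setLIntegral_const, mul_assoc, Finset.sum_mul]
      _ ≤ ENNReal.ofReal (1 / (σ * H)) ^ 2 * ((d + 1 : ℕ) * (C₁ * C₂ * (h * G))) := by
          refine mul_le_mul' le_rfl ((Finset.sum_le_card_nsmul _ _ _ hnode).trans ?_)
          rw [hse.2, nsmul_eq_mul]
      _ = (ENNReal.ofReal (1 / (σ * H)) * ENNReal.ofReal H) ^ 2 *
            ((d + 1 : ℕ) * (C₁ * C₂)) * G := by ring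
      _ = _ := by
          rw [← ENNReal.ofReal_mul (by positivity), show 1 / (σ * H) * H = 1 / σ by field_simp]
          push_cast
          rfl
  calc ∫⁻ x in T, ‖D x‖ₑ ^ 2 ∂μ
      ≤ ∫⁻ x in T, 2 * (‖p.1 x • gradient η x‖ₑ ^ 2 + ‖gradient J x‖ₑ ^ 2) ∂μ :=
        lintegral_mono_ae (ae_restrict_of_ae hD)
    _ = 2 * (∫⁻ x in T, ‖p.1 x • gradient η x‖ₑ ^ 2 ∂μ + ∫⁻ x in T, ‖gradient J x‖ₑ ^ 2 ∂μ) := by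
        rw [lintegral_const_mul' _ _ (by norm_num),
          lintegral_add_right _ ((measurable_gradient J).enorm.pow_const 2)]
    _ ≤ 2 * (B ^ 2 * C₂ * G + (1 / σ).toNNReal ^ 2 * ((d + 1) * (C₁ * C₂)) * G) :=
        mul_le_mul' le_rfl (add_le_add b1 b2)
    _ = _ := by
        push_cast
        ring

/-- Take w = ηp - I_H(ηp). As I_H is a projection onto V_H, the correction returns ηp to the kernel.
It vanishes at nodes whose patch lies where η is 0 or where η is 1, so ∇w - η∇p = p∇η - ∇I_H(ηp)
lives in an annulus of width of order H. There the element estimates are summed, with bounded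
overlap of the balls of radius 6H. -/
theorem exists_truncation (hc : 0 < c) (hℓ : ℓ < d)
    (hβ : β ∈ Ioo (-(((d : ℝ) - ℓ) / 2)) (((d : ℝ) - ℓ) / 2)) (hΩ : IsLipschitzDomain Ω) {σ R₀ : ℝ}
    (hσ : 0 < σ) (hR₀ : 0 < R₀) :
    ∃ C : ℝ≥0, ∀ Λ : Set (E d), IsRegularSet ℓ c Λ → ∀ (M : Mesh Ω) (H : ℝ), M.HasSize H σ →
      H ≤ R₀ → ∀ (v : E d) (R : ℝ), 4 * H ≤ R → ∃ η : E d → ℝ, Continuous η ∧ (∀ x, 0 ≤ η x) ∧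
      (∀ x, η x ≤ 1) ∧ (∀ x, R + H ≤ dist x v → η x = 1) ∧
      ∀ p ∈ M.fineSpace Λ β, ∃ w ∈ M.fineSpace Λ β,
      (∀ᵐ x ∂(wMeasure Ω Λ β), x ∈ M.patch v 1 → w.1 x = 0) ∧
      (∀ᵐ x ∂(wMeasure Ω Λ β), x ∉ closedBall v (R + 10 * H) \ closedBall v (R - 10 * H) →
        w.2 x = η x • p.2 x) ∧
      ∫⁻ x in closedBall v (R + 10 * H) \ closedBall v (R - 10 * H), ‖w.2 x - η x • p.2 x‖ₑ ^ 2
          ∂(wMeasure Ω Λ β) ≤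
        C * ∫⁻ x in closedBall v (R + 10 * H) \ closedBall v (R - 10 * H), ‖p.2 x‖ₑ ^ 2
          ∂(wMeasure Ω Λ β) := by
  obtain ⟨B, hB⟩ := exists_isCutoff (d := d)
  obtain ⟨C, hC⟩ := exists_element_estimate (d := d) hc hℓ hβ hΩ hσ hR₀ B
  refine ⟨C * ((7 / σ) ^ d).toNNReal, fun Λ hΛ M H hs hHR v R hR => ?_⟩
  have h := hΩ.admissibleWeight hc hℓ hβ hΛ
  have hH := hs.pos
  obtain ⟨η, hη⟩ := hB v R H (by linarith) hH
  refine ⟨η, hη.contDiff.continuous, hη.nonneg, hη.le_one, hη.eq_one, fun p hp => ?_⟩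
  obtain ⟨hp1, hp2⟩ := Submodule.mem_inf.1 hp
  set μ := wMeasure Ω Λ β with hμ
  obtain ⟨q, hq, hq1, hq2⟩ := h.exists_mul_mem_H10 hη.contDiff (B₀ := 1)
    (fun x => by rw [abs_of_nonneg (hη.nonneg x)]; exact hη.le_one x) hη.norm_gradient_le hp1
  set J := M.quasiInterp Λ β q.1 with hJdef
  have hJ : J ∈ M.VH := hs.quasiInterp_mem_VH hΩ q.1
  obtain ⟨K, hK⟩ := hs.exists_lipschitzWith hΩ hJ
  obtain ⟨j, hj, hj1, hj2⟩ := h.exists_mem_H10 hK hJ.2.1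
  -- The vertices of an element containing x are within H of x, so the bounds R - H and R + 2H for
  -- nodes become R - 2H and R + 3H for points.
  have hJz : ∀ x ∈ Ω, (dist x v ≤ R - 2 * H ∨ R + 3 * H ≤ dist x v) → J x = 0 := fun x hx hxv => by
    obtain ⟨s, hse, hxs⟩ := M.exists_element hΩ.isOpen (subset_closure hx)
    rw [eq_sum_of_affine hJ.2.2 hse hxs]
    refine Finset.sum_eq_zero fun w hws => mul_eq_zero_of_right _ ?_
    by_cases hwΩ : w ∈ Ω
    swap
    · exact hJ.2.1 w hwΩ
    have hwx := hs.dist_le s hse w (subset_convexHull ℝ _ hws) x hxs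
    refine quasiInterp_mul_apply_eq_zero hc hℓ hβ hΩ hΛ hs hη
      (mem_intNodes.2 ⟨mem_vertices_of_mem hse.1 hws, hwΩ⟩) hp hq1 ?_
    rcases hxv with hxv | hxv
    · left; linarith [dist_triangle w x v]
    · right; linarith [dist_triangle x w v, dist_comm x w]
  have hmemΩ : ∀ᵐ x ∂μ, x ∈ Ω :=
    wMeasure_absolutelyContinuous.ae_le (ae_restrict_mem hΩ.isOpen.measurableSet)
  have hw1 : (q - j).1 =ᵐ[μ] fun x => η x * p.1 x - J x := by
    filter_upwards [Lp.coeFn_sub q.1 j.1, hq1, hj1] with x e1 e2 e3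
    rw [Prod.fst_sub, e1, Pi.sub_apply, e2, e3]
  have hw2 : ∀ᵐ x ∂μ, (q - j).2 x - η x • p.2 x =
      p.1 x • gradient η x - {x | J x ≠ 0}.indicator (gradient J) x := by
    filter_upwards [Lp.coeFn_sub q.2 j.2, hq2, hj2] with x e1 e2 e3
    rw [Prod.snd_sub, e1, Pi.sub_apply, e2, e3]
    abel
  have hzero : ∀ᵐ x ∂μ, (dist x v ≤ R - 2 * H ∨ R + 3 * H ≤ dist x v) →
      (q - j).2 x - η x • p.2 x = 0 := by
    filter_upwards [hw2, hmemΩ] with x hx hxΩ hxv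
    rw [hx, hη.gradient_eq_zero x (hxv.imp (fun h => by linarith) fun h => by linarith),
      indicator_of_notMem (by simpa using hJz x hxΩ hxv), smul_zero, sub_zero]
  refine ⟨q - j, Submodule.mem_inf.2 ⟨Submodule.sub_mem _ hq hj, LinearMap.mem_ker.2 ?_⟩, ?_, ?_, ?_⟩
  · rw [LinearMap.comp_apply, LinearMap.fst_apply, Prod.fst_sub, map_sub,
      quasiInterp_eq_self hc hℓ hβ hΩ hΛ hs hJ hj1, hJdef, sub_self]
  · filter_upwards [hw1, hmemΩ] with x hx hxΩ hxω
    -- ω_{v,1} lies within 2H of v, and 2H ≤ R - 2H by the assumption on R; both η and J vanish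
    -- there.
    have hxv : dist x v ≤ 2 * H := by
      have := hs.patch_subset_closedBall v 1 hxω
      rw [Metric.mem_closedBall] at this
      push_cast at this
      linarith
    rw [hx, hη.eq_zero x (by linarith), zero_mul, hJz x hxΩ (Or.inl (by linarith)), sub_zero]
  · filter_upwards [hzero] with x hx hxN
    rw [← sub_eq_zero]
    refine hx ?_
    by_contra! hcon
    refine hxN ⟨Metric.mem_closedBall.2 (by linarith), fun h1 => ?_⟩
    linarith [Metric.mem_closedBall.1 h1]
  · obtain ⟨L, hL⟩ := exists_pointwise_clm μ (F := E d) (C := 1)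
      (T := fun x => η x • ContinuousLinearMap.id ℝ (E d))
      (hη.contDiff.continuous.smul continuous_const) fun x => by
        rw [norm_smul, Real.norm_of_nonneg (hη.nonneg x)]
        exact mul_le_one₀ (hη.le_one x) (norm_nonneg _) ContinuousLinearMap.norm_id_le
    set D : L2Vec Ω Λ β := (q - j).2 - L p.2
    have hD : ∀ᵐ x ∂μ, D x = (q - j).2 x - η x • p.2 x := by
      filter_upwards [Lp.coeFn_sub (q - j).2 (L p.2), hL p.2] with x h1 h2
      rw [h1, Pi.sub_apply, h2]
      simp
    have hDle : ∀ᵐ x ∂μ, ‖D x‖ₑ ^ 2 ≤ 2 * (‖p.1 x • gradient η x‖ₑ ^ 2 + ‖gradient J x‖ₑ ^ 2) := by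
      filter_upwards [hD, hw2] with x h1 h2
      rw [h1, h2, sub_eq_add_neg]
      refine (enorm_add_sq_le _ _).trans ?_
      rw [enorm_neg]
      gcongr
      by_cases hx : J x = 0
      · rw [indicator_of_notMem (by simpa using hx), enorm_zero]
        exact zero_le
      · rw [indicator_of_mem (by simpa using hx)]
    set N := closedBall v (R + 10 * H) \ closedBall v (R - 10 * H) with hN
    have hNm : MeasurableSet N :=
      Metric.isClosed_closedBall.measurableSet.diff Metric.isClosed_closedBall.measurableSet
    classical
    set A : Set (E d) := {x | R - 2 * H < dist x v ∧ dist x v < R + 3 * H} with hA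
    -- The elements that meet the annulus A, off which D vanishes. Each is given a point in A, so
    -- that the ball of radius 6H about that point stays in N.
    set F : Finset (Finset (E d)) :=
      M.finite_elements.toFinset.filter fun s => (convexHull ℝ (s : Set (E d)) ∩ A).Nonempty with hF
    have hFmem : ∀ s ∈ F, s ∈ M.elements ∧ (convexHull ℝ (s : Set (E d)) ∩ A).Nonempty := fun s hs =>
      by simpa [hF] using hs
    have hy : ∀ s : Finset (E d), ∃ y, s ∈ F → y ∈ convexHull ℝ (s : Set (E d)) ∩ A := fun s => by
      by_cases hs : s ∈ F
      · obtain ⟨y, hy⟩ := (hFmem s hs).2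
        exact ⟨y, fun _ => hy⟩
      · exact ⟨0, fun h => absurd h hs⟩
    choose y hy using hy
    have hDm : AEMeasurable (fun x => ‖D x‖ₑ ^ 2) μ := (Lp.aestronglyMeasurable D).enorm.pow_const 2
    have hTm : ∀ s : Finset (E d), MeasurableSet (convexHull ℝ (s : Set (E d))) := fun s =>
      (isCompact_convexHull s).isClosed.measurableSet
    have hcover : ∀ᵐ x ∂μ, ‖D x‖ₑ ^ 2 ≤
        ∑ s ∈ F, (convexHull ℝ (s : Set (E d))).indicator (fun x => ‖D x‖ₑ ^ 2) x := by
      filter_upwards [hD, hzero, hmemΩ] with x h1 h2 hxΩ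
      by_cases hxA : x ∈ A
      · obtain ⟨s, hse, hxs⟩ := M.exists_element hΩ.isOpen (subset_closure hxΩ)
        have hsF : s ∈ F := by
          simp only [hF, Finset.mem_filter, Set.Finite.mem_toFinset]
          exact ⟨hse, x, hxs, hxA⟩
        refine le_trans (le_of_eq ?_) (Finset.single_le_sum (f := fun s : Finset (E d) =>
          (convexHull ℝ (s : Set (E d))).indicator (fun x => ‖D x‖ₑ ^ 2) x) (fun _ _ => zero_le) hsF)
        rw [indicator_of_mem hxs]
      · rw [h1, h2 ?_]
        · simp
        · by_contra! hcon
          exact hxA hcon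
    calc ∫⁻ x in N, ‖(q - j).2 x - η x • p.2 x‖ₑ ^ 2 ∂μ = ∫⁻ x in N, ‖D x‖ₑ ^ 2 ∂μ := by
          refine lintegral_congr_ae (ae_restrict_of_ae ?_)
          filter_upwards [hD] with x hx
          rw [hx]
      _ ≤ ∫⁻ x, ‖D x‖ₑ ^ 2 ∂μ := setLIntegral_le_lintegral _ _
      _ ≤ ∫⁻ x, ∑ s ∈ F, (convexHull ℝ (s : Set (E d))).indicator (fun x => ‖D x‖ₑ ^ 2) x ∂μ :=
          lintegral_mono_ae hcover
      _ = ∑ s ∈ F, ∫⁻ x in convexHull ℝ (s : Set (E d)), ‖D x‖ₑ ^ 2 ∂μ := by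
          rw [lintegral_finsetSum' _ fun s _ => hDm.indicator (hTm s)]
          exact Finset.sum_congr rfl fun s _ => lintegral_indicator (hTm s) _
      _ ≤ ∑ s ∈ F, C * ∫⁻ x in closedBall (y s) (6 * H), ‖p.2 x‖ₑ ^ 2 ∂μ :=
          Finset.sum_le_sum fun s hsF => hC Λ hΛ M H hs hHR v R η hη p hp q.1 hq1 D hDle s
            (hFmem s hsF).1 (y s) (hy s hsF).1
      _ = C * ∑ s ∈ F, ∫⁻ x in closedBall (y s) (6 * H), ‖p.2 x‖ₑ ^ 2 ∂μ := by rw [Finset.mul_sum]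
      _ ≤ C * (ENNReal.ofReal ((7 / σ) ^ d) * ∫⁻ x in N, ‖p.2 x‖ₑ ^ 2 ∂μ) := by
          refine mul_le_mul' le_rfl (sum_setLIntegral_le
            (fun s _ => Metric.isClosed_closedBall.measurableSet) (fun s hsF x hx => ?_) hNm
            (fun x F' hF' hx => ?_) ((Lp.aestronglyMeasurable p.2).enorm.pow_const 2))
          · obtain ⟨-, h1, h2⟩ := hy s hsF
            rw [Metric.mem_closedBall] at hx
            refine ⟨Metric.mem_closedBall.2 (by linarith [dist_triangle x (y s) v]), fun h3 => ?_⟩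
            rw [Metric.mem_closedBall] at h3
            linarith [dist_triangle (y s) x v, dist_comm x (y s)]
          · have := hs.card_le (x := x) (r := 6) (by norm_num) (F := F')
              (fun s hs' => (hFmem s (hF' hs')).1) fun s hs' => ⟨y s, (hy s (hF' hs')).1, by
                rw [Metric.mem_closedBall, dist_comm]
                exact Metric.mem_closedBall.1 (hx s hs')⟩
            rw [← ENNReal.ofReal_natCast]
            refine ENNReal.ofReal_le_ofReal (this.trans (le_of_eq ?_))
            norm_num
      _ = _ := by
          rw [ENNReal.coe_mul, mul_assoc]
          rfl

end Mesh

/-- Hole filling. The truncation w with R = r + 10H is zero on ω_{v,1}, so F w = 0, and testing with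
it gives X ≤ aY, where X is the square integral of the gradient off the larger ball and Y that over
the annulus between r and r + 20H. Adding aX to both sides gives (1 + a)X ≤ a(X + Y), whence the
factor a/(1 + a). -/
theorem exists_energy_decay (hc : 0 < c) (hℓ : ℓ < d)
    (hβ : β ∈ Ioo (-(((d : ℝ) - ℓ) / 2)) (((d : ℝ) - ℓ) / 2)) (hΩ : IsLipschitzDomain Ω)
    {σ R₀ γ₁ γ₂ : ℝ} (hσ : 0 < σ) (hR₀ : 0 < R₀) (hγ₁ : 0 < γ₁) (hγ₂ : 0 < γ₂) :
    ∃ θ : ℝ, 0 < θ ∧ θ < 1 ∧ ∀ Λ : Set (E d), IsRegularSet ℓ c Λ →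
      ∀ A : E d → Matrix (Fin d) (Fin d) ℝ, IsCoefficient Ω γ₁ γ₂ A →
      ∀ (M : Mesh Ω) (H : ℝ), M.HasSize H σ → H ≤ R₀ → ∀ v, ∀ F : M.fineSpace Λ β →L[ℝ] ℝ,
      (∀ w ∈ M.fineSpaceOn Λ β (Ω \ M.patch v 1), F w = 0) → ∀ u : M.fineSpace Λ β,
      (∀ w : M.fineSpace Λ β, energy A u.1.2 w.1.2 = F w) → ∀ r : ℝ, 0 ≤ r →
      ∫⁻ x in (closedBall v (r + 20 * H))ᶜ, ‖u.1.2 x‖ₑ ^ 2 ∂(wMeasure Ω Λ β) ≤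
        ENNReal.ofReal θ * ∫⁻ x in (closedBall v r)ᶜ, ‖u.1.2 x‖ₑ ^ 2 ∂(wMeasure Ω Λ β) := by
  obtain ⟨C, hC⟩ := Mesh.exists_truncation (d := d) hc hℓ hβ hΩ hσ hR₀
  set a : ℝ := γ₂ / 2 * (1 + C) / γ₁ with ha
  have ha0 : 0 < a := by positivity
  refine ⟨a / (1 + a), by positivity, (div_lt_one (by positivity)).2 (by linarith),
    fun Λ hΛ A hA M H hs hHR v F hF u hu r hr => ?_⟩
  have hH := hs.pos
  obtain ⟨η, hηc, hη0, hη1, hηe, hη⟩ := hC Λ hΛ M H hs hHR v (r + 10 * H) (by linarith)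
  obtain ⟨w, hw, hw1, hw2, hw3⟩ := hη u.1 u.2
  rw [show r + 10 * H - 10 * H = r by ring, show r + 10 * H + 10 * H = r + 20 * H by ring] at hw2 hw3
  set μ := wMeasure Ω Λ β
  set N := closedBall v (r + 20 * H) \ closedBall v r with hN
  have hNm : MeasurableSet N :=
    Metric.isClosed_closedBall.measurableSet.diff Metric.isClosed_closedBall.measurableSet
  have hSm : MeasurableSet (closedBall v (r + 20 * H))ᶜ :=
    Metric.isClosed_closedBall.measurableSet.compl
  have hF0 : F ⟨w, hw⟩ = 0 := hF _ (hw1.mono fun x hx hxΩ => hx (by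
    by_contra h1
    exact hxΩ.2 ⟨hxΩ.1, h1⟩))
  have key := hA.energy_estimate hγ₁ hγ₂ (G := u.1.2) (W := w.2) ((hu ⟨w, hw⟩).trans hF0)
    hηc hη0 hη1 hSm hNm (fun x hx => hηe x (by
      rw [mem_compl_iff, Metric.mem_closedBall] at hx
      linarith)) hw2
  have hsplit : ∫⁻ x in (closedBall v r)ᶜ, ‖u.1.2 x‖ₑ ^ 2 ∂μ =
      (∫⁻ x in (closedBall v (r + 20 * H))ᶜ, ‖u.1.2 x‖ₑ ^ 2 ∂μ) + ∫⁻ x in N, ‖u.1.2 x‖ₑ ^ 2 ∂μ := by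
    rw [← lintegral_union hNm]
    · congr 2
      ext x
      have : x ∈ closedBall v r → x ∈ closedBall v (r + 20 * H) := fun h =>
        Metric.closedBall_subset_closedBall (by linarith) h
      simp only [hN, mem_compl_iff, mem_union, Set.mem_sdiff]
      tauto
    · exact disjoint_left.2 fun x h1 h2 => h1 h2.1
  set X := ∫⁻ x in (closedBall v (r + 20 * H))ᶜ, ‖u.1.2 x‖ₑ ^ 2 ∂μ
  set Y := ∫⁻ x in N, ‖u.1.2 x‖ₑ ^ 2 ∂μ
  rw [hsplit]
  have h1 : ENNReal.ofReal γ₁ * X ≤ ENNReal.ofReal γ₁ * (ENNReal.ofReal a * Y) := by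
    refine key.trans ((mul_le_mul' le_rfl (add_le_add le_rfl hw3)).trans (le_of_eq ?_))
    rw [← mul_assoc, ← ENNReal.ofReal_mul hγ₁.le, ha, mul_div_cancel₀ _ hγ₁.ne',
      ENNReal.ofReal_mul (by positivity), ENNReal.ofReal_add zero_le_one C.coe_nonneg, ENNReal.ofReal_one,
      ENNReal.ofReal_coe_nnreal]
    ring
  rw [ENNReal.mul_le_mul_iff_right (by simpa using hγ₁) ENNReal.ofReal_ne_top] at h1
  have h2 : ENNReal.ofReal (1 + a) * X ≤ ENNReal.ofReal a * (X + Y) := by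
    rw [ENNReal.ofReal_add zero_le_one ha0.le, ENNReal.ofReal_one, mul_add, add_mul, one_mul, add_comm]
    exact add_le_add le_rfl h1
  rw [ENNReal.ofReal_div_of_pos (by positivity), ← ENNReal.mul_div_right_comm,
    ENNReal.le_div_iff_mul_le (Or.inl (by simp; positivity)) (Or.inl ENNReal.ofReal_ne_top), mul_comm]
  exact h2

theorem normOn_le_mul_of_lintegral_le {S : Set (E d)} {G : L2Vec Ω Λ β} {t : ℝ} (ht : 0 ≤ t)
    (hΩ : MeasurableSet Ω)
    (h : ∫⁻ x in S, ‖G x‖ₑ ^ 2 ∂(wMeasure Ω Λ β) ≤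
      ENNReal.ofReal (t ^ 2) * ∫⁻ x, ‖G x‖ₑ ^ 2 ∂(wMeasure Ω Λ β)) :
    normOn S G ≤ t * normOn Ω G := by
  have hsq : ∀ y : E d, ENNReal.ofReal (‖y‖ ^ 2) = ‖y‖ₑ ^ 2 := fun y => by
    rw [ENNReal.ofReal_pow (norm_nonneg _), ofReal_norm]
  have hI : ∀ S : Set (E d), ENNReal.ofReal (∫ x in S, ‖G x‖ ^ 2 ∂(wMeasure Ω Λ β)) =
      ∫⁻ x in S, ‖G x‖ₑ ^ 2 ∂(wMeasure Ω Λ β) := fun S => by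
    rw [ofReal_integral_eq_lintegral_ofReal (integrable_norm_sq G).restrict
      (Eventually.of_forall fun x => by positivity)]
    simp only [hsq]
  have hres : (wMeasure Ω Λ β).restrict Ω = wMeasure Ω Λ β := by
    rw [wMeasure_restrict hΩ, inter_self]
  have h1 : ∫⁻ x, ‖G x‖ₑ ^ 2 ∂(wMeasure Ω Λ β) = ∫⁻ x in Ω, ‖G x‖ₑ ^ 2 ∂(wMeasure Ω Λ β) := by
    rw [hres]
  rw [h1, ← hI S, ← hI Ω, ← ENNReal.ofReal_mul (sq_nonneg t), ENNReal.ofReal_le_ofReal_iff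
    (mul_nonneg (sq_nonneg t) (integral_nonneg fun x => by positivity))] at h
  rw [normOn, normOn, ← Real.sqrt_sq ht, ← Real.sqrt_mul (sq_nonneg t)]
  exact Real.sqrt_le_sqrt h

theorem exists_normOn_decay (hc : 0 < c) (hℓ : ℓ < d)
    (hβ : β ∈ Ioo (-(((d : ℝ) - ℓ) / 2)) (((d : ℝ) - ℓ) / 2)) (hΩ : IsLipschitzDomain Ω)
    {γ₁ γ₂ κ τ : ℝ} (hγ₁ : 0 < γ₁) (hγ₂ : 0 < γ₂) (hκ : 0 < κ) (hτ : 0 < τ) :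
    ∃ C θ : ℝ, 0 < C ∧ 0 < θ ∧ θ < 1 ∧ ∀ Λ : Set (E d), IsRegularSet ℓ c Λ →
      ∀ A : E d → Matrix (Fin d) (Fin d) ℝ, IsCoefficient Ω γ₁ γ₂ A →
      ∀ M : Mesh Ω, M.IsShapeRegular κ → M.IsQuasiUniform τ → ∀ v ∈ M.intNodes,
      ∀ F : M.fineSpace Λ β →L[ℝ] ℝ,
      (∀ w ∈ M.fineSpaceOn Λ β (Ω \ M.patch v 1), F w = 0) → ∀ u : M.fineSpace Λ β,
      (∀ w : M.fineSpace Λ β, energy A u.1.2 w.1.2 = F w) → ∀ k : ℕ,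
      normOn (Ω \ M.patch v k) u.1.2 ≤ C * θ ^ k * normOn Ω u.1.2 := by
  have hσ : 0 < κ / τ ^ 2 := by positivity
  -- This bounds the sizes H of all admissible meshes in terms of Ω and τ; the maximum with 1 only
  -- secures positivity.
  have hR₀ : 0 < max (τ * diam (closure Ω)) 1 := lt_max_of_lt_right one_pos
  obtain ⟨q, hq0, hq1, hq⟩ := exists_energy_decay (d := d) hc hℓ hβ hΩ hσ hR₀ hγ₁ hγ₂
  obtain ⟨K, hK0, hK⟩ := Mesh.exists_ball_subset_patch hΩ hσ
  -- The norm decays like q^(n/2) with n = ⌊(k/K - 1)/20⌋. Since n > k/(20K) - 21/20, the exponent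
  -- n/2 is larger than k/(40K) - 21/40.
  refine ⟨q ^ (-(21 / 40 : ℝ)), q ^ (1 / (40 * K)), Real.rpow_pos_of_pos hq0 _,
    Real.rpow_pos_of_pos hq0 _, Real.rpow_lt_one hq0.le hq1 (by positivity),
    fun Λ hΛ A hA M hM1 hM2 v hv F hF u hu k => ?_⟩
  obtain ⟨H, hs, hHR⟩ := M.exists_hasSize hΩ (by omega) hκ hτ hM1 hM2
  have hH := hs.pos
  set X : ℝ → ℝ≥0∞ := fun r => ∫⁻ x in (closedBall v r)ᶜ, ‖u.1.2 x‖ₑ ^ 2 ∂(wMeasure Ω Λ β) with hX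
  have hdecay : ∀ n : ℕ, X (20 * n * H) ≤ ENNReal.ofReal (q ^ n) *
      ∫⁻ x, ‖u.1.2 x‖ₑ ^ 2 ∂(wMeasure Ω Λ β) := fun n => by
    induction n with
    | zero => simpa using setLIntegral_le_lintegral _ _
    | succ n ih =>
      have h1 := hq Λ hΛ A hA M H hs (hHR.trans (le_max_left _ _)) v F hF u hu (20 * n * H)
        (by positivity)
      rw [show 20 * (n : ℝ) * H + 20 * H = 20 * (n + 1 : ℕ) * H by push_cast; ring] at h1
      refine h1.trans ((mul_le_mul' le_rfl ih).trans (le_of_eq ?_))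
      rw [← mul_assoc, ← ENNReal.ofReal_mul hq0.le, pow_succ']
  -- For n > 0 this choice gives 20nK + K ≤ k, so the part of Ω in the ball of radius 20nH lies in
  -- ω_{v,k}. For small k the floor is 0 and the bound is trivial.
  set n := ⌊(k / K - 1) / 20⌋₊ with hn
  have hle : ∫⁻ x in Ω \ M.patch v k, ‖u.1.2 x‖ₑ ^ 2 ∂(wMeasure Ω Λ β) ≤
      ENNReal.ofReal (q ^ n) * ∫⁻ x, ‖u.1.2 x‖ₑ ^ 2 ∂(wMeasure Ω Λ β) := by
    rcases Nat.eq_zero_or_pos n with h0 | h0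
    · rw [h0, pow_zero, ENNReal.ofReal_one, one_mul]
      exact setLIntegral_le_lintegral _ _
    · refine (lintegral_mono_set fun x hx => ?_).trans (hdecay n)
      have h1 : (n : ℝ) ≤ (k / K - 1) / 20 := Nat.floor_le (by
        by_contra! hneg
        exact h0.ne' (Nat.floor_of_nonpos hneg.le))
      intro hxb
      refine hx.2 (hK M H hs v hv x hx.1 k ?_)
      have h2 : dist v x / H ≤ 20 * n := by
        rw [div_le_iff₀ hH, dist_comm]
        exact hxb
      have h3 : 20 * (n : ℝ) + 1 ≤ k / K := by linarith
      rw [le_div_iff₀ hK0] at h3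
      nlinarith
  have hqn : q ^ (n : ℝ) ≤ (q ^ ((n : ℝ) / 2)) ^ 2 := by
    rw [← Real.rpow_natCast, ← Real.rpow_mul hq0.le]
    refine le_of_eq ?_
    congr 1
    push_cast
    ring
  refine (normOn_le_mul_of_lintegral_le (t := q ^ ((n : ℝ) / 2)) (Real.rpow_nonneg hq0.le _)
    hΩ.isOpen.measurableSet (hle.trans ?_)).trans ?_
  · rw [← Real.rpow_natCast]
    exact mul_le_mul' (ENNReal.ofReal_le_ofReal hqn) le_rfl
  · refine mul_le_mul_of_nonneg_right ?_ (Real.sqrt_nonneg _)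
    rw [← Real.rpow_natCast, ← Real.rpow_mul hq0.le, ← Real.rpow_add hq0]
    refine Real.rpow_le_rpow_of_exponent_ge hq0 hq1.le ?_
    have h1 : (k / K - 1) / 20 < n + 1 := Nat.lt_floor_add_one _
    have h2 : 1 / (40 * K) * (k : ℝ) = k / K / 40 := by field_simp
    rw [h2]
    linarith

end Decay

end DistWeightedLOD

end

/-- Exponential decay, away from a patch, of the solutions of the weighted corrector equation. -/
theorem lemmaB2 (d ℓ : ℕ) (hd : d = 2 ∨ d = 3) (hℓ : ℓ < d)
    (β : ℝ) (hβ : β ∈ Set.Ioo (-(((d : ℝ) - ℓ) / 2)) (((d : ℝ) - ℓ) / 2))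
    (Ω : Set (DistWeightedLOD.E d)) (hΩ : DistWeightedLOD.IsLipschitzDomain Ω)
    (c γ₁ γ₂ κ τ : ℝ) (hc : 0 < c) (hγ₁ : 0 < γ₁) (hγ₂ : 0 < γ₂) (hκ : 0 < κ) (hτ : 0 < τ) :
    ∃ C θ : ℝ, 0 < C ∧ 0 < θ ∧ θ < 1 ∧
      ∀ (Λ : Set (DistWeightedLOD.E d)), Λ ⊆ Ω → DistWeightedLOD.IsRegularSet ℓ c Λ →
      ∀ (A : DistWeightedLOD.E d → Matrix (Fin d) (Fin d) ℝ),
        DistWeightedLOD.IsCoefficient Ω γ₁ γ₂ A →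
      ∀ (M : DistWeightedLOD.Mesh Ω), M.IsShapeRegular κ → M.IsQuasiUniform τ →
      ∀ v ∈ M.intNodes,
      ∀ F : M.fineSpace Λ β →L[ℝ] ℝ,
        (∀ w ∈ M.fineSpaceOn Λ β (Ω \ M.patch v 1), F w = 0) →
      ∀ u : M.fineSpace Λ β,
        (∀ w : M.fineSpace Λ β, DistWeightedLOD.energy A u.1.2 w.1.2 = F w) →
      ∀ k : ℕ,
        DistWeightedLOD.normOn (Ω \ M.patch v k) u.1.2 ≤
          C * θ ^ k * DistWeightedLOD.normOn Ω u.1.2 := by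
  obtain ⟨C, θ, hC, hθ, hθ1, h⟩ := DistWeightedLOD.exists_normOn_decay hc hℓ hβ hΩ hγ₁ hγ₂ hκ hτ
  exact ⟨C, θ, hC, hθ, hθ1, fun Λ _ hΛ => h Λ hΛ⟩
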